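/- All groups are finite. A \emph{Carter subgroup} of a group is a nilpotent self-normalizing subgroup. If $B\trianglelefteq A$ and $K$ are subgroups of a group $\Gamma$, then $\mathrm{Aut}_K(A/B)$ denotes the group of automorphisms of $A/B$ induced by conjugation by the elements of $N_K(A)\cap N_K(B)$; in particular $\mathrm{Aut}_\Gamma(S)$ is defined for every composition factor $S$ of $\Gamma$. Let $\Gamma=\Gamma_0>\Gamma_1>\dots>\Gamma_n=1$ be a chief series of $\Gamma$, let $\Gamma_i/\Gamma_{i+1}=T_{i,1}\times\dots\times T_{i,k_i}$ with all $T_{i,j}$ simple, let $\overline K_i$ be a Carter subgroup of $\Gamma/\Gamma_i$ (if there is one), and let $K_i$ be its complete preimage in $\Gamma/\Gamma_{i+1}$ (so $\overline K_0=1$ and $K_0=\Gamma/\Gamma_1$). For these choices $\Gamma$ satisfies condition (E) if for all $i,j$ either $\Gamma/\Gamma_i$ has no Carter subgroup or $\mathrm{Aut}_{K_i}(T_{i,j})$ has a Carter subgroup. Let $\varphi$ be the automorphism of $PSL_2(27)$ induced by a non-trivial automorphism of the field $\mathbb F_{27}$, and let $L=PSL_2(27)\rtimes\langle\varphi\rangle$.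 Let $X=(L\times L)\rtimes \mathrm{Sym}_2$ be the permutation wreath product, in which the transposition interchanges the two coordinates, let $M=L\times L$ be its base group and $H=PSL_2(27)\times PSL_2(27)\le M$. Let $G=(H\rtimes\langle(\varphi,\varphi^{-1})\rangle)\rtimes \mathrm{Sym}_2\le X$. Then: 1. for every composition factor $S$ of $G$, the group $\mathrm{Aut}_G(S)$ has a Carter subgroup; 2. $G\cap M$ is a normal subgroup of $G$ and has a Carter subgroup; 3. $G/(G\cap M)$ is nilpotent; 4. $G$ has no Carter subgroup; moreover, $G$ does not satisfy (E), for any chief series and any of the other choices in (E). Consequently: (a) condition (E) cannot be replaced by the condition on composition factors in 1: there is a finite group $\Gamma$ such that $\mathrm{Aut}_\Gamma(S)$ has a Carter subgroup for every composition factor $S$ of $\Gamma$, but $\Gamma$ has no Carter subgroup and does not satisfy (E), for any of the choices in (E); (b) there is a finite group $\Gamma$ with a normal subgroup $N$ such that $N$ and $\Gamma/N$ have Carter subgroups, but $\Gamma$ has none. -/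

import Mathlib

open scoped MatrixGroups

namespace CarterExample

universe u

section Carter

/-- A Carter subgroup of a group: a nilpotent self-normalizing subgroup. -/
def IsCarter {Γ : Type u} [Group Γ] (K : Subgroup Γ) : Prop :=
  Group.IsNilpotent K ∧ Subgroup.normalizer (K : Set Γ) = K

/-- The group has (contains) a Carter subgroup. -/
def HasCarter (Γ : Type u) [Group Γ] : Prop :=
  ∃ K : Subgroup Γ, IsCarter K

end Carter

section Sections

variable {Γ : Type u} [Group Γ]

/-- `N(A/B) = N(A) ∩ N(B)`, the normalizer of the section `A/B` of `Γ`. -/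
def sectionNormalizer (A B : Subgroup Γ) : Subgroup Γ :=
  Subgroup.normalizer (A : Set Γ) ⊓ Subgroup.normalizer (B : Set Γ)

/-- Conjugation by an element of `N(A) ∩ N(B)`, as an automorphism of `A`. -/
def conjOn (A B : Subgroup Γ) : sectionNormalizer A B →* MulAut A :=
  A.normalizerMonoidHom.comp (Subgroup.inclusion inf_le_left)

theorem conjOn_apply (A B : Subgroup Γ) (x : sectionNormalizer A B) (a : A) :
    ((conjOn A B x a : A) : Γ) = x * a * (x : Γ)⁻¹ := rfl

theorem map_conjOn (A B : Subgroup Γ) (x : sectionNormalizer A B) :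
    (B.subgroupOf A).map (conjOn A B x : A →* A) = B.subgroupOf A := by
  ext a
  constructor
  · rintro ⟨b, hb, rfl⟩
    exact (Subgroup.mem_normalizer_iff.mp x.2.2 b).mp hb
  · intro ha
    refine ⟨conjOn A B x⁻¹ a, ?_, ?_⟩
    · exact (Subgroup.mem_normalizer_iff.mp (x⁻¹).2.2 a).mp ha
    · apply Subtype.ext
      change (x : Γ) * (((x⁻¹ : sectionNormalizer A B) : Γ) * a *
        ((x⁻¹ : sectionNormalizer A B) : Γ)⁻¹) * (x : Γ)⁻¹ = a
      simp [mul_assoc]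

/-- The homomorphism `N(A/B) → Aut(A/B)` given by conjugation: `x` sends the coset of `a` to the
coset of `x a x⁻¹`. -/
def sectionConj (A B : Subgroup Γ) [(B.subgroupOf A).Normal] :
    sectionNormalizer A B →* MulAut (A ⧸ B.subgroupOf A) where
  toFun x := QuotientGroup.congr _ _ (conjOn A B x) (map_conjOn A B x)
  map_one' := by
    ext q
    induction q using QuotientGroup.induction_on with
    | H a => simp
  map_mul' x y := by
    ext q
    induction q using QuotientGroup.induction_on with
    | H a => simp

/-- `Aut_K(A/B)`: the group of automorphisms of the section `A/B` induced by the elements of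
`N_K(A/B) = K ∩ N(A) ∩ N(B)`. -/
def autSection (K A B : Subgroup Γ) [(B.subgroupOf A).Normal] :
    Subgroup (MulAut (A ⧸ B.subgroupOf A)) :=
  (K.subgroupOf (sectionNormalizer A B)).map (sectionConj A B)

end Sections

section CompositionFactors

/-- A subnormal series `Γ = Γ₀ ≥ Γ₁ ≥ … ≥ Γₙ = 1`, each term normal in the preceding one. -/
structure SubnormalSeries (Γ : Type u) [Group Γ] where
  length : ℕ
  term : Fin (length + 1) → Subgroup Γ
  term_zero : term 0 = ⊤
  term_last : term (Fin.last length) = ⊥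
  le : ∀ i : Fin length, term i.succ ≤ term i.castSucc
  normal : ∀ i : Fin length, ((term i.succ).subgroupOf (term i.castSucc)).Normal

attribute [instance] SubnormalSeries.normal

/-- A composition series: all factors are simple (possibly of prime order). -/
def SubnormalSeries.IsComposition {Γ : Type u} [Group Γ] (s : SubnormalSeries Γ) : Prop :=
  ∀ i : Fin s.length,
    IsSimpleGroup (s.term i.castSucc ⧸ (s.term i.succ).subgroupOf (s.term i.castSucc))

/-- For every composition factor `S` of `Γ` (in every composition series), the group `Aut_Γ(S)`
contains a Carter subgroup. -/
def CompositionFactorCondition (Γ : Type u) [Group Γ] : Prop :=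
  ∀ s : SubnormalSeries Γ, s.IsComposition → ∀ i : Fin s.length,
    HasCarter (autSection ⊤ (s.term i.castSucc) (s.term i.succ))

end CompositionFactors

section ConditionE

/-- A chief series `Γ = Γ₀ > Γ₁ > … > Γₙ = 1`: all terms are normal in `Γ`, and no normal subgroup
of `Γ` lies strictly between two consecutive terms. -/
structure ChiefSeries (Γ : Type u) [Group Γ] where
  length : ℕ
  term : Fin (length + 1) → Subgroup Γ
  term_zero : term 0 = ⊤
  term_last : term (Fin.last length) = ⊥
  normal : ∀ i, (term i).Normal
  lt : ∀ i : Fin length, term i.succ < term i.castSucc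
  minimal : ∀ (i : Fin length) (N : Subgroup Γ), N.Normal →
    term i.succ ≤ N → N ≤ term i.castSucc → N = term i.succ ∨ N = term i.castSucc

attribute [instance] ChiefSeries.normal

/-- `N` is the internal direct product of the simple subgroups `T 0, …, T (k - 1)`. -/
structure IsSimpleDecomposition {Q : Type u} [Group Q] (N : Subgroup Q) {k : ℕ}
    (T : Fin k → Subgroup Q) : Prop where
  simple : ∀ j, IsSimpleGroup (T j)
  commute : ∀ j l, j ≠ l → ∀ x ∈ T j, ∀ y ∈ T l, Commute x y
  independent : iSupIndep T
  iSup_eq : ⨆ j, T j = N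

/-- The choices entering condition (E): a chief series `Γ = Γ₀ > Γ₁ > … > Γₙ = 1`, for every `i` a
decomposition `Γᵢ/Γᵢ₊₁ = Tᵢ,₁ × … × Tᵢ,ₖ` into simple subgroups (as subgroups of `Γ/Γᵢ₊₁`), and
for every `i` a Carter subgroup of `Γ/Γᵢ` if there is one. For `i = 0` the group `Γ/Γ₀` is trivial
and the Carter subgroup is the trivial group. -/
structure ConditionEData (Γ : Type u) [Group Γ] where
  series : ChiefSeries Γ
  numFactors : Fin series.length → ℕ
  factor : ∀ i : Fin series.length, Fin (numFactors i) → Subgroup (Γ ⧸ series.term i.succ)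
  decomposition : ∀ i : Fin series.length,
    IsSimpleDecomposition
      ((series.term i.castSucc).map (QuotientGroup.mk' (series.term i.succ))) (factor i)
  carter : ∀ i : Fin series.length, Subgroup (Γ ⧸ series.term i.castSucc)
  isCarter : ∀ i : Fin series.length,
    HasCarter (Γ ⧸ series.term i.castSucc) → IsCarter (carter i)

variable {Γ : Type u} [Group Γ]

/-- `Kᵢ`: the complete preimage in `Γ/Γᵢ₊₁` of the chosen subgroup of `Γ/Γᵢ`. For `i = 0` this is
the whole of `Γ/Γ₁`. -/
def ConditionEData.preimage (D : ConditionEData Γ) (i : Fin D.series.length) :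
    Subgroup (Γ ⧸ D.series.term i.succ) :=
  (D.carter i).comap
    (QuotientGroup.map (D.series.term i.succ) (D.series.term i.castSucc) (MonoidHom.id Γ)
      (D.series.lt i).le)

/-- Condition (E), for the given choices: for all `i, j`, either `Γ/Γᵢ` has no Carter subgroup, or
`Aut_{Kᵢ}(Tᵢ,ⱼ)` contains a Carter subgroup. -/
def ConditionEData.Holds (D : ConditionEData Γ) : Prop :=
  ∀ (i : Fin D.series.length) (j : Fin (D.numFactors i)),
    ¬ HasCarter (Γ ⧸ D.series.term i.castSucc) ∨
      HasCarter (autSection (D.preimage i) (D.factor i j) ⊥)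

end ConditionE

section Construction

variable {F : Type u} [Field F]

/-- The automorphism of `SL₂(F)` that applies the automorphism `τ` of `F` to all matrix entries. -/
def slAut (τ : F ≃+* F) : MulAut SL(2, F) where
  toFun := Matrix.SpecialLinearGroup.map (τ : F →+* F)
  invFun := Matrix.SpecialLinearGroup.map (τ.symm : F →+* F)
  left_inv A := by ext i j; simp
  right_inv A := by ext i j; simp
  map_mul' := map_mul _

/-- The field automorphism of `PSL₂(F)` induced by the automorphism `τ` of `F`. -/
def fieldAut (τ : F ≃+* F) : MulAut PSL(2, F) :=
  QuotientGroup.congr _ _ (slAut τ)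
    (Subgroup.characteristic_iff_map_eq.mp inferInstance (slAut τ))

/-- `L = PSL₂(F) ⋊ ⟨φ⟩`, where `⟨φ⟩ ≤ Aut(PSL₂(F))` is generated by the field automorphism `φ`
induced by `τ`. -/
abbrev L (τ : F ≃+* F) : Type u :=
  PSL(2, F) ⋊[(Subgroup.zpowers (fieldAut τ)).subtype] (Subgroup.zpowers (fieldAut τ))

/-- The element `φ` of `L`. -/
def phi (τ : F ≃+* F) : L τ :=
  SemidirectProduct.inr ⟨fieldAut τ, Subgroup.mem_zpowers _⟩

/-- `X = (L × L) ⋊ Sym₂`, the permutation wreath product of `L` and `Sym₂`: a permutation `σ` acts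
on `L × L` by permuting the coordinates. -/
abbrev X (τ : F ≃+* F) : Type u :=
  (Fin 2 → L τ) ⋊[(mulAutArrow : Equiv.Perm (Fin 2) →* MulAut (Fin 2 → L τ))] Equiv.Perm (Fin 2)

/-- `M = L × L`, the base group of `X`. -/
def M (τ : F ≃+* F) : Subgroup (X τ) :=
  (SemidirectProduct.inl : (Fin 2 → L τ) →* X τ).range

/-- `H = PSL₂(F) × PSL₂(F)`, as a subgroup of the base group of `X`. -/
def H (τ : F ≃+* F) : Subgroup (X τ) :=
  (Subgroup.pi Set.univ
    (fun _ : Fin 2 => (SemidirectProduct.inl : PSL(2, F) →* L τ).range)).map SemidirectProduct.inl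

/-- `G = (H ⋊ ⟨(φ, φ⁻¹)⟩) ⋊ Sym₂`, the subgroup of `X` generated by `H`, the element `(φ, φ⁻¹)` of
the base group, and the complement `Sym₂`. -/
def G (τ : F ≃+* F) : Subgroup (X τ) :=
  (H τ ⊔ Subgroup.zpowers (SemidirectProduct.inl ![phi τ, (phi τ)⁻¹])) ⊔
    (SemidirectProduct.inr : Equiv.Perm (Fin 2) →* X τ).range

end Construction

end CarterExample

/-! Write S = PSL₂(27) and let π : L → ⟨φ⟩ be the projection, with kernel S. By `eq_twist`, G
consists of the elements (x, y)σ with π x · π y = 1, which is the group `twist π`; here G ∩ M is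
`twistBase π` and H = S × S is `kerBase π`. The swap inverts (φ, φ⁻¹) modulo H, so G/H is Sym₃. The
group theory is done for an abstract π, and the facts about PSL₂(27) enter as hypotheses.

The example works because S has no Carter subgroup, while adjoining φ creates one. In S the
centralizer of an element that is not an involution is abelian and there is no element of order 4 (2
= -1 is not a square in the field). Hence a Carter subgroup of S would be abelian and would contain
the normalizer of one of its Sylow subgroups; Burnside's transfer theorem excludes this
(`not_hasCarter_of_centralizers`). In L, on the other hand, the 3-group U ⋊ ⟨φ⟩, with U
unitriangular, is self-normalizing: φ rules out every diagonal entry other than ±1. Pairs of such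
elements give a Carter 3-subgroup of G ∩ M (`isCarterIn_twistBase`). A non-abelian composition
factor of G has G ∩ M as its section normalizer, so its automorphism group is a quotient of G ∩ M,
and Carter p-subgroups survive in quotients (`HasCarter.of_surjective`). The other factors have
abelian automorphism groups.

Condition (E) fails at the bottom chief factor H. A Carter subgroup of G/H ≅ Sym₃ meets (G ∩ M)/H
trivially, so its preimage contains no element acting on a factor S as an outer automorphism, and
the induced group is Inn S ≅ S (`not_holds_twist`).

Suppose that G had a Carter subgroup K (`not_hasCarter_twist`). If K contains an element outside M,
nilpotency forces K ∩ M ≤ H, and the coordinates of K yield a Carter subgroup of S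
(`hasCarter_of_mem_swap`). If K ≤ H, the projections of K do the same (`hasCarter_of_le_base`). In
the remaining case K ≤ M and K is not contained in H. Then K is a 3-group: the centralizer in S of a
field automorphism is PSL₂(3) ≅ Alt₄, whose four-group and 3-elements cannot lie together in a
nilpotent group (`eq_one_of_coprime_mem`). So K would be a self-normalizing Sylow 3-subgroup of G
inside the proper normal subgroup G ∩ M, against Frattini's argument. -/

namespace CarterExample

open Subgroup

/-! ### Nilpotent subgroups, Sylow theory and Carter subgroups -/

section General

variable {Γ : Type*} [Group Γ]

theorem mem_normalizer_of_forall_conj_mem {K : Subgroup Γ} [Finite K] {g : Γ}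
    (h : ∀ k ∈ K, g * k * g⁻¹ ∈ K) : g ∈ normalizer (K : Set Γ) := by
  have hle : K.map (MulAut.conj g).toMonoidHom ≤ K := by
    rintro _ ⟨k, hk, rfl⟩
    exact h k hk
  have heq : K.map (MulAut.conj g).toMonoidHom = K := by
    refine Subgroup.eq_of_le_of_card_ge hle ?_
    rw [Nat.card_congr (K.equivMapOfInjective _ (MulAut.conj g).injective).toEquiv.symm]
  rw [mem_normalizer_iff]
  refine fun k => ⟨h k, fun hk : g * k * g⁻¹ ∈ K => ?_⟩
  rw [← heq] at hk
  obtain ⟨k', hk', he⟩ := hk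
  have : k' = k := (MulAut.conj g).injective he
  exact this ▸ hk'

/-- Normalizers grow in nilpotent groups. This is how a Carter subgroup is shown to equal any
nilpotent overgroup in which it stays self-normalizing. -/
theorem eq_of_le_of_nilpotent {A P : Subgroup Γ} (hAP : A ≤ P) [hP : Group.IsNilpotent P]
    (h : ∀ g ∈ P, g ∈ normalizer (A : Set Γ) → g ∈ A) : A = P := by
  by_contra hne
  have hlt : A.subgroupOf P < ⊤ := by
    rw [lt_top_iff_ne_top, Ne, subgroupOf_eq_top]
    exact fun h' => hne (le_antisymm hAP h')
  have h1 := Group.normalizerCondition_of_isNilpotent (G := P) _ hlt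
  apply h1.not_ge
  intro g hg
  rw [mem_subgroupOf]
  refine h g g.2 ?_
  rw [mem_normalizer_iff] at hg ⊢
  refine fun k => ⟨fun hk => ?_, fun hk => ?_⟩
  · exact (hg ⟨k, hAP hk⟩).1 hk
  · have hkP : k ∈ P := by
      have := P.mul_mem (P.mul_mem (P.inv_mem g.2) (hAP hk)) g.2
      simpa [mul_assoc] using this
    exact (hg ⟨k, hkP⟩).2 hk

/-- The decomposition of a finite nilpotent group into its p-part `A` and p′-part `B`. The last
clause identifies `A` as the set of all p-elements of `K`. The complement comes from
Schur–Zassenhaus. -/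
theorem exists_isPGroup_mul_coprime (K : Subgroup Γ) [Finite K] [Group.IsNilpotent K]
    (p : ℕ) [hp : Fact p.Prime] :
    ∃ A B : Subgroup Γ, A ≤ K ∧ B ≤ K ∧ IsPGroup p A ∧ (Nat.card B).Coprime p ∧
      (∀ a ∈ A, ∀ b ∈ B, Commute a b) ∧ (∀ k ∈ K, ∃ a ∈ A, ∃ b ∈ B, k = a * b) ∧
      (∀ x ∈ K, (∃ n, x ^ p ^ n = 1) → x ∈ A) := by
  let P : Sylow p K := default
  have hPn : (P : Subgroup K).Normal := inferInstance
  obtain ⟨B, hB⟩ := exists_right_complement'_of_coprime (N := (P : Subgroup K))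
    (by
      obtain ⟨n, hn⟩ := IsPGroup.iff_card.mp P.2
      rw [hn]
      exact Nat.Coprime.pow_left _ ((Nat.Prime.coprime_iff_not_dvd hp.out).2 P.not_dvd_index))
  have hcard : (Nat.card B).Coprime p := by
    rw [← hB.symm.index_eq_card]
    exact ((Nat.Prime.coprime_iff_not_dvd hp.out).2 P.not_dvd_index).symm
  have hcom : ∀ a ∈ (P : Subgroup K), ∀ b ∈ B, Commute a b := by
    intro a ha b hb
    -- This join contains a Sylow q-subgroup for every prime q, since normal Sylow subgroups for
    -- distinct primes commute; so no prime divides its index.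
    have hcent : centralizer ((P : Subgroup K) : Set K) ⊔ P = ⊤ := by
      rw [← index_eq_one]
      by_contra hne
      obtain ⟨q, hq, hdvd⟩ := Nat.exists_prime_and_dvd hne
      have : Fact q.Prime := ⟨hq⟩
      rcases eq_or_ne q p with rfl | hqp
      · exact P.not_dvd_index (hdvd.trans (index_dvd_of_le le_sup_right))
      · let Q : Sylow q K := default
        refine Q.not_dvd_index (hdvd.trans (index_dvd_of_le (le_trans ?_ le_sup_left)))
        intro x hx
        rw [mem_centralizer_iff]
        intro y hy
        exact commute_of_normal_of_disjoint _ _ hPn (inferInstance : (Q : Subgroup K).Normal)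
          (IsPGroup.disjoint_of_ne p q hqp.symm _ _ P.2 Q.2) y x hy hx
    have hbtop : b ∈ centralizer ((P : Subgroup K) : Set K) ⊔ P := by
      rw [hcent]
      exact mem_top b
    obtain ⟨c, hc, d, hd, rfl⟩ := mem_sup_of_normal_right.1 hbtop
    have hcd : Commute c d := ((mem_centralizer_iff.1 hc) d hd).symm
    obtain ⟨n, hn⟩ := P.2 ⟨d, hd⟩
    have hn' : d ^ p ^ n = 1 := by
      have := congrArg (P : Subgroup K).subtype hn
      rwa [map_pow, map_one] at this
    -- The power kills `d` and leaves a power of `c`, which centralizes `P`. As `c * d` has order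
    -- prime to p, it is itself a power of this power.
    have h1 : Commute a ((c * d) ^ p ^ n) := by
      rw [hcd.mul_pow, hn', mul_one]
      exact Commute.pow_right ((mem_centralizer_iff.1 hc) a ha) _
    have hcop : (orderOf (c * d)).Coprime (p ^ n) := by
      refine Nat.Coprime.pow_right _ (Nat.Coprime.coprime_dvd_left ?_ hcard)
      rw [← Subgroup.orderOf_mk _ hb]
      exact orderOf_dvd_natCard _
    obtain ⟨m, hm⟩ := exists_pow_eq_self_of_coprime hcop.symm
    rw [← hm]
    exact h1.pow_right m
  refine ⟨(P : Subgroup K).map K.subtype, B.map K.subtype, map_subtype_le _, map_subtype_le _,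
    P.2.map _, ?_, ?_, ?_, ?_⟩
  · rwa [Nat.card_congr (B.equivMapOfInjective _ K.subtype_injective).toEquiv.symm]
  · rintro _ ⟨a, ha, rfl⟩ _ ⟨b, hb, rfl⟩
    exact (hcom a ha b hb).map K.subtype
  · intro k hk
    obtain ⟨⟨⟨a, ha⟩, ⟨b, hb⟩⟩, hab⟩ := hB.2 ⟨k, hk⟩
    exact ⟨a, ⟨a, ha, rfl⟩, b, ⟨b, hb, rfl⟩, congrArg Subtype.val hab.symm⟩
  · rintro x hx ⟨n, hn⟩
    refine ⟨⟨x, hx⟩, ?_, rfl⟩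
    have hz : IsPGroup p (zpowers (⟨x, hx⟩ : K)) := by
      rintro ⟨_, m, rfl⟩
      refine ⟨n, Subtype.ext (Subtype.ext ?_)⟩
      simp only [OneMemClass.coe_one, SubgroupClass.coe_zpow,
        SubmonoidClass.coe_pow]
      rw [← zpow_natCast, ← zpow_mul, mul_comm, zpow_mul, zpow_natCast, hn, one_zpow]
    have hs : IsPGroup p ((P : Subgroup K) ⊔ zpowers (⟨x, hx⟩ : K) : Subgroup K) :=
      IsPGroup.to_sup_of_normal_left P.2 hz
    rw [← P.3 hs le_sup_left]
    exact mem_sup_right (mem_zpowers _)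

theorem isPGroup_of_forall_coprime {K : Subgroup Γ} [Finite K] {p : ℕ}
    {A B : Subgroup Γ} (hA : IsPGroup p A) (hK : ∀ k ∈ K, ∃ a ∈ A, ∃ b ∈ B, k = a * b)
    (hB : ∀ b ∈ B, b = 1) : IsPGroup p K := by
  rintro ⟨k, hk⟩
  obtain ⟨a, ha, b, hb, rfl⟩ := hK k hk
  obtain ⟨n, hn⟩ := hA ⟨a, ha⟩
  refine ⟨n, Subtype.ext ?_⟩
  simpa [hB b hb] using congrArg Subtype.val hn

theorem eq_one_of_pow_eq_one_of_coprime {x : Γ} {m n : ℕ} (hm : x ^ m = 1) (hn : x ^ n = 1)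
    (h : m.Coprime n) : x = 1 := by
  rw [← orderOf_eq_one_iff]
  exact Nat.eq_one_of_dvd_coprimes h (orderOf_dvd_of_pow_eq_one hm) (orderOf_dvd_of_pow_eq_one hn)

theorem HasCarter.of_mulEquiv {A B : Type*} [Group A] [Group B] (e : A ≃* B) (h : HasCarter A) :
    HasCarter B := by
  obtain ⟨K, hn, hK⟩ := h
  refine ⟨K.map e.toMonoidHom, ?_, ?_⟩
  · exact Group.nilpotent_of_mulEquiv (K.equivMapOfInjective e.toMonoidHom e.injective)
  · have := (map_equiv_normalizer_eq K e)
    rw [hK] at this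
    exact this.symm

theorem hasCarter_of_commute {A : Type*} [Group A] (h : ∀ a b : A, a * b = b * a) :
    HasCarter A := by
  refine ⟨⊤, ?_, ?_⟩
  · let : CommGroup (⊤ : Subgroup A) :=
      { (inferInstance : Group (⊤ : Subgroup A)) with
        mul_comm := fun a b => Subtype.ext (h a b) }
    exact CommGroup.isNilpotent
  · rw [eq_top_iff]
    exact le_normalizer

/-- A self-normalizing `p`-subgroup is a Sylow `p`-subgroup. -/
theorem IsPGroup.eq_of_le_of_normalizer [Finite Γ] {p : ℕ} [Fact p.Prime] {Q P : Subgroup Γ}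
    (hP : IsPGroup p P) (hQP : Q ≤ P)
    (h : ∀ g ∈ normalizer (Q : Set Γ), (∃ n, g ^ p ^ n = 1) → g ∈ Q) : Q = P := by
  have := hP.isNilpotent
  refine eq_of_le_of_nilpotent hQP fun g hg hgn => h g hgn ?_
  obtain ⟨n, hn⟩ := hP ⟨g, hg⟩
  exact ⟨n, congrArg Subtype.val hn⟩

/-- A self-normalizing p-subgroup `Q` is Sylow. If `f g` normalizes the image of `Q`, then `Q` and
its conjugate by `g` are Sylow subgroups of the preimage `N` of that image, hence conjugate in `N`;
so `g` lies in `N` times the normalizer of `Q`, which is `N`. -/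
theorem HasCarter.of_surjective {A B : Type*} [Group A] [Finite A] [Group B] {p : ℕ}
    [Fact p.Prime] {Q : Subgroup A} (hQ : IsPGroup p Q) (hN : normalizer (Q : Set A) = Q)
    (f : A →* B) (hf : Function.Surjective f) : HasCarter B := by
  have : Finite B := Finite.of_surjective f hf
  refine ⟨Q.map f, (hQ.map f).isNilpotent, le_antisymm ?_ le_normalizer⟩
  intro b hb
  obtain ⟨g, rfl⟩ := hf b
  have hmax : ∀ P : Subgroup A, IsPGroup p P → Q ≤ P → P = Q := fun P hP hQP =>
    (IsPGroup.eq_of_le_of_normalizer hP hQP fun g hg _ => by rwa [hN] at hg).symm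
  let N : Subgroup A := (Q.map f).comap f
  have hQN : Q ≤ N := le_comap_map f Q
  let S : Sylow p A := ⟨Q, hQ, fun {P} hP hQP => hmax P hP hQP⟩
  -- conjugate of `Q` by `g` lies in `N`
  let S' : Sylow p A := g • S
  have hS' : (S' : Subgroup A) ≤ N := by
    rintro _ ⟨q, hq, rfl⟩
    have : f g * f q * (f g)⁻¹ ∈ Q.map f :=
      (mem_normalizer_iff.1 hb (f q)).1 (mem_map_of_mem f hq)
    change f (g * q * g⁻¹) ∈ Q.map f
    simpa using this
  obtain ⟨n, hn⟩ := MulAction.exists_smul_eq N (S'.subtype hS') (S.subtype hQN)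
  simp_rw [Sylow.smul_subtype, Subgroup.smul_def] at hn
  have hn' : (n : A) • S' = S := Sylow.subtype_injective hn
  have h1 : ((n : A) * g) • S = S := by rw [mul_smul]; exact hn'
  have h2 : (n : A) * g ∈ Q := by
    rw [← hN]
    exact Sylow.smul_eq_iff_mem_normalizer.1 h1
  have h3 : f (n : A) ∈ Q.map f := n.2
  have h4 : f g = (f n)⁻¹ * f (n * g) := by simp
  rw [h4]
  exact mul_mem (inv_mem h3) (mem_map_of_mem f h2)

/-- Burnside's transfer theorem, for simple groups. -/
theorem IsSimpleGroup.comm_of_sylow_normalizer_le [Finite Γ] [IsSimpleGroup Γ] {p : ℕ}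
    [hp : Fact p.Prime] (P : Sylow p Γ) (hP1 : (P : Subgroup Γ) ≠ ⊥)
    (hP : normalizer (P : Set Γ) ≤ centralizer (P : Set Γ)) (a b : Γ) : a * b = b * a := by
  have h1 := MonoidHom.ker_transferSylow_isComplement' P hP
  rcases (inferInstance : (MonoidHom.transferSylow P hP).ker.Normal).eq_bot_or_eq_top with h | h
  · rw [h, isComplement'_bot_left] at h1
    have h2 : ∀ x : Γ, x ∈ centralizer (P : Set Γ) := fun x => hP (le_normalizer (by
      rw [h1]
      exact mem_top x))
    have := h2 b
    rw [mem_centralizer_iff] at this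
    exact this a (by
      change a ∈ (P : Subgroup Γ)
      rw [h1]
      exact mem_top a)
  · rw [h, isComplement'_top_left] at h1
    exact absurd h1 hP1

end General

/-! ### Simple groups without Carter subgroups -/

section NoCarter

variable {Γ : Type*} [Group Γ]

theorem sq_eq_one_of_pow_two_pow_eq_one (h4 : ∀ x : Γ, x ^ 4 = 1 → x ^ 2 = 1) {x : Γ} {n : ℕ}
    (hx : x ^ 2 ^ n = 1) : x ^ 2 = 1 := by
  induction n with
  | zero => simp_all
  | succ n ih =>
    cases n with
    | zero => simpa using hx
    | succ n =>
      apply ih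
      rw [pow_succ 2 n, pow_mul]
      refine h4 _ ?_
      rw [← pow_mul]
      convert hx using 2
      ring

theorem commute_of_sq_eq_one {x y : Γ} (hx : x ^ 2 = 1) (hy : y ^ 2 = 1) (hxy : (x * y) ^ 2 = 1) :
    Commute x y := by
  rw [pow_two, mul_eq_one_iff_eq_inv] at hx hy hxy
  rw [Commute, SemiconjBy, hxy, mul_inv_rev, ← hx, ← hy]

/-- A simple group has no abelian Carter subgroup `K` that contains the normalizer of a
nontrivial Sylow subgroup of `K`. -/
theorem comm_of_normalizer_le [Finite Γ] [IsSimpleGroup Γ] {p : ℕ} [Fact p.Prime]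
    {K Q : Subgroup Γ} (hK : ∀ x ∈ K, ∀ y ∈ K, Commute x y) (hQ : IsPGroup p Q) (hQ1 : Q ≠ ⊥)
    (hQK : Q ≤ K) (hN : normalizer (Q : Set Γ) ≤ K) (hmax : ∀ x ∈ K, (∃ n, x ^ p ^ n = 1) → x ∈ Q)
    (a b : Γ) : a * b = b * a := by
  let P : Sylow p Γ := ⟨Q, hQ, fun {P} hP hQP =>
    (IsPGroup.eq_of_le_of_normalizer hP hQP fun g hg h => hmax g (hN hg) h).symm⟩
  refine IsSimpleGroup.comm_of_sylow_normalizer_le P hQ1 ?_ a b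
  intro g hg
  rw [mem_centralizer_iff]
  exact fun q hq => hK q (hQK hq) g (hN hg)

/-- A Carter 2-subgroup would be elementary abelian by `h4` and Sylow. Otherwise a Carter subgroup
has a central element `w` of odd prime order p, and then equals the abelian centralizer of `w`. In
both cases `comm_of_normalizer_le` applies. -/
theorem not_hasCarter_of_centralizers [Finite Γ] [IsSimpleGroup Γ]
    (hnc : ∃ a b : Γ, a * b ≠ b * a)
    (h2 : ∀ x : Γ, x ^ 2 ≠ 1 → ∀ y z, Commute x y → Commute x z → Commute y z)
    (h4 : ∀ x : Γ, x ^ 4 = 1 → x ^ 2 = 1) : ¬ HasCarter Γ := by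
  rintro ⟨K, hnil, hK⟩
  obtain ⟨a, b, hab⟩ := hnc
  apply hab
  have hKbot : K ≠ ⊥ := by
    rintro rfl
    rw [normalizer_eq_top] at hK
    exact absurd hK.symm bot_ne_top
  by_cases hp : IsPGroup 2 K
  · have hsq : ∀ x ∈ K, x ^ 2 = 1 := by
      intro x hx
      obtain ⟨n, hn⟩ := hp ⟨x, hx⟩
      exact sq_eq_one_of_pow_two_pow_eq_one h4 (congrArg Subtype.val hn)
    refine comm_of_normalizer_le (K := K) (fun x hx y hy => ?_) hp hKbot le_rfl hK.le
      (fun x hx _ => hx) a b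
    exact commute_of_sq_eq_one (hsq x hx) (hsq y hy) (hsq _ (mul_mem hx hy))
  · obtain ⟨A, B, -, hBK, hA, hBc, hcomm, hdec, -⟩ := exists_isPGroup_mul_coprime K 2
    have hB : ∃ z ∈ B, z ≠ 1 ∧ ∀ y ∈ B, Commute z y := by
      have hBn : Group.IsNilpotent B := by
        have : Group.IsNilpotent (B.subgroupOf K) := inferInstance
        exact Group.nilpotent_of_mulEquiv (subgroupOfEquivOfLe hBK)
      have hBnt : Nontrivial B := by
        by_contra hnt
        rw [not_nontrivial_iff_subsingleton] at hnt
        exact hp (isPGroup_of_forall_coprime hA hdec fun b hb =>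
          congrArg Subtype.val (Subsingleton.elim (⟨b, hb⟩ : B) 1))
      obtain ⟨⟨z, hz⟩, hz1⟩ := ne_bot_iff_exists_ne_one.1 (Group.IsNilpotent.center_ne_bot (G := B))
      refine ⟨z, z.2, fun h => hz1 (Subtype.ext (Subtype.ext h)), fun y hy => ?_⟩
      exact congrArg Subtype.val ((mem_center_iff.1 hz) ⟨y, hy⟩).symm
    obtain ⟨z, hzB, hz1, hzc⟩ := hB
    obtain ⟨p, hp, hpz⟩ := Nat.exists_prime_and_dvd (n := orderOf z) (by rwa [Ne, orderOf_eq_one_iff])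
    have : Fact p.Prime := ⟨hp⟩
    have hp2 : p.Coprime 2 := by
      refine Nat.Coprime.coprime_dvd_left (hpz.trans ?_) hBc
      rw [← Subgroup.orderOf_mk _ hzB]
      exact orderOf_dvd_natCard _
    have hzo : orderOf (z ^ (orderOf z / p)) = p := orderOf_pow_orderOf_div (orderOf_pos z).ne' hpz
    set w := z ^ (orderOf z / p) with hw
    have hwB : w ∈ B := pow_mem hzB _
    have hwp : w ^ p = 1 := hzo ▸ pow_orderOf_eq_one w
    have hw1 : w ≠ 1 := by
      rw [Ne, ← orderOf_eq_one_iff, hzo]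
      exact hp.ne_one
    have hw2 : w ^ 2 ≠ 1 := fun h => hw1 (eq_one_of_pow_eq_one_of_coprime hwp h hp2)
    have hwK : ∀ k ∈ K, Commute w k := by
      intro k hk
      obtain ⟨a, ha, b, hb, rfl⟩ := hdec k hk
      exact (hcomm a ha w hwB).symm.mul_right ((hzc b hb).pow_left _)
    have hKab : ∀ x ∈ K, ∀ y ∈ K, Commute x y := fun x hx y hy => h2 w hw2 x y (hwK x hx) (hwK y hy)
    -- The centralizer of `w` is abelian and contains `K`, so it normalizes `K`.
    have hCw : ∀ g, Commute w g → g ∈ K := by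
      intro g hg
      rw [← hK]
      refine mem_normalizer_of_forall_conj_mem fun k hk => ?_
      rwa [(h2 w hw2 g k hg (hwK k hk)).eq, mul_inv_cancel_right]
    obtain ⟨Q, -, hQK, -, hQ, -, -, -, hQmax⟩ := exists_isPGroup_mul_coprime K p
    have hwQ : w ∈ Q := hQmax w (hBK hwB) ⟨1, by simpa using hwp⟩
    refine comm_of_normalizer_le hKab hQ (fun h => hw1 ?_) hQK ?_ hQmax a b
    · rwa [h, mem_bot] at hwQ
    · intro g hg
      rw [← hK]
      refine mem_normalizer_of_forall_conj_mem fun k hk => hCw _ ?_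
      -- For `g` normalizing `Q`, the conjugate `g⁻¹ * w * g` lies in the abelian group `K`.
      -- Conjugating back, `w` commutes with `g * k * g⁻¹`, which therefore lies in `K`.
      have h1 : g⁻¹ * w * g ∈ Q := by
        have := (mem_normalizer_iff.1 (inv_mem hg) w).1 hwQ
        rwa [inv_inv] at this
      have h3 : Commute (g⁻¹ * w * g) k := hKab _ (hQK h1) _ hk
      have h5 := h3.map (MulAut.conj g)
      simpa [mul_assoc] using h5

end NoCarter

/-! ### Calculus in the wreath product with Sym₂ -/

section Wreath

/-- The permutation wreath product of `A` and `Sym₂`. -/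
abbrev Wr (A : Type*) [Group A] : Type _ :=
  (Fin 2 → A) ⋊[(mulAutArrow : Equiv.Perm (Fin 2) →* MulAut (Fin 2 → A))] Equiv.Perm (Fin 2)

variable {A : Type*} [Group A]

/-- The element `(x, y)` of the base group. -/
def pr (x y : A) : Wr A := SemidirectProduct.inl ![x, y]

/-- The element interchanging the two coordinates. -/
def sw : Wr A := SemidirectProduct.inr (Equiv.swap 0 1)

theorem pr_mul (x y u v : A) : pr x y * pr u v = pr (x * u) (y * v) := by
  rw [pr, pr, pr, ← map_mul]
  congr 1
  ext i
  fin_cases i <;> rfl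

@[simp] theorem pr_one : pr (1 : A) 1 = 1 := by
  rw [pr, ← map_one SemidirectProduct.inl]
  congr 1
  ext i
  fin_cases i <;> rfl

theorem pr_inv (x y : A) : (pr x y)⁻¹ = pr x⁻¹ y⁻¹ := by
  rw [inv_eq_iff_mul_eq_one, pr_mul]
  simp

theorem sw_mul_sw : (sw * sw : Wr A) = 1 := by
  rw [sw, ← map_mul]
  simp

theorem sw_inv : (sw⁻¹ : Wr A) = sw := inv_eq_of_mul_eq_one_left sw_mul_sw

theorem pr_left (x y : A) : (pr x y).left = ![x, y] := rfl
theorem pr_right (x y : A) : (pr x y).right = 1 := rfl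
theorem pr_mul_sw_left (x y : A) : (pr x y * sw).left = ![x, y] := by simp [pr, sw]
theorem pr_mul_sw_right (x y : A) : (pr x y * sw).right = Equiv.swap 0 1 := by simp [pr, sw]

theorem sw_mul_pr (x y : A) : sw * pr x y = pr y x * sw := by
  apply SemidirectProduct.ext
  · have h : ((sw : Wr A) * pr x y).left = sw.left * mulAutArrow (sw : Wr A).right (pr x y).left :=
      SemidirectProduct.mul_left _ _
    rw [pr_mul_sw_left, h]
    ext i
    fin_cases i <;> simp [sw, pr, mulAutArrow_apply_apply] <;> rfl
  · simp [sw, pr]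

theorem pr_inj {x y u v : A} : pr x y = pr u v ↔ x = u ∧ y = v := by
  rw [pr, pr, SemidirectProduct.inl_inj]
  constructor
  · exact fun h => ⟨congrFun h 0, congrFun h 1⟩
  · rintro ⟨rfl, rfl⟩
    rfl

theorem pr_ne_pr_mul_sw (x y u v : A) : pr x y ≠ pr u v * sw := by
  intro h
  have := congrArg SemidirectProduct.right h
  rw [pr_right, pr_mul_sw_right] at this
  exact absurd this (by decide)

theorem eq_pr_or (g : Wr A) : ∃ x y : A, g = pr x y ∨ g = pr x y * sw := by
  have h : ∀ σ : Equiv.Perm (Fin 2), σ = 1 ∨ σ = Equiv.swap 0 1 := by decide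
  refine ⟨g.left 0, g.left 1, (h g.right).imp (fun hr => ?_) fun hr => ?_⟩
  · apply SemidirectProduct.ext
    · ext i
      fin_cases i <;> simp [pr]
    · simpa [pr] using hr
  · apply SemidirectProduct.ext
    · rw [pr_mul_sw_left]
      ext i
      fin_cases i <;> simp
    · rw [pr_mul_sw_right, hr]

/-- The embedding of the base group. -/
def prHom : A × A →* Wr A where
  toFun z := pr z.1 z.2
  map_one' := pr_one
  map_mul' _ _ := (pr_mul _ _ _ _).symm

theorem prHom_injective : Function.Injective (prHom : A × A →* Wr A) := fun _ _ h =>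
  Prod.ext_iff.2 (pr_inj.1 h)

theorem sw_conj_pr (x y : A) : sw * pr x y * sw⁻¹ = pr y x := by
  rw [sw_mul_pr, mul_inv_cancel_right]

theorem pr_conj_pr (x y u v : A) :
    pr x y * pr u v * (pr x y)⁻¹ = pr (x * u * x⁻¹) (y * v * y⁻¹) := by
  rw [pr_inv, pr_mul, pr_mul]

theorem pr_mul_sw_mul (x y u v : A) : pr x y * sw * pr u v = pr (x * v) (y * u) * sw := by
  rw [mul_assoc, sw_mul_pr, ← mul_assoc, pr_mul]

theorem pr_conj_pr_mul_sw (x y u v : A) :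
    pr x y * (pr u v * sw) * (pr x y)⁻¹ = pr (x * u * y⁻¹) (y * v * x⁻¹) * sw := by
  rw [← mul_assoc, pr_mul, pr_inv, pr_mul_sw_mul]

theorem pr_pow (x y : A) (n : ℕ) : pr x y ^ n = pr (x ^ n) (y ^ n) :=
  (map_pow prHom (x, y) n).symm

theorem commute_pr {x y u v : A} : Commute (pr x y) (pr u v) ↔ Commute x u ∧ Commute y v := by
  rw [Commute, SemiconjBy, pr_mul, pr_mul, pr_inj]
  rfl

end Wreath

/-! ### Carter subgroups of a subgroup, seen in the ambient group -/

section Relative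

variable {Γ : Type*} [Group Γ]

theorem hasCarter_of_relative [Finite Γ] {S K : Subgroup Γ} (hKS : K ≤ S) (hK : Group.IsNilpotent K)
    (h : ∀ g ∈ S, g ∈ normalizer (K : Set Γ) → g ∈ K) : HasCarter S := by
  refine ⟨K.subgroupOf S, Group.nilpotent_of_mulEquiv (subgroupOfEquivOfLe hKS).symm,
    le_antisymm ?_ le_normalizer⟩
  intro g hg
  rw [mem_subgroupOf]
  refine h g g.2 (mem_normalizer_of_forall_conj_mem fun k hk => ?_)
  exact (mem_normalizer_iff.1 hg ⟨k, hKS hk⟩).1 hk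

theorem HasCarter.exists_relative {S : Subgroup Γ} [Finite Γ] (h : HasCarter S) :
    ∃ K ≤ S, Group.IsNilpotent K ∧ ∀ g ∈ S, g ∈ normalizer (K : Set Γ) → g ∈ K := by
  obtain ⟨K, hn, hK⟩ := h
  refine ⟨K.map S.subtype, map_subtype_le K,
    Group.nilpotent_of_mulEquiv (K.equivMapOfInjective _ S.subtype_injective), fun g hg hgn => ?_⟩
  refine ⟨⟨g, hg⟩, ?_, rfl⟩
  rw [SetLike.mem_coe, ← hK]
  refine mem_normalizer_of_forall_conj_mem fun k hk => ?_
  obtain ⟨k', hk', he⟩ := (mem_normalizer_iff.1 hgn k).1 ⟨k, hk, rfl⟩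
  have : k' = ⟨g, hg⟩ * k * ⟨g, hg⟩⁻¹ := Subtype.ext he
  rwa [← this]

end Relative

/-! ### From a Carter subgroup in the wreath product to one of a coordinate group -/

section Cases

variable {A : Type*} [Group A] [Finite A]

theorem isNilpotent_comap {G N : Type*} [Group G] [Group N] {f : N →* G}
    (hf : Function.Injective f) (K : Subgroup G) [Group.IsNilpotent K] :
    Group.IsNilpotent (K.comap f) := by
  refine Subgroup.isNilpotent_of_ker_le_center (f.subgroupComap K) ?_
  rw [(MonoidHom.ker_eq_bot_iff _).2]
  · exact bot_le
  · exact fun x y h => Subtype.ext (hf (congrArg Subtype.val h))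

theorem isNilpotent_map {G N : Type*} [Group G] [Group N] (f : G →* N)
    (K : Subgroup G) [Group.IsNilpotent K] : Group.IsNilpotent (K.map f) :=
  Group.nilpotent_of_surjective (f.subgroupMap K) (f.subgroupMap_surjective K)

instance (A : Type*) [Group A] [Finite A] : Finite (Wr A) :=
  Finite.of_equiv _ SemidirectProduct.equivProd.symm

/-- The product of the two projections of `K` is nilpotent and contains `K`. Self-normalization in S
× S gives equality, so each projection is self-normalizing in `S`. -/
theorem hasCarter_of_le_base {S : Subgroup A} {K : Subgroup (Wr A)} [Group.IsNilpotent K]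
    (hK : ∀ k ∈ K, ∃ x ∈ S, ∃ y ∈ S, k = pr x y)
    (hN : ∀ x ∈ S, ∀ y ∈ S, pr x y ∈ normalizer (K : Set (Wr A)) → pr x y ∈ K) : HasCarter S := by
  have hn : Group.IsNilpotent (K.comap prHom) := isNilpotent_comap prHom_injective K
  let K₁ := (K.comap prHom).map (MonoidHom.fst A A)
  let K₂ := (K.comap prHom).map (MonoidHom.snd A A)
  have hn₁ : Group.IsNilpotent K₁ := isNilpotent_map _ _
  have hn₂ : Group.IsNilpotent K₂ := isNilpotent_map _ _
  have hS₁ : K₁ ≤ S := by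
    rintro _ ⟨⟨x, y⟩, hk, rfl⟩
    obtain ⟨x', hx', y', -, he⟩ := hK _ hk
    rwa [← (pr_inj.1 he).1] at hx'
  have hS₂ : K₂ ≤ S := by
    rintro _ ⟨⟨x, y⟩, hk, rfl⟩
    obtain ⟨x', -, y', hy', he⟩ := hK _ hk
    rwa [← (pr_inj.1 he).2] at hy'
  have hnp : Group.IsNilpotent (K₁.prod K₂) :=
    Group.nilpotent_of_mulEquiv (K₁.prodEquiv K₂).symm
  have hnP : Group.IsNilpotent ((K₁.prod K₂).map prHom) := isNilpotent_map _ _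
  have hKP : K = (K₁.prod K₂).map prHom := by
    refine eq_of_le_of_nilpotent ?_ ?_
    · intro k hk
      obtain ⟨x, -, y, -, rfl⟩ := hK k hk
      exact ⟨(x, y), ⟨⟨(x, y), hk, rfl⟩, ⟨(x, y), hk, rfl⟩⟩, rfl⟩
    · rintro _ ⟨⟨x, y⟩, ⟨hx, hy⟩, rfl⟩ hg
      exact hN x (hS₁ hx) y (hS₂ hy) hg
  refine hasCarter_of_relative hS₁ hn₁ fun n hn hnN => ?_
  refine ⟨(n, 1), hN n hn 1 S.one_mem (mem_normalizer_of_forall_conj_mem fun k hk => ?_), rfl⟩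
  rw [hKP] at hk ⊢
  obtain ⟨⟨x, y⟩, ⟨hx, hy⟩, rfl⟩ := hk
  refine ⟨(n * x * n⁻¹, y), ⟨(mem_normalizer_iff.1 hnN x).1 hx, hy⟩, ?_⟩
  change pr _ _ = pr n 1 * pr x y * (pr n 1)⁻¹
  rw [pr_conj_pr]
  simp

end Cases

section Cases

variable {A : Type*} [Group A] [Finite A]

/-- The odd part of `K` commutes with `(1, c) sw`, hence is diagonal, say the diagonal of `R₁`. The
base elements of the 2-part project onto a 2-group `R₂` centralizing `R₁`. Self-normalization first
puts R₂ × R₂ into `K`, and then makes `R₂ R₁` a Carter subgroup of `S`. -/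
theorem hasCarter_of_mem_swap {S : Subgroup A} {K : Subgroup (Wr A)} [Group.IsNilpotent K]
    (hK : ∀ k ∈ K, ∃ x ∈ S, ∃ y ∈ S, k = pr x y ∨ k = pr x y * sw)
    (hN : ∀ x ∈ S, ∀ y ∈ S, pr x y ∈ normalizer (K : Set (Wr A)) → pr x y ∈ K)
    {c : A} (ht : pr 1 c * sw ∈ K) (ht2 : ∃ n, (pr 1 c * sw) ^ 2 ^ n = 1) : HasCarter S := by
  obtain ⟨P, B, hPK, hBK, hP, hB, hcomm, hdec, hmax⟩ := exists_isPGroup_mul_coprime K 2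
  have htP : pr 1 c * sw ∈ P := hmax _ ht ht2
  -- the elements of odd order are diagonal
  have hBodd : ∀ b ∈ B, b ^ Nat.card B = 1 := fun b hb =>
    congrArg Subtype.val (pow_card_eq_one' (x := (⟨b, hb⟩ : B)))
  have hBdiag : ∀ b ∈ B, ∃ x ∈ S, b = pr x x ∧ Commute x c := by
    intro b hb
    obtain ⟨x, hx, y, hy, rfl | rfl⟩ := hK b (hBK hb)
    · have h1 := hcomm _ htP _ hb
      rw [Commute, SemiconjBy, pr_mul_sw_mul, ← mul_assoc, pr_mul, mul_left_inj, pr_inj] at h1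
      obtain ⟨h2, h3⟩ := h1
      rw [one_mul, mul_one] at h2
      subst h2
      exact ⟨y, hy, rfl, h3.symm⟩
    · have h1 := congrArg (SemidirectProduct.rightHom) (hBodd _ hb)
      rw [map_pow, map_one, SemidirectProduct.rightHom_eq_right] at h1
      have h2 : (pr x y * sw).right ^ 2 = 1 := by
        rw [pr_mul_sw_right]
        decide
      have h3 := eq_one_of_pow_eq_one_of_coprime h1 h2 hB
      rw [pr_mul_sw_right] at h3
      exact absurd h3 (by decide)
  let R₂ : Subgroup A := (P.comap prHom).map (MonoidHom.fst A A)
  let R₁ : Subgroup A := B.comap (prHom.comp ((MonoidHom.id A).prod (MonoidHom.id A)))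
  have hR₂ : ∀ x, x ∈ R₂ ↔ ∃ y, pr x y ∈ P := by
    intro x
    constructor
    · rintro ⟨⟨x, y⟩, h, rfl⟩
      exact ⟨y, h⟩
    · rintro ⟨y, h⟩
      exact ⟨(x, y), h, rfl⟩
  have hR₁ : ∀ x, x ∈ R₁ ↔ pr x x ∈ B := fun x => Iff.rfl
  have hR₂p : IsPGroup 2 R₂ := (hP.comap_of_injective _ prHom_injective).map _
  have hR₂S : R₂ ≤ S := by
    intro x hx
    obtain ⟨y, h⟩ := (hR₂ x).1 hx
    obtain ⟨x', hx', y', -, he | he⟩ := hK _ (hPK h)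
    · rwa [(pr_inj.1 he).1]
    · exact absurd he (pr_ne_pr_mul_sw _ _ _ _)
  have hR₁S : R₁ ≤ S := by
    intro x hx
    obtain ⟨y, hy, he, -⟩ := hBdiag _ ((hR₁ x).1 hx)
    rwa [(pr_inj.1 he).1]
  -- Conjugation by `(1, c) sw` moves the second coordinate to the first place, so both projections
  -- land in `R₂`.
  have hsnd : ∀ x y, pr x y ∈ P → y ∈ R₂ := by
    intro x y h
    have h1 := mul_mem (mul_mem htP h) (inv_mem htP)
    rw [hR₂]
    refine ⟨c * x * c⁻¹, ?_⟩
    rw [mul_inv_rev, sw_inv, pr_mul_sw_mul, ← mul_assoc, mul_assoc _ sw sw, sw_mul_sw, mul_one,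
      pr_inv, pr_mul] at h1
    simpa using h1
  -- The square of `(1, c) sw` is `(c, c)`.
  have hcR : c ∈ R₂ := by
    rw [hR₂]
    refine ⟨c, ?_⟩
    have := mul_mem htP htP
    rw [← mul_assoc, pr_mul_sw_mul, mul_assoc, sw_mul_sw] at this
    simpa using this
  have hPform : ∀ a ∈ P, ∃ x ∈ R₂, ∃ y ∈ R₂, a = pr x y ∨ a = pr x y * sw := by
    intro a ha
    obtain ⟨x, -, y, -, rfl | rfl⟩ := hK a (hPK ha)
    · exact ⟨x, (hR₂ x).2 ⟨y, ha⟩, y, hsnd x y ha, Or.inl rfl⟩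
    · have h1 := mul_mem ha (inv_mem htP)
      rw [mul_inv_rev, sw_inv, pr_inv, ← mul_assoc, mul_assoc (pr x y), sw_mul_sw, mul_one,
        pr_mul, inv_one, mul_one] at h1
      refine ⟨x, (hR₂ x).2 ⟨_, h1⟩, y, ?_, Or.inr rfl⟩
      have := mul_mem (hsnd _ _ h1) hcR
      simpa using this
  have hcomm' : ∀ x ∈ R₂, ∀ z ∈ R₁, Commute x z := by
    intro x hx z hz
    obtain ⟨y, h⟩ := (hR₂ x).1 hx
    exact (commute_pr.1 (hcomm _ h _ hz)).1
  -- the Sylow `2`-subgroup contains `R₂ × R₂`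
  let D : Subgroup (Wr A) := (R₂.prod R₂).map prHom
  have hD : IsPGroup 2 D := by
    refine IsPGroup.map ?_ _
    rintro ⟨⟨x, y⟩, hx, hy⟩
    obtain ⟨m, hm⟩ := hR₂p ⟨x, hx⟩
    obtain ⟨n, hn⟩ := hR₂p ⟨y, hy⟩
    have hm' : x ^ 2 ^ m = 1 := congrArg Subtype.val hm
    have hn' : y ^ 2 ^ n = 1 := congrArg Subtype.val hn
    refine ⟨m + n, Subtype.ext (Prod.ext ?_ ?_)⟩
    · change x ^ 2 ^ (m + n) = 1
      rw [pow_add, pow_mul, hm', one_pow]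
    · change y ^ 2 ^ (m + n) = 1
      rw [pow_add, mul_comm, pow_mul, hn', one_pow]
  have hPD : P ≤ normalizer (D : Set (Wr A)) := by
    intro a ha
    refine mem_normalizer_of_forall_conj_mem ?_
    rintro _ ⟨⟨u, v⟩, ⟨hu, hv⟩, rfl⟩
    change u ∈ R₂ at hu
    change v ∈ R₂ at hv
    obtain ⟨x, hx, y, hy, rfl | rfl⟩ := hPform a ha
    · refine ⟨(x * u * x⁻¹, y * v * y⁻¹), mem_prod.2 ⟨?_, ?_⟩, (pr_conj_pr _ _ _ _).symm⟩
      · exact mul_mem (mul_mem hx hu) (inv_mem hx)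
      · exact mul_mem (mul_mem hy hv) (inv_mem hy)
    · refine ⟨(x * v * x⁻¹, y * u * y⁻¹), mem_prod.2 ⟨?_, ?_⟩, ?_⟩
      · exact mul_mem (mul_mem hx hv) (inv_mem hx)
      · exact mul_mem (mul_mem hy hu) (inv_mem hy)
      · change pr _ _ = pr x y * sw * pr u v * (pr x y * sw)⁻¹
        rw [pr_mul_sw_mul, mul_inv_rev, sw_inv, ← mul_assoc, mul_assoc _ sw sw, sw_mul_sw, mul_one,
          pr_inv, pr_mul]
  have hE : IsPGroup 2 (D ⊔ P : Subgroup (Wr A)) := hD.to_sup_of_normal_left' hP hPD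
  have hEn := hE.isNilpotent
  -- The 2-group generated by `D` and `P` centralizes `B`. Hence those of its elements that
  -- normalize `P` normalize `K = P B`, and so belong to `K`.
  have hPE : P = D ⊔ P := by
    refine eq_of_le_of_nilpotent le_sup_right fun g hg hgN => ?_
    have hgB : ∀ b ∈ B, Commute g b := by
      have : D ⊔ P ≤ centralizer (B : Set (Wr A)) := by
        refine sup_le ?_ fun a ha => mem_centralizer_iff.2 fun b hb => (hcomm a ha b hb).symm
        rintro _ ⟨⟨x, y⟩, ⟨hx, hy⟩, rfl⟩
        rw [mem_centralizer_iff]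
        intro b hb
        obtain ⟨z, -, rfl, -⟩ := hBdiag b hb
        exact (commute_pr.2 ⟨hcomm' x hx z hb, hcomm' y hy z hb⟩).symm
      exact fun b hb => ((mem_centralizer_iff.1 (this hg)) b hb).symm
    have hgK : g ∈ normalizer (K : Set (Wr A)) := by
      refine mem_normalizer_of_forall_conj_mem fun k hk => ?_
      obtain ⟨a, ha, b, hb, rfl⟩ := hdec k hk
      have h1 : g * (a * b) * g⁻¹ = g * a * g⁻¹ * b := by
        rw [mul_assoc, mul_assoc a b, ← (hgB b hb).inv_left.eq]
        group
      rw [h1]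
      exact mul_mem (hPK ((mem_normalizer_iff.1 hgN a).1 ha)) (hBK hb)
    obtain ⟨n, hn⟩ := hE ⟨g, hg⟩
    refine hmax g ?_ ⟨n, congrArg Subtype.val hn⟩
    obtain ⟨_, ⟨⟨x, y⟩, ⟨hx, hy⟩, rfl⟩, a, ha, rfl⟩ := Set.mem_mul.1
      ((coe_mul_of_right_le_normalizer_left D P hPD) ▸ (SetLike.mem_coe.2 hg))
    have haN := mul_mem hgK (inv_mem (le_normalizer (hPK ha)))
    rw [mul_inv_cancel_right] at haN
    exact mul_mem (hN x (hR₂S hx) y (hR₂S hy) haN) (hPK ha)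
  have hRP : ∀ x ∈ R₂, ∀ y ∈ R₂, pr x y ∈ P := by
    intro x hx y hy
    rw [hPE]
    exact mem_sup_left ⟨(x, y), ⟨hx, hy⟩, rfl⟩
  let f : R₂ × R₁ →* A := MonoidHom.noncommCoprod R₂.subtype R₁.subtype
    fun x z => hcomm' x x.2 z z.2
  have hR₁n : Group.IsNilpotent R₁ := by
    have hBn : Group.IsNilpotent B := by
      have : Group.IsNilpotent (B.subgroupOf K) := inferInstance
      exact Group.nilpotent_of_mulEquiv (subgroupOfEquivOfLe hBK)
    refine isNilpotent_comap (f := prHom.comp ((MonoidHom.id A).prod (MonoidHom.id A))) ?_ B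
    exact fun x y h => (pr_inj.1 h).1
  have hR₂n : Group.IsNilpotent R₂ := hR₂p.isNilpotent
  have hfn : Group.IsNilpotent f.range :=
    Group.nilpotent_of_surjective f.rangeRestrict f.rangeRestrict_surjective
  have hf : ∀ r, r ∈ f.range ↔ ∃ x ∈ R₂, ∃ z ∈ R₁, x * z = r := by
    intro r
    constructor
    · rintro ⟨⟨x, z⟩, rfl⟩
      exact ⟨x, x.2, z, z.2, rfl⟩
    · rintro ⟨x, hx, z, hz, rfl⟩
      exact ⟨(⟨x, hx⟩, ⟨z, hz⟩), rfl⟩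
  have hR₁pow : ∀ z ∈ R₁, z ^ Nat.card B = 1 := by
    intro z hz
    have := hBodd _ hz
    rw [MonoidHom.comp_apply] at this
    change pr z z ^ _ = 1 at this
    rw [pr_pow, ← pr_one, pr_inj] at this
    exact this.1
  have hR₂pow : ∀ x ∈ R₂, ∃ n, x ^ 2 ^ n = 1 := fun x hx =>
    (hR₂p ⟨x, hx⟩).imp fun n hn => congrArg Subtype.val hn
  refine hasCarter_of_relative (K := f.range) ?_ hfn fun n hn hnN => ?_
  · intro r hr
    obtain ⟨x, hx, z, hz, rfl⟩ := (hf r).1 hr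
    exact mul_mem (hR₂S hx) (hR₁S hz)
  -- `R₂` and `R₁` have coprime exponents and commute, so an element normalizing their product
  -- normalizes each of them. Then `(n, n)` normalizes `K`, and splitting it in `K` shows that `n`
  -- is in `R₂ R₁`.
  · have hn₂ : ∀ x ∈ R₂, n * x * n⁻¹ ∈ R₂ := by
      intro x hx
      have hx' : x ∈ f.range := (hf x).2 ⟨x, hx, 1, one_mem _, mul_one x⟩
      obtain ⟨u, hu, z, hz, he⟩ := (hf _).1 ((mem_normalizer_iff.1 hnN x).1 hx')
      obtain ⟨k, hk⟩ := hR₂pow x hx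
      obtain ⟨l, hl⟩ := hR₂pow u hu
      have h1 : z ^ (2 ^ k * 2 ^ l) = 1 := by
        have h2 : (n * x * n⁻¹) ^ (2 ^ k * 2 ^ l) = 1 := by
          rw [conj_pow, pow_mul, hk, one_pow, mul_one, mul_inv_cancel]
        rw [← he, (hcomm' u hu z hz).mul_pow, mul_comm, pow_mul, hl, one_pow, one_mul] at h2
        rwa [mul_comm]
      have h3 : z = 1 := eq_one_of_pow_eq_one_of_coprime (hR₁pow z hz) h1
        (by rw [← pow_add]; exact Nat.Coprime.pow_right _ hB)
      rw [← he, h3, mul_one]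
      exact hu
    have hn₁ : ∀ z ∈ R₁, n * z * n⁻¹ ∈ R₁ := by
      intro x hx
      have hx' : x ∈ f.range := (hf x).2 ⟨1, one_mem _, x, hx, one_mul x⟩
      obtain ⟨u, hu, z, hz, he⟩ := (hf _).1 ((mem_normalizer_iff.1 hnN x).1 hx')
      obtain ⟨l, hl⟩ := hR₂pow u hu
      have h1 : u ^ Nat.card B = 1 := by
        have h2 : (n * x * n⁻¹) ^ Nat.card B = 1 := by
          rw [conj_pow, hR₁pow x hx, mul_one, mul_inv_cancel]
        rwa [← he, (hcomm' u hu z hz).mul_pow, hR₁pow z hz, mul_one] at h2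
      have h3 : u = 1 := eq_one_of_pow_eq_one_of_coprime h1 hl (Nat.Coprime.pow_right _ hB)
      rw [← he, h3, one_mul]
      exact hz
    have hdK : pr n n ∈ K := by
      refine hN n hn n hn (mem_normalizer_of_forall_conj_mem fun k hk => ?_)
      obtain ⟨a, ha, b, hb, rfl⟩ := hdec k hk
      have h1 : pr n n * (a * b) * (pr n n)⁻¹ =
        (pr n n * a * (pr n n)⁻¹) * (pr n n * b * (pr n n)⁻¹) := by group
      rw [h1]
      refine mul_mem (hPK ?_) (hBK ?_)
      · obtain ⟨x, hx, y, hy, rfl | rfl⟩ := hPform a ha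
        · rw [pr_conj_pr]
          exact hRP _ (hn₂ x hx) _ (hn₂ y hy)
        · have h2 : pr n n * (pr x y * sw) * (pr n n)⁻¹ =
              pr (n * x * n⁻¹) (n * y * n⁻¹ * c⁻¹) * (pr 1 c * sw) := by
            rw [pr_conj_pr_mul_sw, ← mul_assoc, pr_mul, mul_one, inv_mul_cancel_right]
          rw [h2]
          exact mul_mem (hRP _ (hn₂ x hx) _ (mul_mem (hn₂ y hy) (inv_mem hcR))) htP
      · obtain ⟨z, -, rfl, -⟩ := hBdiag b hb
        rw [pr_conj_pr]
        exact hn₁ z hb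
    obtain ⟨a, ha, b, hb, he⟩ := hdec _ hdK
    obtain ⟨z, -, rfl, -⟩ := hBdiag b hb
    refine (hf n).2 ⟨n * z⁻¹, (hR₂ _).2 ⟨n * z⁻¹, ?_⟩, z, hb, inv_mul_cancel_right n z⟩
    have : a = pr n n * (pr z z)⁻¹ := by rw [he, mul_inv_cancel_right]
    rwa [this, pr_inv, pr_mul] at ha

end Cases

/-! ### Carter subgroups relative to a subgroup, and their conjugates -/

section IsCarterIn

variable {Γ : Type*} [Group Γ]

/-- `K` is a Carter subgroup of the subgroup `G`. -/
structure IsCarterIn (G K : Subgroup Γ) : Prop where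
  le : K ≤ G
  nilpotent : Group.IsNilpotent K
  self : ∀ g ∈ G, g ∈ normalizer (K : Set Γ) → g ∈ K

theorem HasCarter.exists_isCarterIn [Finite Γ] {G : Subgroup Γ} (h : HasCarter G) :
    ∃ K, IsCarterIn G K := by
  obtain ⟨K, h1, h2, h3⟩ := h.exists_relative
  exact ⟨K, h1, h2, h3⟩

theorem IsCarterIn.normalizer_subgroupOf [Finite Γ] {G K : Subgroup Γ} (h : IsCarterIn G K) :
    normalizer ((K.subgroupOf G : Subgroup G) : Set G) = K.subgroupOf G := by
  refine le_antisymm (fun g hg => ?_) le_normalizer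
  rw [mem_subgroupOf]
  refine h.self g g.2 (mem_normalizer_of_forall_conj_mem fun k hk => ?_)
  exact (mem_normalizer_iff.1 hg ⟨k, h.le hk⟩).1 hk

theorem IsCarterIn.conj [Finite Γ] {G K : Subgroup Γ} (h : IsCarterIn G K) {g : Γ} (hg : g ∈ G) :
    IsCarterIn G (K.map (MulAut.conj g).toMonoidHom) := by
  have := h.nilpotent
  refine ⟨?_, isNilpotent_map _ _, fun n hn hnN => ?_⟩
  · rintro _ ⟨k, hk, rfl⟩
    exact mul_mem (mul_mem hg (h.le hk)) (inv_mem hg)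
  · refine ⟨g⁻¹ * n * g, ?_, ?_⟩
    · refine h.self _ (mul_mem (mul_mem (inv_mem hg) hn) hg)
        (mem_normalizer_of_forall_conj_mem fun k hk => ?_)
      obtain ⟨k', hk', he⟩ := (mem_normalizer_iff.1 hnN (g * k * g⁻¹)).1 ⟨k, hk, rfl⟩
      have he' : g * k' * g⁻¹ = n * (g * k * g⁻¹) * n⁻¹ := he
      have : g⁻¹ * n * g * k * (g⁻¹ * n * g)⁻¹ = k' := by
        have h1 : k' = g⁻¹ * (g * k' * g⁻¹) * g := by group
        rw [h1, he']
        group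
      rwa [this]
    · change g * (g⁻¹ * n * g) * g⁻¹ = n
      group

end IsCarterIn

/-! ### The group `twist π`, and Carter subgroups of it inside the base group -/

section Twist

variable {A C : Type*} [Group A] [CommGroup C]

/-- The elements `(x, y)σ` of the wreath product with `π x * π y = 1`. -/
def twist (π : A →* C) : Subgroup (Wr A) where
  carrier := {g | π (g.left 0) * π (g.left 1) = 1}
  one_mem' := by simp
  mul_mem' := by
    intro a b ha hb
    obtain ⟨x, y, rfl | rfl⟩ := eq_pr_or a <;> obtain ⟨u, v, rfl | rfl⟩ := eq_pr_or b <;>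
    [rw [pr_mul]; rw [← mul_assoc, pr_mul]; rw [pr_mul_sw_mul];
      rw [← mul_assoc, pr_mul_sw_mul, mul_assoc, sw_mul_sw, mul_one]] <;>
    simp only [Set.mem_ofPred_eq, pr_left, pr_mul_sw_left, Matrix.cons_val_zero,
      Matrix.cons_val_one, map_mul] at ha hb ⊢
    · rw [mul_mul_mul_comm, ha, hb, one_mul]
    · rw [mul_mul_mul_comm, ha, hb, one_mul]
    · rw [mul_mul_mul_comm, ha, mul_comm (π v), hb, one_mul]
    · rw [mul_mul_mul_comm, ha, mul_comm (π v), hb, one_mul]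
  inv_mem' := by
    intro a ha
    obtain ⟨x, y, rfl | rfl⟩ := eq_pr_or a <;>
    [rw [pr_inv]; rw [mul_inv_rev, sw_inv, pr_inv, sw_mul_pr]] <;>
    simp only [Set.mem_ofPred_eq, pr_left, pr_mul_sw_left, Matrix.cons_val_zero,
      Matrix.cons_val_one, map_inv] at ha ⊢
    · rw [← mul_inv, ha, inv_one]
    · rw [← mul_inv, mul_comm, ha, inv_one]

variable {π : A →* C}

theorem pr_mem_twist {x y : A} : pr x y ∈ twist π ↔ π x * π y = 1 := Iff.rfl

theorem pr_mul_sw_mem_twist {x y : A} : pr x y * sw ∈ twist π ↔ π x * π y = 1 := by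
  change π ((pr x y * sw).left 0) * π ((pr x y * sw).left 1) = 1 ↔ _
  rw [pr_mul_sw_left]
  rfl

theorem sw_mem_twist : sw ∈ twist π := by
  have : pr 1 1 * sw ∈ twist π := pr_mul_sw_mem_twist.2 (by simp)
  simpa using this

/-- The hypothesis on the centralizers in `ker π` of the `3`-elements of `A` outside `ker π`. -/
def CentralizerCondition (π : A →* C) : Prop :=
  ∀ t : A, (∃ n, t ^ 3 ^ n = 1) → π t ≠ 1 → ∀ q, π q = 1 → q ≠ 1 →
    (∃ m : ℕ, m.Coprime 3 ∧ q ^ m = 1) → Commute q t →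
    (∀ s, π s = 1 → (∃ n, s ^ 3 ^ n = 1) → Commute s q → s = 1) ∧
    ∃ V : Subgroup A, (∀ v ∈ V, π v = 1 ∧ Commute v t ∧ v ^ 2 = 1) ∧
      (∀ r, π r = 1 → Commute r t → (∃ m : ℕ, m.Coprime 3 ∧ r ^ m = 1) → r ∈ V) ∧
      ∃ w, π w = 1 ∧ Commute w t ∧ w ^ 3 = 1 ∧ ∃ v ∈ V, ¬ Commute w v

variable [Finite A]

/-- If `q₁ ≠ 1`, the first coordinates of the 3-part of `K` are powers of `t₁`, and those of the
3′-part lie in the elementary abelian group `V`. Then V × 1 centralizes `K`, and `(w, 1)` normalizes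
it; both lie in `K`, where a 3-element and a 3′-element must commute, contrary to the choice of `w`.
-/
theorem eq_one_of_coprime_mem {K : Subgroup (Wr A)} (hK : IsCarterIn (twist π) K)
    (hC3 : ∀ a : C, a ^ 3 = 1) (hCz : ∀ a b : C, a ≠ 1 → b ∈ zpowers a)
    (hcent : CentralizerCondition π) (hbase : ∀ k ∈ K, ∃ x y, k = pr x y)
    {t₁ t₂ : A} (ht : pr t₁ t₂ ∈ K) (ht3 : ∃ n, pr t₁ t₂ ^ 3 ^ n = 1) (hπt : π t₁ ≠ 1)
    {q₁ q₂ : A} (hq : pr q₁ q₂ ∈ K) (hq3 : ∃ m : ℕ, m.Coprime 3 ∧ pr q₁ q₂ ^ m = 1) :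
    q₁ = 1 := by
  by_contra hq1
  have := hK.nilpotent
  have : Fact (Nat.Prime 3) := ⟨Nat.prime_three⟩
  obtain ⟨P, B, hPK, hBK, hP, hB, hcomm, hdec, hmax⟩ := exists_isPGroup_mul_coprime K 3
  have hBpow : ∀ b ∈ B, b ^ Nat.card B = 1 := fun b hb =>
    congrArg Subtype.val (pow_card_eq_one' (x := (⟨b, hb⟩ : B)))
  have hBmem : ∀ k ∈ K, (∃ m : ℕ, m.Coprime 3 ∧ k ^ m = 1) → k ∈ B := by
    rintro k hk ⟨m, hm, hkm⟩
    obtain ⟨a, ha, b, hb, rfl⟩ := hdec k hk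
    obtain ⟨n, hn⟩ := hP ⟨a, ha⟩
    have hn' : a ^ 3 ^ n = 1 := congrArg Subtype.val hn
    have h1 : a ^ (Nat.card B * m) = 1 := by
      have h2 : (a * b) ^ (Nat.card B * m) = 1 := by rw [mul_comm, pow_mul, hkm, one_pow]
      rwa [(hcomm a ha b hb).mul_pow, pow_mul b, hBpow b hb, one_pow, mul_one] at h2
    rw [eq_one_of_pow_eq_one_of_coprime h1 hn' (Nat.Coprime.pow_right _ (hB.mul_left hm)), one_mul]
    exact hb
  have htP : pr t₁ t₂ ∈ P := hmax _ ht ht3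
  have hqB := hBmem _ hq hq3
  have hBker : ∀ x y, pr x y ∈ B → π x = 1 ∧ Commute x t₁ ∧ (∃ m : ℕ, m.Coprime 3 ∧ x ^ m = 1) := by
    intro x y h
    have h1 := hBpow _ h
    rw [pr_pow, ← pr_one, pr_inj] at h1
    refine ⟨?_, (commute_pr.1 (hcomm _ htP _ h)).1.symm, _, hB, h1.1⟩
    refine eq_one_of_pow_eq_one_of_coprime (m := Nat.card B) ?_ (hC3 _) hB
    rw [← map_pow, h1.1, map_one]
  obtain ⟨hqπ, hqt, hqm⟩ := hBker _ _ hqB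
  have ht3' : ∃ n, t₁ ^ 3 ^ n = 1 := by
    obtain ⟨n, hn⟩ := ht3
    rw [pr_pow, ← pr_one, pr_inj] at hn
    exact ⟨n, hn.1⟩
  obtain ⟨hs, V, hV, hVmem, w, hwπ, hwt, hw3, v, hv, hwv⟩ :=
    hcent t₁ ht3' hπt q₁ hqπ hq1 hqm hqt
  have hVcomm : ∀ x ∈ V, ∀ y ∈ V, Commute x y := fun x hx y hy =>
    commute_of_sq_eq_one (hV x hx).2.2 (hV y hy).2.2 (hV _ (mul_mem hx hy)).2.2
  have hPform : ∀ z, Commute z t₁ → ∀ a ∈ P, Commute (pr z 1) a := by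
    intro z hz a ha
    obtain ⟨x, y, rfl⟩ := hbase a (hPK ha)
    refine commute_pr.2 ⟨?_, Commute.one_left _⟩
    obtain ⟨i, hi⟩ := mem_zpowers_iff.1 (hCz (π t₁) (π x) hπt)
    have h1 : pr x y * (pr t₁ t₂ ^ i)⁻¹ ∈ P := mul_mem ha (inv_mem (zpow_mem htP i))
    have h2 : pr t₁ t₂ ^ i = pr (t₁ ^ i) (t₂ ^ i) := (map_zpow prHom (t₁, t₂) i).symm
    rw [h2, pr_inv, pr_mul] at h1
    -- This is a 3-element of `ker π` that commutes with `q₁`.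
    have h3 : x * (t₁ ^ i)⁻¹ = 1 := by
      refine hs _ ?_ ?_ (commute_pr.1 (hcomm _ h1 _ hqB)).1
      · rw [map_mul, map_inv, map_zpow, hi, mul_inv_cancel]
      · obtain ⟨n, hn⟩ := hP ⟨_, h1⟩
        have hn' := congrArg Subtype.val hn
        change pr _ _ ^ _ = 1 at hn'
        rw [pr_pow, ← pr_one, pr_inj] at hn'
        exact ⟨n, hn'.1⟩
    rw [mul_inv_eq_one.1 h3]
    exact hz.zpow_right i
  have hVK : ∀ v ∈ V, pr v 1 ∈ K := by
    intro v hv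
    refine hK.self _ (pr_mem_twist.2 (by rw [(hV v hv).1, map_one, one_mul]))
      (mem_normalizer_of_forall_conj_mem fun k hk => ?_)
    obtain ⟨a, ha, b, hb, rfl⟩ := hdec k hk
    obtain ⟨x, y, rfl⟩ := hbase b (hBK hb)
    have hxV : x ∈ V := hVmem x (hBker x y hb).1 (hBker x y hb).2.1 (hBker x y hb).2.2
    have h1 : Commute (pr v 1) (pr x y) := commute_pr.2 ⟨hVcomm v hv x hxV, Commute.one_left _⟩
    rw [((hPform v (hV v hv).2.1 a ha).mul_right h1).eq, mul_inv_cancel_right]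
    exact hk
  have hwK : pr w 1 ∈ K := by
    refine hK.self _ (pr_mem_twist.2 (by rw [hwπ, map_one, one_mul]))
      (mem_normalizer_of_forall_conj_mem fun k hk => ?_)
    obtain ⟨a, ha, b, hb, rfl⟩ := hdec k hk
    obtain ⟨x, y, rfl⟩ := hbase b (hBK hb)
    have hxV : x ∈ V := hVmem x (hBker x y hb).1 (hBker x y hb).2.1 (hBker x y hb).2.2
    have hx := hV x hxV
    have hwx : w * x * w⁻¹ ∈ V := by
      refine hVmem _ (by simp [hwπ, hx.1]) ((hwt.mul_left hx.2.1).mul_left hwt.inv_left)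
        ⟨2, by norm_num, ?_⟩
      rw [conj_pow, hx.2.2, mul_one, mul_inv_cancel]
    -- Conjugation by `(w, 1)` changes an element of `K` only by a factor from V × 1, which is
    -- already known to lie in `K`.
    have h1 : pr w 1 * (a * pr x y) * (pr w 1)⁻¹ = a * (pr (w * x * w⁻¹ * x⁻¹) 1 * pr x y) := by
      rw [← mul_assoc, (hPform w hwt a ha).eq, mul_assoc, mul_assoc, ← mul_assoc (pr w 1),
        pr_conj_pr, pr_mul]
      simp
    rw [h1]
    exact mul_mem (hPK ha) (mul_mem (hVK _ (mul_mem hwx (inv_mem hxV))) (hBK hb))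
  have hwP : pr w 1 ∈ P := hmax _ hwK ⟨1, by rw [pow_one, pr_pow, hw3, one_pow, pr_one]⟩
  have hvB : pr v 1 ∈ B := hBmem _ (hVK v hv)
    ⟨2, by norm_num, by rw [pr_pow, (hV v hv).2.2, one_pow, pr_one]⟩
  exact hwv (commute_pr.1 (hcomm _ hwP _ hvB)).1

end Twist

/-! ### The group `twist π` has no Carter subgroup -/

section Twist

variable {A C : Type*} [Group A] [CommGroup C] {π : A →* C} [Finite A]

theorem exists_pr_of_coprime_two {g : Wr A} {m : ℕ} (hm : g ^ m = 1) (h2 : m.Coprime 2) :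
    ∃ x y, g = pr x y := by
  obtain ⟨x, y, rfl | rfl⟩ := eq_pr_or g
  · exact ⟨x, y, rfl⟩
  · have h1 := congrArg (SemidirectProduct.rightHom) hm
    rw [map_pow, map_one, SemidirectProduct.rightHom_eq_right, pr_mul_sw_right] at h1
    have h3 := eq_one_of_pow_eq_one_of_coprime h1 (n := 2) (by decide) h2
    exact absurd h3 (by decide)

/-- The 3-part `(p', q')` of a base element commutes with the 3′-part of the swapping element,
whence `π p' = π q'`. These values are also inverse to each other and of exponent 3, hence trivial.
-/
theorem eq_one_of_swap_mem {K : Subgroup (Wr A)} (hKT : K ≤ twist π) [Group.IsNilpotent K]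
    (hC3 : ∀ a : C, a ^ 3 = 1) {u v : A} (hs : pr u v * sw ∈ K) {x y : A} (hxy : pr x y ∈ K) :
    π x = 1 := by
  have : Fact (Nat.Prime 3) := ⟨Nat.prime_three⟩
  obtain ⟨P, B, hPK, hBK, hP, hB, hcomm, hdec, hmax⟩ := exists_isPGroup_mul_coprime K 3
  have hBpow : ∀ b ∈ B, b ^ Nat.card B = 1 := fun b hb =>
    congrArg Subtype.val (pow_card_eq_one' (x := (⟨b, hb⟩ : B)))
  have hPpr : ∀ a ∈ P, ∃ x y, a = pr x y := by
    intro a ha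
    obtain ⟨n, hn⟩ := hP ⟨a, ha⟩
    exact exists_pr_of_coprime_two (congrArg Subtype.val hn) (Nat.Coprime.pow_left n (by norm_num))
  obtain ⟨a, ha, b, hb, he⟩ := hdec _ hs
  obtain ⟨a', ha', b', hb', he'⟩ := hdec _ hxy
  obtain ⟨p, q, rfl⟩ := hPpr a ha
  obtain ⟨p', q', rfl⟩ := hPpr a' ha'
  obtain ⟨r, s, rfl | rfl⟩ := eq_pr_or b
  · rw [pr_mul] at he
    exact absurd he.symm (pr_ne_pr_mul_sw _ _ _ _)
  obtain ⟨r', s', rfl | rfl⟩ := eq_pr_or b'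
  swap
  · rw [← mul_assoc, pr_mul] at he'
    exact absurd he' (pr_ne_pr_mul_sw _ _ _ _)
  have hr' : π r' = 1 := by
    have h1 := hBpow _ hb'
    rw [pr_pow, ← pr_one, pr_inj] at h1
    refine eq_one_of_pow_eq_one_of_coprime (m := Nat.card B) ?_ (hC3 _) hB
    rw [← map_pow, h1.1, map_one]
  have hp' : π p' = π q' := by
    have h1 := hcomm _ ha' _ hb
    rw [Commute, SemiconjBy, pr_mul_sw_mul, ← mul_assoc, pr_mul, mul_left_inj, pr_inj] at h1
    have h2 := congrArg π h1.1
    rw [map_mul, map_mul, mul_comm] at h2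
    exact mul_left_cancel h2
  have h2 : π p' ^ 2 = 1 := by
    have := pr_mem_twist.1 (hKT (hPK ha'))
    rwa [← hp', ← pow_two] at this
  rw [pr_mul, pr_inj] at he'
  rw [he'.1, map_mul, hr', mul_one]
  exact eq_one_of_pow_eq_one_of_coprime h2 (hC3 _) (by norm_num)

theorem not_hasCarter_twist (hC3 : ∀ a : C, a ^ 3 = 1)
    (hCz : ∀ a b : C, a ≠ 1 → b ∈ zpowers a) (hS : ¬ HasCarter π.ker)
    (hcent : CentralizerCondition π) : ¬ HasCarter (twist π) := by
  intro h
  obtain ⟨K, hK⟩ := h.exists_isCarterIn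
  have := hK.nilpotent
  have : Fact (Nat.Prime 3) := ⟨Nat.prime_three⟩
  by_cases hsw : ∃ u v, pr u v * sw ∈ K
  · obtain ⟨u, v, huv⟩ := hsw
    obtain ⟨P, B, hPK, hBK, hP, hB, hcomm, hdec, hmax⟩ := exists_isPGroup_mul_coprime K 2
    have hBpow : ∀ b ∈ B, b ^ Nat.card B = 1 := fun b hb =>
      congrArg Subtype.val (pow_card_eq_one' (x := (⟨b, hb⟩ : B)))
    obtain ⟨a, ha, b, hb, he⟩ := hdec _ huv
    obtain ⟨r, s, rfl⟩ := exists_pr_of_coprime_two (hBpow b hb) hB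
    obtain ⟨p, q, rfl | rfl⟩ := eq_pr_or a
    · rw [pr_mul] at he
      exact absurd he.symm (pr_ne_pr_mul_sw _ _ _ _)
    have hpq : π p * π q = 1 := pr_mul_sw_mem_twist.1 (hK.le (hPK ha))
    -- Conjugation by `(p, p²)` turns `(p, q) sw` into an element with first coordinate 1. It stays
    -- inside `twist π` because `C` has exponent 3.
    have hg : pr p (p * p) ∈ twist π := by
      rw [pr_mem_twist, map_mul, ← pow_two, ← pow_succ', hC3]
    have hK' := hK.conj hg
    set K' := K.map (MulAut.conj (pr p (p * p))).toMonoidHom with hKdef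
    set c := p * p * q * p⁻¹ with hc
    have hconj : pr p (p * p) * (pr p q * sw) * (pr p (p * p))⁻¹ = pr 1 c * sw := by
      rw [pr_conj_pr_mul_sw, mul_inv_cancel]
    have ht : pr 1 c * sw ∈ K' := ⟨_, hPK ha, hconj⟩
    have hπc : π c = 1 := by
      have := pr_mul_sw_mem_twist.1 (hK'.le ht)
      rwa [map_one, one_mul] at this
    have hn' := hK'.nilpotent
    have hker : ∀ x y, pr x y ∈ K' → π x = 1 ∧ π y = 1 := by
      intro x y hxy
      have h1 := eq_one_of_swap_mem hK'.le hC3 ht hxy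
      have h2 := pr_mem_twist.1 (hK'.le hxy)
      rw [h1, one_mul] at h2
      exact ⟨h1, h2⟩
    refine hS (hasCarter_of_mem_swap (K := K') ?_ ?_ ht ?_)
    · intro k hk
      obtain ⟨x, y, rfl | rfl⟩ := eq_pr_or k
      · exact ⟨x, (hker x y hk).1, y, (hker x y hk).2, Or.inl rfl⟩
      · have h1 := mul_mem hk (inv_mem ht)
        rw [mul_inv_rev, sw_inv, pr_inv, ← mul_assoc, mul_assoc (pr x y), sw_mul_sw, mul_one,
          pr_mul, inv_one, mul_one] at h1
        obtain ⟨h2, h3⟩ := hker _ _ h1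
        refine ⟨x, h2, y, ?_, Or.inr rfl⟩
        rwa [map_mul, map_inv, hπc, inv_one, mul_one] at h3
    · intro x hx y hy hxy
      refine hK'.self _ (pr_mem_twist.2 ?_) hxy
      rw [MonoidHom.mem_ker.1 hx, MonoidHom.mem_ker.1 hy, one_mul]
    · obtain ⟨n, hn⟩ := hP ⟨_, ha⟩
      refine ⟨n, ?_⟩
      have hn' : (pr p q * sw) ^ 2 ^ n = 1 := congrArg Subtype.val hn
      rw [← hconj, conj_pow, hn', mul_one, mul_inv_cancel]
  · push Not at hsw
    have hbase : ∀ k ∈ K, ∃ x y, k = pr x y := by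
      intro k hk
      obtain ⟨x, y, rfl | rfl⟩ := eq_pr_or k
      · exact ⟨x, y, rfl⟩
      · exact absurd hk (hsw x y)
    by_cases hker : ∀ x y, pr x y ∈ K → π x = 1
    · refine hS (hasCarter_of_le_base (K := K) ?_ ?_)
      · intro k hk
        obtain ⟨x, y, rfl⟩ := hbase k hk
        have h1 := hker x y hk
        have h2 := pr_mem_twist.1 (hK.le hk)
        rw [h1, one_mul] at h2
        exact ⟨x, h1, y, h2, rfl⟩
      · intro x hx y hy hxy
        refine hK.self _ (pr_mem_twist.2 ?_) hxy
        rw [MonoidHom.mem_ker.1 hx, MonoidHom.mem_ker.1 hy, one_mul]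
    · push Not at hker
      obtain ⟨x, y, hxy, hx⟩ := hker
      obtain ⟨P, B, hPK, hBK, hP, hB, hcomm, hdec, hmax⟩ := exists_isPGroup_mul_coprime K 3
      have hBpow : ∀ b ∈ B, b ^ Nat.card B = 1 := fun b hb =>
        congrArg Subtype.val (pow_card_eq_one' (x := (⟨b, hb⟩ : B)))
      obtain ⟨a, ha, b, hb, he⟩ := hdec _ hxy
      obtain ⟨r, s, rfl⟩ := hbase b (hBK hb)
      obtain ⟨p, q, rfl⟩ := hbase a (hPK ha)
      have hr : π r = 1 := by
        have h1 := hBpow _ hb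
        rw [pr_pow, ← pr_one, pr_inj] at h1
        refine eq_one_of_pow_eq_one_of_coprime (m := Nat.card B) ?_ (hC3 _) hB
        rw [← map_pow, h1.1, map_one]
      have hp : π p ≠ 1 := by
        rw [pr_mul, pr_inj] at he
        rwa [he.1, map_mul, hr, mul_one] at hx
      have hq : π q ≠ 1 := by
        intro h
        have := pr_mem_twist.1 (hK.le (hPK ha))
        rw [h, mul_one] at this
        exact hp this
      have hp3 : ∃ n, pr p q ^ 3 ^ n = 1 :=
        (hP ⟨_, ha⟩).imp fun n hn => congrArg Subtype.val hn
      -- The swap-conjugate of `K` gives access to the second coordinate.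
      have hKs := hK.conj sw_mem_twist
      have hB1 : ∀ b ∈ B, b = 1 := by
        intro b hb
        obtain ⟨r, s, rfl⟩ := hbase b (hBK hb)
        have h1 : r = 1 := eq_one_of_coprime_mem hK hC3 hCz hcent hbase (hPK ha) hp3 hp (hBK hb)
          ⟨_, hB, hBpow _ hb⟩
        have h2 : s = 1 := by
          refine eq_one_of_coprime_mem hKs hC3 hCz hcent ?_ (t₁ := q) (t₂ := p) (q₂ := r)
            ⟨_, hPK ha, sw_conj_pr p q⟩ ?_ hq ⟨_, hBK hb, sw_conj_pr r s⟩ ?_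
          · rintro _ ⟨k, hk, rfl⟩
            obtain ⟨x, y, rfl⟩ := hbase k hk
            exact ⟨y, x, sw_conj_pr x y⟩
          · obtain ⟨n, hn⟩ := hp3
            exact ⟨n, by rw [← sw_conj_pr, conj_pow, hn, mul_one, mul_inv_cancel]⟩
          · exact ⟨_, hB, by rw [← sw_conj_pr, conj_pow, hBpow _ hb, mul_one, mul_inv_cancel]⟩
        rw [h1, h2, pr_one]
      have hK3 : IsPGroup 3 K := isPGroup_of_forall_coprime hP hdec hB1
      -- Frattini's argument in the intersection with the base group
      let Q : Sylow 3 (twist π) := ⟨K.subgroupOf (twist π),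
        hK3.of_equiv (subgroupOfEquivOfLe hK.le).symm, fun {R} hR hQR =>
          (IsPGroup.eq_of_le_of_normalizer hR hQR fun g hg _ => by
            rwa [hK.normalizer_subgroupOf] at hg).symm⟩
      let N : Subgroup (twist π) := (SemidirectProduct.rightHom.comp (twist π).subtype).ker
      have hQN : (Q : Subgroup (twist π)) ≤ N := by
        intro k hk
        obtain ⟨x, y, he⟩ := hbase k hk
        change SemidirectProduct.rightHom (k : Wr A) = 1
        rw [he]
        rfl
      have h1 := Sylow.normalizer_sup_eq_top' Q hQN
      have h2 : normalizer (Q : Set (twist π)) = Q := hK.normalizer_subgroupOf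
      have h3 : (⟨sw, sw_mem_twist⟩ : twist π) ∈ N := by
        have : normalizer (Q : Set (twist π)) ⊔ N ≤ N := sup_le (h2.le.trans hQN) le_rfl
        exact this (h1 ▸ mem_top _)
      have h4 : (Equiv.swap 0 1 : Equiv.Perm (Fin 2)) = 1 := h3
      exact absurd h4 (by decide)

end Twist

/-! ### Automorphism groups of sections with simple quotient -/

section Factors

variable {Γ : Type*} [Group Γ]

theorem le_or_eq_sup_of_isSimpleGroup {A B N : Subgroup Γ} [(B.subgroupOf A).Normal]
    [IsSimpleGroup (A ⧸ B.subgroupOf A)] (hBA : B ≤ A) (hNA : N ≤ A)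
    (hN : A ≤ normalizer (N : Set Γ)) : N ≤ B ∨ A = N ⊔ B := by
  have hn : (N.subgroupOf A).Normal := (normal_subgroupOf_iff_le_normalizer hNA).2 hN
  have hm := hn.map (QuotientGroup.mk' (B.subgroupOf A)) (QuotientGroup.mk'_surjective _)
  rcases hm.eq_bot_or_eq_top with h | h
  · left
    rw [Subgroup.map_eq_bot_iff, QuotientGroup.ker_mk'] at h
    intro n hn
    exact h (show (⟨n, hNA hn⟩ : A) ∈ N.subgroupOf A from hn)
  · right
    refine le_antisymm (fun a ha => ?_) (sup_le hNA hBA)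
    have h1 : QuotientGroup.mk' (B.subgroupOf A) ⟨a, ha⟩ ∈
        (N.subgroupOf A).map (QuotientGroup.mk' (B.subgroupOf A)) := h ▸ mem_top _
    obtain ⟨n, hn, he⟩ := h1
    have h2 := QuotientGroup.eq.1 he
    have h3 : a = n * ((n : Γ)⁻¹ * a) := by group
    rw [h3]
    exact mul_mem (mem_sup_left hn) (mem_sup_right h2)

/-- A commutative simple group is cyclic, and a cyclic group has abelian automorphism group. -/
theorem mulAut_mul_comm {S : Type*} [Group S] [Finite S] [IsSimpleGroup S]
    (h : ∀ a b : S, a * b = b * a) (f g : MulAut S) : f * g = g * f := by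
  let : CommGroup S := { (inferInstance : Group S) with mul_comm := h }
  have : IsCyclic S := IsSimpleGroup.isCyclic
  let e := IsCyclic.mulAutMulEquiv S
  apply e.injective
  rw [map_mul, map_mul, mul_comm]

theorem hasCarter_of_mul_comm {S : Type*} [Group S] [Finite S] [IsSimpleGroup S]
    (h : ∀ a b : S, a * b = b * a) (K : Subgroup (MulAut S)) : HasCarter K :=
  hasCarter_of_commute fun f g => Subtype.ext (mulAut_mul_comm h f g)

theorem hasCarter_autSection [Finite Γ] {A B Q : Subgroup Γ} [(B.subgroupOf A).Normal] {p : ℕ}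
    [Fact p.Prime] (hp : IsPGroup p Q) (hQ : IsCarterIn (sectionNormalizer A B) Q) :
    HasCarter (autSection ⊤ A B) := by
  have hmem : ∀ x, sectionConj A B x ∈ autSection ⊤ A B := fun x => ⟨x, mem_top _, rfl⟩
  refine HasCarter.of_surjective (Q := Q.subgroupOf (sectionNormalizer A B))
    (hp.of_equiv (subgroupOfEquivOfLe hQ.le).symm) hQ.normalizer_subgroupOf
    ((sectionConj A B).codRestrict (autSection ⊤ A B) hmem) ?_
  rintro ⟨_, x, -, rfl⟩
  exact ⟨x, rfl⟩

end Factors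

/-! ### Subgroups of `twist π` normalized by ker π × ker π -/

section Twist

variable {A C : Type*} [Group A] [CommGroup C] (π : A →* C)

/-- The group `ker π × ker π`. -/
def kerBase : Subgroup (Wr A) := (π.ker.prod π.ker).map prHom

/-- The group `ker π × 1`. -/
def kerFst : Subgroup (Wr A) := (π.ker.prod ⊥).map prHom

/-- The group `1 × ker π`. -/
def kerSnd : Subgroup (Wr A) := ((⊥ : Subgroup A).prod π.ker).map prHom

/-- The intersection of the base group with `twist π`. -/
def twistBase : Subgroup (Wr A) := twist π ⊓ SemidirectProduct.rightHom.ker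

variable {π}

theorem mem_kerBase {g : Wr A} : g ∈ kerBase π ↔ ∃ x y, π x = 1 ∧ π y = 1 ∧ g = pr x y := by
  constructor
  · rintro ⟨⟨x, y⟩, ⟨hx, hy⟩, rfl⟩
    exact ⟨x, y, hx, hy, rfl⟩
  · rintro ⟨x, y, hx, hy, rfl⟩
    exact ⟨(x, y), ⟨hx, hy⟩, rfl⟩

theorem mem_kerFst {g : Wr A} : g ∈ kerFst π ↔ ∃ x, π x = 1 ∧ g = pr x 1 := by
  constructor
  · rintro ⟨⟨x, y⟩, ⟨hx, hy⟩, rfl⟩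
    obtain rfl : y = 1 := hy
    exact ⟨x, hx, rfl⟩
  · rintro ⟨x, hx, rfl⟩
    exact ⟨(x, 1), ⟨hx, rfl⟩, rfl⟩

theorem mem_kerSnd {g : Wr A} : g ∈ kerSnd π ↔ ∃ y, π y = 1 ∧ g = pr 1 y := by
  constructor
  · rintro ⟨⟨x, y⟩, ⟨hx, hy⟩, rfl⟩
    obtain rfl : x = 1 := hx
    exact ⟨y, hy, rfl⟩
  · rintro ⟨y, hy, rfl⟩
    exact ⟨(1, y), ⟨rfl, hy⟩, rfl⟩

theorem mem_twistBase {g : Wr A} : g ∈ twistBase π ↔ ∃ x y, π x * π y = 1 ∧ g = pr x y := by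
  constructor
  · rintro ⟨h1, h2⟩
    obtain ⟨x, y, rfl | rfl⟩ := eq_pr_or g
    · exact ⟨x, y, h1, rfl⟩
    · have h2 : (pr x y * sw).right = 1 := h2
      rw [pr_mul_sw_right] at h2
      exact absurd h2 (by decide)
  · rintro ⟨x, y, h, rfl⟩
    exact ⟨h, rfl⟩

theorem pr_mem_kerBase {x y : A} : pr x y ∈ kerBase π ↔ π x = 1 ∧ π y = 1 := by
  rw [mem_kerBase]
  constructor
  · rintro ⟨u, v, hu, hv, he⟩
    rw [pr_inj] at he
    rw [he.1, he.2]
    exact ⟨hu, hv⟩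
  · rintro ⟨hx, hy⟩
    exact ⟨x, y, hx, hy, rfl⟩

theorem pr_mem_kerFst {x y : A} : pr x y ∈ kerFst π ↔ π x = 1 ∧ y = 1 := by
  rw [mem_kerFst]
  constructor
  · rintro ⟨u, hu, he⟩
    rw [pr_inj] at he
    rw [he.1, he.2]
    exact ⟨hu, rfl⟩
  · rintro ⟨hx, rfl⟩
    exact ⟨x, hx, rfl⟩

theorem pr_mem_kerSnd {x y : A} : pr x y ∈ kerSnd π ↔ x = 1 ∧ π y = 1 := by
  rw [mem_kerSnd]
  constructor
  · rintro ⟨u, hu, he⟩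
    rw [pr_inj] at he
    rw [he.1, he.2]
    exact ⟨rfl, hu⟩
  · rintro ⟨rfl, hx⟩
    exact ⟨y, hx, rfl⟩

theorem kerBase_le_twist : kerBase π ≤ twist π := by
  intro g hg
  obtain ⟨x, y, hx, hy, rfl⟩ := mem_kerBase.1 hg
  rw [pr_mem_twist, hx, hy, one_mul]

theorem kerFst_le_kerBase : kerFst π ≤ kerBase π := by
  intro g hg
  obtain ⟨x, hx, rfl⟩ := mem_kerFst.1 hg
  exact pr_mem_kerBase.2 ⟨hx, map_one π⟩

theorem kerSnd_le_kerBase : kerSnd π ≤ kerBase π := by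
  intro g hg
  obtain ⟨x, hx, rfl⟩ := mem_kerSnd.1 hg
  exact pr_mem_kerBase.2 ⟨map_one π, hx⟩

theorem kerBase_le_twistBase : kerBase π ≤ twistBase π := by
  intro g hg
  obtain ⟨x, y, hx, hy, rfl⟩ := mem_kerBase.1 hg
  exact mem_twistBase.2 ⟨x, y, by rw [hx, hy, one_mul], rfl⟩

theorem kerBase_le {B : Subgroup (Wr A)} (h₁ : kerFst π ≤ B) (h₂ : kerSnd π ≤ B) :
    kerBase π ≤ B := by
  intro g hg
  obtain ⟨x, y, hx, hy, rfl⟩ := mem_kerBase.1 hg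
  have : pr x y = pr x 1 * pr 1 y := by rw [pr_mul, mul_one, one_mul]
  rw [this]
  exact mul_mem (h₁ (pr_mem_kerFst.2 ⟨hx, rfl⟩)) (h₂ (pr_mem_kerSnd.2 ⟨rfl, hy⟩))

theorem le_normalizer_kerBase : twist π ≤ normalizer (kerBase π : Set (Wr A)) := by
  rw [le_normalizer_iff]
  intro g _ k hk
  obtain ⟨u, v, hu, hv, rfl⟩ := mem_kerBase.1 hk
  obtain ⟨x, y, rfl | rfl⟩ := eq_pr_or g
  · rw [pr_conj_pr, pr_mem_kerBase]
    simp [hu, hv]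
  · rw [mul_inv_rev, ← mul_assoc, mul_assoc (pr x y), mul_assoc (pr x y), sw_conj_pr, pr_conj_pr,
      pr_mem_kerBase]
    simp [hu, hv]

theorem le_normalizer_twistBase : twist π ≤ normalizer (twistBase π : Set (Wr A)) := by
  rw [le_normalizer_iff]
  intro g hg k hk
  obtain ⟨hk, hk'⟩ := mem_inf.1 hk
  refine mem_inf.2 ⟨mul_mem (mul_mem hg hk) (inv_mem hg), ?_⟩
  rw [MonoidHom.mem_ker] at hk' ⊢
  rw [map_mul, map_mul, hk', mul_one, map_inv, mul_inv_cancel]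

theorem twist_inf_normalizer_kerFst (hnt : ∃ s, π s = 1 ∧ s ≠ 1) :
    twist π ⊓ normalizer (kerFst π : Set (Wr A)) = twistBase π := by
  apply le_antisymm
  · rintro g ⟨hg, hgN⟩
    obtain ⟨x, y, rfl | rfl⟩ := eq_pr_or g
    · exact mem_twistBase.2 ⟨x, y, hg, rfl⟩
    · obtain ⟨s, hs, hs1⟩ := hnt
      have := (mem_normalizer_iff.1 hgN (pr s 1)).1 (pr_mem_kerFst.2 ⟨hs, rfl⟩)
      rw [mul_inv_rev, ← mul_assoc, mul_assoc (pr x y), mul_assoc (pr x y), sw_conj_pr,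
        pr_conj_pr] at this
      have h1 := (pr_mem_kerFst.1 this).2
      rw [conj_eq_one_iff] at h1
      exact absurd h1 hs1
  · refine le_inf inf_le_left (le_normalizer_iff.2 fun g hg k hk => ?_)
    obtain ⟨x, y, h, rfl⟩ := mem_twistBase.1 hg
    obtain ⟨s, hs, rfl⟩ := mem_kerFst.1 hk
    rw [pr_conj_pr, pr_mem_kerFst]
    simp [hs]

theorem twist_inf_normalizer_kerSnd (hnt : ∃ s, π s = 1 ∧ s ≠ 1) :
    twist π ⊓ normalizer (kerSnd π : Set (Wr A)) = twistBase π := by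
  apply le_antisymm
  · rintro g ⟨hg, hgN⟩
    obtain ⟨x, y, rfl | rfl⟩ := eq_pr_or g
    · exact mem_twistBase.2 ⟨x, y, hg, rfl⟩
    · obtain ⟨s, hs, hs1⟩ := hnt
      have := (mem_normalizer_iff.1 hgN (pr 1 s)).1 (pr_mem_kerSnd.2 ⟨rfl, hs⟩)
      rw [mul_inv_rev, ← mul_assoc, mul_assoc (pr x y), mul_assoc (pr x y), sw_conj_pr,
        pr_conj_pr] at this
      have h1 := (pr_mem_kerSnd.1 this).1
      rw [conj_eq_one_iff] at h1
      exact absurd h1 hs1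
  · refine le_inf inf_le_left (le_normalizer_iff.2 fun g hg k hk => ?_)
    obtain ⟨x, y, h, rfl⟩ := mem_twistBase.1 hg
    obtain ⟨s, hs, rfl⟩ := mem_kerSnd.1 hk
    rw [pr_conj_pr, pr_mem_kerSnd]
    simp [hs]

section Classification

variable (hZ : ∀ x : A, (∀ s, π s = 1 → Commute s x) → x = 1) [IsSimpleGroup π.ker]
  {B : Subgroup (Wr A)} (hB : kerBase π ≤ normalizer (B : Set (Wr A)))

-- Commutators of `(x, y)` with `(s, 1)`, `s` in `ker π`, lie in `B` and in ker π × 1. Not all are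
-- trivial, since only 1 centralizes `ker π`; simplicity of `ker π` gives the rest.
include hZ hB in
theorem kerFst_le_of_mem {x y : A} (hxy : pr x y ∈ B) (hx : x ≠ 1) : kerFst π ≤ B := by
  let D : Subgroup π.ker := B.comap (prHom.comp ((MonoidHom.inl A A).comp π.ker.subtype))
  have hD : ∀ s : π.ker, s ∈ D ↔ pr (s : A) 1 ∈ B := fun s => Iff.rfl
  have hDn : D.Normal := by
    refine ⟨fun d hd g => ?_⟩
    rw [hD] at hd ⊢
    have := (mem_normalizer_iff.1 (hB (pr_mem_kerBase.2 ⟨g.2, map_one π⟩)) _).1 hd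
    rw [pr_conj_pr] at this
    simpa using this
  have hDtop : D = ⊤ := by
    refine hDn.eq_bot_or_eq_top.resolve_left fun hbot => hx (hZ x fun s hs => ?_)
    have h1 := (mem_normalizer_iff.1 (hB (pr_mem_kerBase (y := 1).2 ⟨hs, map_one π⟩)) _).1 hxy
    have h2 := mul_mem h1 (inv_mem hxy)
    rw [pr_conj_pr, pr_inv, pr_mul, one_mul, inv_one, mul_one, mul_inv_cancel] at h2
    have h3 : (⟨s * x * s⁻¹ * x⁻¹, by simp [MonoidHom.mem_ker, hs]⟩ : π.ker) ∈ D := h2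
    rw [hbot, mem_bot] at h3
    have h4 : s * x * s⁻¹ * x⁻¹ = 1 := congrArg Subtype.val h3
    rw [mul_inv_eq_one, mul_inv_eq_iff_eq_mul] at h4
    exact h4
  intro g hg
  obtain ⟨s, hs, rfl⟩ := mem_kerFst.1 hg
  exact (hD ⟨s, hs⟩).1 (hDtop ▸ mem_top _)

include hZ hB in
theorem kerSnd_le_of_mem {x y : A} (hxy : pr x y ∈ B) (hy : y ≠ 1) : kerSnd π ≤ B := by
  have h1 : kerBase π ≤ normalizer ((B.map (MulAut.conj (sw : Wr A)).toMonoidHom : Subgroup _) :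
      Set (Wr A)) := by
    rw [le_normalizer_iff]
    rintro g hg _ ⟨k, hk, rfl⟩
    obtain ⟨u, v, hu, hv, rfl⟩ := mem_kerBase.1 hg
    refine ⟨pr v u * k * (pr v u)⁻¹,
      (mem_normalizer_iff.1 (hB (pr_mem_kerBase.2 ⟨hv, hu⟩)) k).1 hk, ?_⟩
    change sw * (pr v u * k * (pr v u)⁻¹) * sw⁻¹ = pr u v * (sw * k * sw⁻¹) * (pr u v)⁻¹
    rw [← sw_conj_pr v u]
    group
  have h2 := kerFst_le_of_mem hZ h1 (x := y) (y := x) ⟨_, hxy, sw_conj_pr x y⟩ hy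
  intro g hg
  obtain ⟨s, hs, rfl⟩ := mem_kerSnd.1 hg
  obtain ⟨k, hk, he⟩ := h2 (pr_mem_kerFst.2 ⟨hs, rfl⟩)
  have : k = pr 1 s := by
    refine (MulAut.conj (sw : Wr A)).injective (he.trans ?_)
    exact (sw_conj_pr 1 s).symm
  rwa [← this]

-- This list controls every term of a composition series of `twist π`, and determines its minimal
-- normal subgroup.
include hZ hB in
theorem kerBase_le_or_eq (hBG : B ≤ twist π) :
    kerBase π ≤ B ∨ B = ⊥ ∨ B = kerFst π ∨ B = kerSnd π := by
  by_cases hsw : ∃ x y, pr x y * sw ∈ B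
  · left
    obtain ⟨x, y, hxy⟩ := hsw
    obtain ⟨⟨s, hs⟩, hs1⟩ := exists_ne (1 : π.ker)
    have hs1' : s ≠ 1 := fun h => hs1 (Subtype.ext h)
    have h1 := (mem_normalizer_iff.1 (hB (pr_mem_kerBase (y := 1).2 ⟨hs, map_one π⟩)) _).1 hxy
    -- The commutator of `(s, 1)` with `(x, y) sw` is `(s, y s⁻¹ y⁻¹)`, non-trivial in both
    -- coordinates.
    have h2 := mul_mem h1 (inv_mem hxy)
    rw [pr_conj_pr_mul_sw, mul_inv_rev, sw_inv, pr_inv, ← mul_assoc, mul_assoc (pr _ _),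
      sw_mul_sw, mul_one, pr_mul] at h2
    refine kerBase_le (kerFst_le_of_mem hZ hB h2 ?_) (kerSnd_le_of_mem hZ hB h2 ?_)
    · simpa using hs1'
    · simpa using hs1'
  push Not at hsw
  have hpr : ∀ b ∈ B, ∃ x y, b = pr x y := by
    intro b hb
    obtain ⟨x, y, rfl | rfl⟩ := eq_pr_or b
    · exact ⟨x, y, rfl⟩
    · exact absurd hb (hsw x y)
  by_cases h1 : ∃ x y, pr x y ∈ B ∧ x ≠ 1 <;> by_cases h2 : ∃ x y, pr x y ∈ B ∧ y ≠ 1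
  · obtain ⟨x, y, hxy, hx⟩ := h1
    obtain ⟨u, v, huv, hv⟩ := h2
    exact Or.inl (kerBase_le (kerFst_le_of_mem hZ hB hxy hx) (kerSnd_le_of_mem hZ hB huv hv))
  · obtain ⟨x, y, hxy, hx⟩ := h1
    push Not at h2
    refine Or.inr (Or.inr (Or.inl (le_antisymm ?_ (kerFst_le_of_mem hZ hB hxy hx))))
    intro b hb
    obtain ⟨u, v, rfl⟩ := hpr b hb
    obtain rfl := h2 u v hb
    have := pr_mem_twist.1 (hBG hb)
    rw [map_one, mul_one] at this
    exact pr_mem_kerFst.2 ⟨this, rfl⟩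
  · obtain ⟨x, y, hxy, hy⟩ := h2
    push Not at h1
    refine Or.inr (Or.inr (Or.inr (le_antisymm ?_ (kerSnd_le_of_mem hZ hB hxy hy))))
    intro b hb
    obtain ⟨u, v, rfl⟩ := hpr b hb
    obtain rfl := h1 u v hb
    have := pr_mem_twist.1 (hBG hb)
    rw [map_one, one_mul] at this
    exact pr_mem_kerSnd.2 ⟨rfl, this⟩
  · push Not at h1 h2
    refine Or.inr (Or.inl ((eq_bot_iff_forall _).2 fun b hb => ?_))
    obtain ⟨u, v, rfl⟩ := hpr b hb
    obtain rfl := h1 u v hb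
    obtain rfl := h2 1 v hb
    exact pr_one

end Classification

end Twist

/-! ### Abelian factors above the kernel, and a Carter subgroup of `twistBase π` -/

section Twist

variable {A C : Type*} [Group A] [CommGroup C] {π : A →* C}

theorem kerBase_subgroupOf_le_or_eq (hZ : ∀ x : A, (∀ s, π s = 1 → Commute s x) → x = 1)
    [IsSimpleGroup π.ker] {B : Subgroup (twist π)}
    (hB : (kerBase π).subgroupOf (twist π) ≤ normalizer (B : Set (twist π))) :
    (kerBase π).subgroupOf (twist π) ≤ B ∨ B = ⊥ ∨ B = (kerFst π).subgroupOf (twist π) ∨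
      B = (kerSnd π).subgroupOf (twist π) := by
  have hBB : (B.map (twist π).subtype).subgroupOf (twist π) = B :=
    comap_map_eq_self_of_injective (twist π).subtype_injective B
  have h1 : kerBase π ≤ normalizer ((B.map (twist π).subtype : Subgroup (Wr A)) : Set (Wr A)) := by
    rw [le_normalizer_iff]
    rintro g hg _ ⟨b, hb, rfl⟩
    have h2 : (⟨g, kerBase_le_twist hg⟩ : twist π) ∈ (kerBase π).subgroupOf (twist π) := hg
    exact ⟨_, (mem_normalizer_iff.1 (hB h2) b).1 hb, rfl⟩
  rcases kerBase_le_or_eq hZ h1 (map_subtype_le B) with h | h | h | h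
  · left
    intro g hg
    rw [← hBB]
    exact h hg
  · right; left
    rwa [map_eq_bot_iff_of_injective _ (twist π).subtype_injective] at h
  · right; right; left
    rw [← h, hBB]
  · right; right; right
    rw [← h, hBB]

theorem normal_kerBase : ((kerBase π).subgroupOf (twist π)).Normal :=
  (normal_subgroupOf_iff_le_normalizer kerBase_le_twist).2 le_normalizer_kerBase

theorem twistBase_le_twist : twistBase π ≤ twist π := inf_le_left

theorem normal_twistBase : ((twistBase π).subgroupOf (twist π)).Normal :=
  (normal_subgroupOf_iff_le_normalizer twistBase_le_twist).2 le_normalizer_twistBase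

theorem pr_commutator_mem {a b : Wr A} (ha : a ∈ twistBase π) (hb : b ∈ twistBase π) :
    a⁻¹ * b⁻¹ * a * b ∈ kerBase π := by
  obtain ⟨x, y, -, rfl⟩ := mem_twistBase.1 ha
  obtain ⟨u, v, -, rfl⟩ := mem_twistBase.1 hb
  rw [pr_inv, pr_inv, pr_mul, pr_mul, pr_mul, pr_mem_kerBase]
  constructor
  · rw [map_mul, map_mul, map_mul, map_inv, map_inv, mul_comm (π x)⁻¹]
    simp
  · rw [map_mul, map_mul, map_mul, map_inv, map_inv, mul_comm (π y)⁻¹]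
    simp

theorem commutator_mem_twistBase {a b : Wr A} (ha : a ∈ twist π) (hb : b ∈ twist π) :
    a⁻¹ * b⁻¹ * a * b ∈ twistBase π := by
  refine mem_inf.2 ⟨mul_mem (mul_mem (mul_mem (inv_mem ha) (inv_mem hb)) ha) hb, ?_⟩
  have h : ∀ σ τ : Equiv.Perm (Fin 2), σ⁻¹ * τ⁻¹ * σ * τ = 1 := by decide
  rw [MonoidHom.mem_ker, map_mul, map_mul, map_mul, map_inv, map_inv]
  exact h _ _

/-- Both `twist π / twistBase π` and `twistBase π / kerBase π` are abelian. A simple factor above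
`kerBase π` is a quotient of a subgroup of one of them, according to whether `T ⊓ U` is contained in
`B` or covers `U` modulo `B`. -/
theorem quotient_mul_comm {U B : Subgroup (twist π)} [(B.subgroupOf U).Normal]
    [IsSimpleGroup (U ⧸ B.subgroupOf U)] (hBU : B ≤ U)
    (hB : (kerBase π).subgroupOf (twist π) ≤ B) (a b : U ⧸ B.subgroupOf U) : a * b = b * a := by
  have hn := normal_twistBase (π := π)
  set T := (twistBase π).subgroupOf (twist π) with hT
  have key : ∀ a b : U, (a : twist π)⁻¹ * (b : twist π)⁻¹ * a * b ∈ B →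
      (QuotientGroup.mk a * QuotientGroup.mk b : U ⧸ B.subgroupOf U) =
        QuotientGroup.mk b * QuotientGroup.mk a := by
    intro a b h
    refine (QuotientGroup.eq.2 ?_).symm
    rw [mem_subgroupOf]
    simpa [mul_assoc] using h
  rcases le_or_eq_sup_of_isSimpleGroup hBU (N := T ⊓ U) inf_le_right (by
    rw [le_normalizer_iff]
    exact fun g hg k hk => mem_inf.2
      ⟨hn.conj_mem k hk.1 g, mul_mem (mul_mem hg (mem_inf.1 hk).2) (inv_mem hg)⟩) with h | h
  · induction a using QuotientGroup.induction_on with | H a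
    induction b using QuotientGroup.induction_on with | H b
    refine key a b (h (mem_inf.2 ⟨?_, ?_⟩))
    · exact commutator_mem_twistBase a.1.2 b.1.2
    · exact mul_mem (mul_mem (mul_mem (inv_mem a.2) (inv_mem b.2)) a.2) b.2
  · have hrep : ∀ a : U ⧸ B.subgroupOf U, ∃ n : U, (n : twist π) ∈ T ∧ QuotientGroup.mk n = a := by
      intro a
      induction a using QuotientGroup.induction_on with | H a
      have hNB : B ≤ normalizer ((T ⊓ U : Subgroup (twist π)) : Set (twist π)) := by
        rw [le_normalizer_iff]
        exact fun g hg k hk => mem_inf.2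
          ⟨hn.conj_mem k hk.1 g, mul_mem (mul_mem (hBU hg) (mem_inf.1 hk).2) (inv_mem (hBU hg))⟩
      have h1 : (a : twist π) ∈ ((T ⊓ U ⊔ B : Subgroup (twist π)) : Set (twist π)) := h ▸ a.2
      rw [coe_mul_of_right_le_normalizer_left _ _ hNB] at h1
      obtain ⟨n, hn, b, hb, he⟩ := h1
      refine ⟨⟨n, hn.2⟩, hn.1, QuotientGroup.eq.2 ?_⟩
      rw [mem_subgroupOf]
      have : b = n⁻¹ * a := by
        change n * b = a at he
        rw [← he, inv_mul_cancel_left]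
      change n⁻¹ * (a : twist π) ∈ B
      rwa [← this]
    obtain ⟨n, hn, rfl⟩ := hrep a
    obtain ⟨m, hm, rfl⟩ := hrep b
    exact key n m (hB (pr_commutator_mem hn hm))

/-- The subgroup is the intersection of Q × Q with `twist π`. Since `π` maps `Q` onto `C`, an
element of `twistBase π` can be moved into ker π × ker π by it, and it projects onto `Q` in each
coordinate. So each coordinate of a normalizing element in ker π × ker π normalizes `Q`. -/
theorem isCarterIn_twistBase {Q : Subgroup A} [Finite A] (hQ : IsPGroup 3 Q)
    (hsurj : ∀ c, ∃ q ∈ Q, π q = c) (hN : ∀ x, π x = 1 → x ∈ normalizer (Q : Set A) → x ∈ Q) :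
    ∃ P : Subgroup (twist π), IsPGroup 3 P ∧
      IsCarterIn ((twistBase π).subgroupOf (twist π)) P := by
  let P : Subgroup (twist π) := ((Q.prod Q).map prHom).subgroupOf (twist π)
  have hP : ∀ x y (h : pr x y ∈ twist π), (⟨pr x y, h⟩ : twist π) ∈ P ↔ x ∈ Q ∧ y ∈ Q := by
    intro x y h
    constructor
    · rintro ⟨⟨u, v⟩, ⟨hu, hv⟩, he⟩
      obtain ⟨rfl, rfl⟩ := pr_inj.1 he
      exact ⟨hu, hv⟩
    · rintro ⟨hx, hy⟩
      exact ⟨(x, y), ⟨hx, hy⟩, rfl⟩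
  have hPform : ∀ p ∈ P, ∃ x y, ∃ h : pr x y ∈ twist π, p = ⟨pr x y, h⟩ := by
    rintro ⟨p, hp'⟩ ⟨⟨u, v⟩, -, rfl⟩
    exact ⟨u, v, hp', rfl⟩
  have hP3 : IsPGroup 3 P := by
    rintro ⟨p, hp⟩
    obtain ⟨x, y, h, rfl⟩ := hPform p hp
    obtain ⟨hx, hy⟩ := (hP x y h).1 hp
    obtain ⟨m, hm⟩ := hQ ⟨x, hx⟩
    obtain ⟨n, hn⟩ := hQ ⟨y, hy⟩
    have hm' : x ^ 3 ^ m = 1 := congrArg Subtype.val hm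
    have hn' : y ^ 3 ^ n = 1 := congrArg Subtype.val hn
    refine ⟨m + n, Subtype.ext (Subtype.ext ?_)⟩
    change pr x y ^ 3 ^ (m + n) = 1
    rw [pr_pow, pow_add, pow_mul, hm', one_pow, mul_comm, pow_mul, hn', one_pow, pr_one]
  have : Fact (Nat.Prime 3) := ⟨Nat.prime_three⟩
  refine ⟨P, hP3, ⟨?_, hP3.isNilpotent, ?_⟩⟩
  · intro p hp
    obtain ⟨x, y, h, rfl⟩ := hPform p hp
    exact mem_twistBase.2 ⟨x, y, h, rfl⟩
  · rintro ⟨g, hgt⟩ hg hgN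
    obtain ⟨x, y, hxy, rfl⟩ := mem_twistBase.1 (show g ∈ twistBase π from hg)
    obtain ⟨q, hq, hqx⟩ := hsurj (π x)
    obtain ⟨r, hr, hry⟩ := hsurj (π y)
    have hqr : pr q r ∈ twist π := by rwa [pr_mem_twist, hqx, hry]
    have hqrP := (hP q r hqr).2 ⟨hq, hr⟩
    have h1 := mul_mem hgN (inv_mem (le_normalizer hqrP))
    have h2 : pr (x * q⁻¹) (y * r⁻¹) ∈ twist π := by
      rw [pr_mem_twist, map_mul, map_mul, map_inv, map_inv, hqx, hry]
      simp
    have h3 : (⟨pr x y, hgt⟩ * (⟨pr q r, hqr⟩)⁻¹ : twist π) = ⟨pr (x * q⁻¹) (y * r⁻¹), h2⟩ := by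
      apply Subtype.ext
      change pr x y * (pr q r)⁻¹ = _
      rw [pr_inv, pr_mul]
    rw [h3] at h1
    have h4 : ∀ u v (h : pr u v ∈ twist π), u ∈ Q → v ∈ Q →
        x * q⁻¹ * u * (x * q⁻¹)⁻¹ ∈ Q ∧ y * r⁻¹ * v * (y * r⁻¹)⁻¹ ∈ Q := by
      intro u v h hu hv
      have h5 := (mem_normalizer_iff.1 h1 ⟨pr u v, h⟩).1 ((hP u v h).2 ⟨hu, hv⟩)
      have h6 : (⟨pr (x * q⁻¹) (y * r⁻¹), h2⟩ * ⟨pr u v, h⟩ *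
          (⟨pr (x * q⁻¹) (y * r⁻¹), h2⟩)⁻¹ : twist π) =
          ⟨pr (x * q⁻¹ * u * (x * q⁻¹)⁻¹) (y * r⁻¹ * v * (y * r⁻¹)⁻¹), by
            rw [pr_mem_twist] at h ⊢
            simp only [map_mul, map_inv, hqx, hry]
            simpa using h⟩ := by
        apply Subtype.ext
        exact pr_conj_pr _ _ _ _
      rw [h6] at h5
      exact (hP _ _ _).1 h5
    have hx' : x * q⁻¹ ∈ Q := by
      refine hN _ (by rw [map_mul, map_inv, hqx, mul_inv_cancel])
        (mem_normalizer_of_forall_conj_mem fun u hu => ?_)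
      obtain ⟨v, hv, hvu⟩ := hsurj (π u)⁻¹
      exact (h4 u v (by rw [pr_mem_twist, hvu, mul_inv_cancel]) hu hv).1
    have hy' : y * r⁻¹ ∈ Q := by
      refine hN _ (by rw [map_mul, map_inv, hry, mul_inv_cancel])
        (mem_normalizer_of_forall_conj_mem fun v hv => ?_)
      obtain ⟨u, hu, huv⟩ := hsurj (π v)⁻¹
      exact (h4 u v (by rw [pr_mem_twist, huv, inv_mul_cancel]) hu hv).2
    rw [hP]
    constructor
    · simpa using mul_mem hx' hq
    · simpa using mul_mem hy' hr

/-- The other direct factor centralizes `U`. This lets the classification continue below ker π × 1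
and 1 × ker π, although the terms of a composition series are only subnormal. -/
theorem kerBase_le_normalizer {U B : Subgroup (twist π)}
    (hU : U = (kerFst π).subgroupOf (twist π) ∨ U = (kerSnd π).subgroupOf (twist π))
    (hBU : B ≤ U) (hn : U ≤ normalizer (B : Set (twist π))) :
    (kerBase π).subgroupOf (twist π) ≤ normalizer (B : Set (twist π)) := by
  rw [le_normalizer_iff]
  rintro ⟨g, hgt⟩ hg b hb
  obtain ⟨x, y, hx, hy, rfl⟩ := mem_kerBase.1 (show g ∈ kerBase π from hg)
  have key : ∀ u, u ∈ kerBase π → (∀ hut : u ∈ twist π, (⟨u, hut⟩ : twist π) ∈ U) →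
      pr x y * (b : Wr A) * (pr x y)⁻¹ = u * (b : Wr A) * u⁻¹ →
      (⟨pr x y, hgt⟩ : twist π) * b * ⟨pr x y, hgt⟩⁻¹ ∈ B := by
    intro u hu hut he
    have h1 := (mem_normalizer_iff.1 (hn (hut (kerBase_le_twist hu))) b).1 hb
    convert h1 using 1
    exact Subtype.ext he
  rcases hU with rfl | rfl
  · obtain ⟨s, hs, he⟩ := mem_kerFst.1 (show (b : Wr A) ∈ kerFst π from hBU hb)
    refine key (pr x 1) (pr_mem_kerBase.2 ⟨hx, map_one π⟩)
      (fun _ => show pr x 1 ∈ kerFst π from pr_mem_kerFst.2 ⟨hx, rfl⟩) ?_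
    rw [he, pr_conj_pr, pr_conj_pr]
    simp
  · obtain ⟨s, hs, he⟩ := mem_kerSnd.1 (show (b : Wr A) ∈ kerSnd π from hBU hb)
    refine key (pr 1 y) (pr_mem_kerBase.2 ⟨map_one π, hy⟩)
      (fun _ => show pr 1 y ∈ kerSnd π from pr_mem_kerSnd.2 ⟨rfl, hy⟩) ?_
    rw [he, pr_conj_pr, pr_conj_pr]
    simp

end Twist

/-! ### Coprime elements of nilpotent groups, and inner automorphisms -/

section General

variable {Γ : Type*} [Group Γ]

theorem commute_of_coprime {K : Subgroup Γ} [Finite K] [Group.IsNilpotent K] {p : ℕ}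
    [Fact p.Prime] {x y : Γ} (hx : x ∈ K) (hy : y ∈ K) (hxp : ∃ n, x ^ p ^ n = 1) {m : ℕ}
    (hym : y ^ m = 1) (hm : m.Coprime p) : Commute x y := by
  obtain ⟨P, B, hPK, hBK, hP, hB, hcomm, hdec, hmax⟩ := exists_isPGroup_mul_coprime K p
  have hBpow : ∀ b ∈ B, b ^ Nat.card B = 1 := by
    intro b hb
    have : Finite B := Finite.of_injective (inclusion hBK) (inclusion_injective hBK)
    exact congrArg Subtype.val (pow_card_eq_one' (x := (⟨b, hb⟩ : B)))
  obtain ⟨a, ha, b, hb, rfl⟩ := hdec y hy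
  obtain ⟨n, hn⟩ := hP ⟨a, ha⟩
  have hn' : a ^ p ^ n = 1 := congrArg Subtype.val hn
  have h1 : a ^ (Nat.card B * m) = 1 := by
    have h2 : (a * b) ^ (Nat.card B * m) = 1 := by rw [mul_comm, pow_mul, hym, one_pow]
    rwa [(hcomm a ha b hb).mul_pow, pow_mul b, hBpow b hb, one_pow, mul_one] at h2
  rw [eq_one_of_pow_eq_one_of_coprime h1 hn' (Nat.Coprime.pow_right _ (hB.mul_left hm)), one_mul]
  exact hcomm x (hmax x hx hxp) b hb

/-- If the elements of `N_K(T)` act on the centreless group `T` as inner automorphisms, then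
`Aut_K(T)` is isomorphic to `T`. -/
theorem nonempty_mulEquiv_autSection {K T : Subgroup Γ} (hTK : T ≤ K)
    (hK : ∀ k ∈ K, k ∈ normalizer (T : Set Γ) → ∃ t ∈ T, ∀ x ∈ T, k * x * k⁻¹ = t * x * t⁻¹)
    (hT : ∀ t ∈ T, (∀ x ∈ T, t * x * t⁻¹ = x) → t = 1) : Nonempty (T ≃* autSection K T ⊥) := by
  have hbot : ∀ g : Γ, g ∈ normalizer ((⊥ : Subgroup Γ) : Set Γ) := fun g => by
    rw [normalizer_eq_top]
    exact mem_top g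
  have hTn : T ≤ sectionNormalizer T ⊥ := fun t ht => mem_inf.2 ⟨le_normalizer ht, hbot t⟩
  have hval : ∀ (x : sectionNormalizer T ⊥) (a : T),
      sectionConj T ⊥ x (QuotientGroup.mk a) = QuotientGroup.mk (conjOn T ⊥ x a) :=
    fun x a => rfl
  have hmk : ∀ a b : T, (QuotientGroup.mk a : T ⧸ (⊥ : Subgroup Γ).subgroupOf T) =
      QuotientGroup.mk b ↔ a = b := by
    intro a b
    rw [QuotientGroup.eq, mem_subgroupOf, mem_bot, OneMemClass.coe_eq_one, inv_mul_eq_one]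
  let f : T →* autSection K T ⊥ :=
    ((sectionConj T ⊥).comp (inclusion hTn)).codRestrict (autSection K T ⊥)
      fun t => ⟨inclusion hTn t, hTK t.2, rfl⟩
  refine ⟨MulEquiv.ofBijective f ⟨?_, ?_⟩⟩
  · rw [injective_iff_map_eq_one]
    intro t ht
    have h1 : sectionConj T ⊥ (inclusion hTn t) = 1 := congrArg Subtype.val ht
    refine Subtype.ext (hT t t.2 fun x hx => ?_)
    have h2 := DFunLike.congr_fun h1 (QuotientGroup.mk ⟨x, hx⟩)
    rw [hval, MulAut.one_apply, hmk] at h2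
    exact congrArg Subtype.val h2
  · rintro ⟨_, k, hk, rfl⟩
    obtain ⟨t, ht, h⟩ := hK k hk (mem_inf.1 k.2).1
    refine ⟨⟨t, ht⟩, Subtype.ext (MulEquiv.ext fun q => ?_)⟩
    induction q using QuotientGroup.induction_on with | H a
    change sectionConj T ⊥ (inclusion hTn ⟨t, ht⟩) _ = sectionConj T ⊥ k _
    rw [hval, hval, hmk]
    exact Subtype.ext (h a a.2).symm

end General

/-! ### The condition on composition factors for `twist π` -/

section Twist

variable {A C : Type*} [Group A] [CommGroup C] {π : A →* C}

theorem normalizer_kerFst (hnt : ∃ s, π s = 1 ∧ s ≠ 1) :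
    normalizer ((kerFst π).subgroupOf (twist π) : Set (twist π)) =
      (twistBase π).subgroupOf (twist π) := by
  rw [← subgroupOf_normalizer_eq (kerFst_le_kerBase.trans kerBase_le_twist),
    ← twist_inf_normalizer_kerFst hnt, inf_subgroupOf_left]

theorem normalizer_kerSnd (hnt : ∃ s, π s = 1 ∧ s ≠ 1) :
    normalizer ((kerSnd π).subgroupOf (twist π) : Set (twist π)) =
      (twistBase π).subgroupOf (twist π) := by
  rw [← subgroupOf_normalizer_eq (kerSnd_le_kerBase.trans kerBase_le_twist),
    ← twist_inf_normalizer_kerSnd hnt, inf_subgroupOf_left]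

theorem kerFst_subgroupOf_ne_top (hnt : ∃ s, π s = 1 ∧ s ≠ 1) :
    ¬ (kerBase π).subgroupOf (twist π) ≤ (kerFst π).subgroupOf (twist π) := by
  intro h
  obtain ⟨s, hs, hs1⟩ := hnt
  have h1 : pr 1 s ∈ kerBase π := pr_mem_kerBase.2 ⟨map_one π, hs⟩
  have h2 : (⟨pr 1 s, kerBase_le_twist h1⟩ : twist π) ∈ (kerBase π).subgroupOf (twist π) := h1
  exact hs1 (pr_mem_kerFst.1 (show pr 1 s ∈ kerFst π from h h2)).2

theorem kerFst_not_le_kerSnd (hnt : ∃ s, π s = 1 ∧ s ≠ 1) :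
    ¬ (kerFst π).subgroupOf (twist π) ≤ (kerSnd π).subgroupOf (twist π) := by
  intro h
  obtain ⟨s, hs, hs1⟩ := hnt
  have h1 : pr s 1 ∈ kerFst π := pr_mem_kerFst.2 ⟨hs, rfl⟩
  have h2 : (⟨pr s 1, kerBase_le_twist (kerFst_le_kerBase h1)⟩ : twist π) ∈
    (kerFst π).subgroupOf (twist π) := h1
  exact hs1 (pr_mem_kerSnd.1 (show pr s 1 ∈ kerSnd π from h h2)).1

theorem kerSnd_not_le_kerFst (hnt : ∃ s, π s = 1 ∧ s ≠ 1) :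
    ¬ (kerSnd π).subgroupOf (twist π) ≤ (kerFst π).subgroupOf (twist π) := by
  intro h
  obtain ⟨s, hs, hs1⟩ := hnt
  have h1 : pr 1 s ∈ kerSnd π := pr_mem_kerSnd.2 ⟨rfl, hs⟩
  have h2 : (⟨pr 1 s, kerBase_le_twist (kerSnd_le_kerBase h1)⟩ : twist π) ∈
    (kerSnd π).subgroupOf (twist π) := h1
  exact hs1 (pr_mem_kerFst.1 (show pr 1 s ∈ kerFst π from h h2)).2

/-- Every term contains ker π × ker π or is 1, ker π × 1 or 1 × ker π. Factors above ker π × ker π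
are abelian. Below it, the section normalizer is always `twistBase π`, because the swap exchanges
the two direct factors. -/
theorem compositionFactorCondition_twist [Finite A]
    (hZ : ∀ x : A, (∀ s, π s = 1 → Commute s x) → x = 1)
    [IsSimpleGroup π.ker] {P : Subgroup (twist π)} (hP3 : IsPGroup 3 P)
    (hP : IsCarterIn ((twistBase π).subgroupOf (twist π)) P) :
    CompositionFactorCondition (twist π) := by
  have : Fact (Nat.Prime 3) := ⟨Nat.prime_three⟩
  have hnt : ∃ s, π s = 1 ∧ s ≠ 1 := by
    obtain ⟨⟨s, hs⟩, hs1⟩ := exists_ne (1 : π.ker)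
    exact ⟨s, hs, fun h => hs1 (Subtype.ext h)⟩
  have hHn := normal_kerBase (π := π)
  have hbot : normalizer ((⊥ : Subgroup (twist π)) : Set (twist π)) = ⊤ := normalizer_eq_top _
  intro s hs i
  set H' := (kerBase π).subgroupOf (twist π) with hH'
  set F₁ := (kerFst π).subgroupOf (twist π) with hF₁
  set F₂ := (kerSnd π).subgroupOf (twist π) with hF₂
  have hF₁H : F₁ ≤ H' := fun g hg => kerFst_le_kerBase (show (g : Wr A) ∈ kerFst π from hg)
  have hF₂H : F₂ ≤ H' := fun g hg => kerSnd_le_kerBase (show (g : Wr A) ∈ kerSnd π from hg)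
  have hstep : ∀ i : Fin s.length, (H' ≤ s.term i.castSucc ∨ s.term i.castSucc = ⊥ ∨
      s.term i.castSucc = F₁ ∨ s.term i.castSucc = F₂) → H' ≤ s.term i.succ ∨ s.term i.succ = ⊥ ∨
      s.term i.succ = F₁ ∨ s.term i.succ = F₂ := by
    intro i hi
    have hn := le_normalizer_of_normal_subgroupOf (hK := s.normal i) (s.le i)
    rcases hi with h | h | h
    · exact kerBase_subgroupOf_le_or_eq hZ (h.trans hn)
    · right; left
      exact le_bot_iff.1 (h ▸ s.le i)
    · exact kerBase_subgroupOf_le_or_eq hZ (kerBase_le_normalizer h (s.le i) hn)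
  have hterm : ∀ i, H' ≤ s.term i ∨ s.term i = ⊥ ∨ s.term i = F₁ ∨ s.term i = F₂ := by
    intro i
    induction i using Fin.induction with
    | zero => exact Or.inl (s.term_zero ▸ le_top)
    | succ i ih => exact hstep i ih
  have hsimple := hs i
  have hle := s.le i
  have hU := hterm i.castSucc
  have hB := hterm i.succ
  have hlt : ¬ s.term i.castSucc ≤ s.term i.succ := by
    intro h
    have h1 : (s.term i.succ).subgroupOf (s.term i.castSucc) = ⊤ := subgroupOf_eq_top.2 h
    have h2 := QuotientGroup.subsingleton_iff.2 h1
    exact not_subsingleton _ h2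
  by_cases hHB : H' ≤ s.term i.succ
  · exact hasCarter_of_mul_comm (quotient_mul_comm hle hHB) _
  · suffices hsec : sectionNormalizer (s.term i.castSucc) (s.term i.succ) =
        (twistBase π).subgroupOf (twist π) from
      hasCarter_autSection hP3 (by rw [hsec]; exact hP)
    have hB' := hB.resolve_left hHB
    rw [sectionNormalizer]
    rcases hU with hU | hU | hU | hU
    · have hBH : s.term i.succ ≤ H' := by
        rcases hB' with h | h | h
        · exact h ▸ bot_le
        · exact h ▸ hF₁H
        · exact h ▸ hF₂H
      have hUH : s.term i.castSucc = H' := by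
        have h1 := (le_or_eq_sup_of_isSimpleGroup hle hU
          (le_normalizer_of_normal (H := H'))).resolve_left hHB
        rwa [sup_eq_left.2 hBH] at h1
      have htop : normalizer (H' : Set (twist π)) = ⊤ := normalizer_eq_top _
      rw [hUH, htop, top_inf_eq]
      rcases hB' with h | h | h
      -- A bottom factor equal to ker π × ker π is not simple: it has the normal subgroup ker π × 1.
      · exfalso
        have hF₁n : s.term i.castSucc ≤ normalizer (F₁ : Set (twist π)) := by
          rw [hUH, normalizer_kerFst hnt]
          exact fun g hg => kerBase_le_twistBase (show (g : Wr A) ∈ kerBase π from hg)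
        rcases le_or_eq_sup_of_isSimpleGroup hle (hF₁H.trans hU) hF₁n with h1 | h1
        · rw [h] at h1
          exact kerFst_not_le_kerSnd hnt (h1.trans bot_le)
        · rw [h, sup_bot_eq, hUH] at h1
          exact kerFst_subgroupOf_ne_top hnt h1.le
      · rw [h, normalizer_kerFst hnt]
      · rw [h, normalizer_kerSnd hnt]
    · exact absurd (hU.trans_le bot_le) hlt
    · rcases hB' with h | h | h
      · rw [hU, h, hbot, inf_top_eq, normalizer_kerFst hnt]
      · exact absurd (hU.trans h.symm).le hlt
      · rw [hU, h] at hle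
        exact absurd hle (kerSnd_not_le_kerFst hnt)
    · rcases hB' with h | h | h
      · rw [hU, h, hbot, inf_top_eq, normalizer_kerSnd hnt]
      · rw [hU, h] at hle
        exact absurd hle (kerFst_not_le_kerSnd hnt)
      · exact absurd (hU.trans h.symm).le hlt

end Twist

/-! ### Carter subgroups of `twist π` modulo ker π × ker π -/

section Twist

variable {A C : Type*} [Group A] [CommGroup C] {π : A →* C}

theorem eq_one_of_mul_eq_one (hC3 : ∀ a : C, a ^ 3 = 1) {a b : C} (h : a * b = 1) (h' : a = b) :
    a = 1 := by
  rw [← h', ← pow_two] at h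
  exact eq_one_of_pow_eq_one_of_coprime h (hC3 a) (by norm_num)

/-- The quotient is the image of `π` extended by an involution inverting it. As that image has
exponent 3, the involution fixes only 1 in it, so the involution generates its own normalizer. -/
theorem isCarter_zpowers_sw [Finite A] (hC3 : ∀ a : C, a ^ 3 = 1) {U : Subgroup (twist π)}
    [U.Normal] (hU : U = (kerBase π).subgroupOf (twist π)) :
    HasCarter (twist π ⧸ U) := by
  have : Fact (Nat.Prime 2) := ⟨Nat.prime_two⟩
  let σ : twist π := ⟨sw, sw_mem_twist⟩
  have hσσ : σ * σ = 1 := Subtype.ext sw_mul_sw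
  have hU' : ∀ g : twist π, g ∈ U ↔ (g : Wr A) ∈ kerBase π := fun g => by
    rw [hU, mem_subgroupOf]
  let s : twist π ⧸ U := QuotientGroup.mk σ
  have hs : s ^ 2 = 1 := by
    rw [pow_two]
    exact congrArg (QuotientGroup.mk (s := U)) hσσ
  have hs' : s ^ (2 : ℤ) = 1 := by exact_mod_cast hs
  have hmem : ∀ g ∈ zpowers s, g = 1 ∨ g = s := by
    rintro _ ⟨n, rfl⟩
    rcases Int.even_or_odd' n with ⟨m, rfl | rfl⟩
    · left
      change s ^ (2 * m) = 1
      rw [zpow_mul, hs', one_zpow]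
    · right
      change s ^ (2 * m + 1) = s
      rw [zpow_add, zpow_mul, zpow_one, hs', one_zpow, one_mul]
  have hp : IsPGroup 2 (zpowers s) := by
    rintro ⟨g, hg⟩
    refine ⟨1, Subtype.ext ?_⟩
    change g ^ 2 ^ 1 = 1
    rcases hmem g hg with rfl | rfl
    · exact one_pow _
    · exact hs
  refine ⟨zpowers s, hp.isNilpotent, le_antisymm ?_ le_normalizer⟩
  have hpr : ∀ x y (h : pr x y ∈ twist π),
      (QuotientGroup.mk (⟨pr x y, h⟩ : twist π) : twist π ⧸ U) ∈
        normalizer (zpowers s : Set (twist π ⧸ U)) →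
      (QuotientGroup.mk (⟨pr x y, h⟩ : twist π) : twist π ⧸ U) = 1 := by
    intro x y h hN
    have h1 := (mem_normalizer_iff.1 hN s).1 (mem_zpowers s)
    rcases hmem _ h1 with h2 | h2
    · rw [conj_eq_one_iff] at h2
      rw [h2, mul_one, mul_inv_cancel] at h1
      have h3 := (hU' _).1 ((QuotientGroup.eq_one_iff σ).1 h2)
      obtain ⟨u, v, -, -, he⟩ := mem_kerBase.1 h3
      have : pr (1 : A) 1 * sw = pr u v := by rw [pr_one, one_mul]; exact he
      exact absurd this.symm (pr_ne_pr_mul_sw _ _ _ _)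
    · rw [mul_inv_eq_iff_eq_mul] at h2
      have h3 : (⟨pr x y, h⟩ * σ : twist π)⁻¹ * (σ * ⟨pr x y, h⟩) ∈ U := QuotientGroup.eq.1 h2
      rw [hU'] at h3
      change (pr x y * sw)⁻¹ * (sw * pr x y) ∈ _ at h3
      rw [sw_mul_pr, mul_inv_rev, sw_inv, pr_inv, mul_assoc, ← mul_assoc (pr _ _), pr_mul,
        ← mul_assoc, sw_mul_pr, mul_assoc, sw_mul_sw, mul_one, pr_mem_kerBase, map_mul, map_inv,
        mul_comm, mul_inv_eq_one] at h3
      have h4 : π x = 1 := eq_one_of_mul_eq_one hC3 (pr_mem_twist.1 h) h3.1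
      rw [QuotientGroup.eq_one_iff, hU', pr_mem_kerBase]
      exact ⟨h4, h3.1 ▸ h4⟩
  intro g hg
  induction g using QuotientGroup.induction_on with | H g
  obtain ⟨g, hgt⟩ := g
  obtain ⟨x, y, rfl | rfl⟩ := eq_pr_or g
  · rw [hpr x y hgt hg]
    exact one_mem _
  · have hxy : pr x y ∈ twist π := pr_mul_sw_mem_twist.1 hgt
    have h1 : (QuotientGroup.mk (⟨pr x y * sw, hgt⟩ : twist π) : twist π ⧸ U) =
        QuotientGroup.mk (⟨pr x y, hxy⟩ : twist π) * s := rfl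
    rw [h1] at hg ⊢
    have h2 := mul_mem hg (inv_mem (le_normalizer (mem_zpowers s)))
    rw [mul_inv_cancel_right] at h2
    rw [hpr x y hxy h2, one_mul]
    exact mem_zpowers s

/-- Needed for an arbitrary Carter subgroup of the quotient, since (E) allows any choice. A
non-trivial element of `K` in the image of `twistBase π` has order 3 and commutes with no swapping
element. So `K` would be exactly that image, which the swap normalizes. -/
theorem mem_of_mk_mem_carter [Finite A] (hC3 : ∀ a : C, a ^ 3 = 1)
    (hCz : ∀ a b : C, a ≠ 1 → b ∈ zpowers a) {U : Subgroup (twist π)}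
    [U.Normal] (hU : U = (kerBase π).subgroupOf (twist π)) {K : Subgroup (twist π ⧸ U)}
    (hK : IsCarter K) {k : twist π} (hk : QuotientGroup.mk k ∈ K)
    (hkb : (k : Wr A) ∈ twistBase π) : (k : Wr A) ∈ kerBase π := by
  have : Fact (Nat.Prime 3) := ⟨Nat.prime_three⟩
  have := hK.1
  have hU' : ∀ g : twist π, g ∈ U ↔ (g : Wr A) ∈ kerBase π := fun g => by
    rw [hU, mem_subgroupOf]
  obtain ⟨k, hkt⟩ := k
  obtain ⟨x, y, hxy, rfl⟩ := mem_twistBase.1 hkb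
  by_contra hne
  have hx : π x ≠ 1 := fun h => by
    rw [h, one_mul] at hxy
    exact hne (pr_mem_kerBase.2 ⟨h, hxy⟩)
  by_cases hsw : ∃ u v, ∃ h : pr u v * sw ∈ twist π,
      (QuotientGroup.mk (⟨pr u v * sw, h⟩ : twist π) : twist π ⧸ U) ∈ K
  · obtain ⟨u, v, h, huv⟩ := hsw
    have h1 : Commute (QuotientGroup.mk (⟨pr x y, hkt⟩ : twist π) : twist π ⧸ U)
        (QuotientGroup.mk (⟨pr u v * sw, h⟩ : twist π)) := by
      refine commute_of_coprime (p := 3) (m := 2) hk huv ⟨1, ?_⟩ ?_ (by norm_num)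
      · rw [← QuotientGroup.mk_pow, QuotientGroup.eq_one_iff, hU']
        change pr x y ^ 3 ^ 1 ∈ _
        rw [pr_pow, pr_mem_kerBase, map_pow, map_pow, pow_one, hC3, hC3]
        exact ⟨rfl, rfl⟩
      · rw [← QuotientGroup.mk_pow, QuotientGroup.eq_one_iff, hU']
        change (pr u v * sw) ^ 2 ∈ _
        rw [pow_two, ← mul_assoc, pr_mul_sw_mul, mul_assoc, sw_mul_sw, mul_one, pr_mem_kerBase,
          map_mul, map_mul, mul_comm (π v)]
        exact ⟨pr_mul_sw_mem_twist.1 h, pr_mul_sw_mem_twist.1 h⟩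
    have h2 : (⟨pr x y, hkt⟩ * ⟨pr u v * sw, h⟩ : twist π)⁻¹ * (⟨pr u v * sw, h⟩ * ⟨pr x y, hkt⟩) ∈
      U := QuotientGroup.eq.1 h1
    rw [hU'] at h2
    change (pr x y * (pr u v * sw))⁻¹ * (pr u v * sw * pr x y) ∈ _ at h2
    have h3 : pr x y * (pr u v * sw) = pr (x * u) (y * v) * sw := by rw [← mul_assoc, pr_mul]
    rw [h3, pr_mul_sw_mul, mul_inv_rev, sw_inv, pr_inv, mul_assoc,
      ← mul_assoc (pr _ _), pr_mul, ← mul_assoc, sw_mul_pr, mul_assoc, sw_mul_sw, mul_one,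
      pr_mem_kerBase] at h2
    have h4 := h2.1
    rw [map_mul, map_inv, map_mul, map_mul, mul_comm (π v), inv_mul_eq_one, mul_left_inj] at h4
    exact hx (eq_one_of_mul_eq_one hC3 hxy h4.symm)
  · push Not at hsw
    have hin : ∀ g : twist π, (g : Wr A) ∈ twistBase π → QuotientGroup.mk g ∈ K := by
      rintro ⟨g, hgt⟩ hg
      obtain ⟨p, q, hpq, rfl⟩ := mem_twistBase.1 hg
      obtain ⟨i, hi⟩ := mem_zpowers_iff.1 (hCz (π x) (π p) hx)
      have h1 : (QuotientGroup.mk (⟨pr p q, hgt⟩ : twist π) : twist π ⧸ U) =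
          QuotientGroup.mk ((⟨pr x y, hkt⟩ : twist π) ^ i) := by
        rw [QuotientGroup.eq, hU']
        change (pr p q)⁻¹ * pr x y ^ i ∈ _
        have h2 : pr x y ^ i = pr (x ^ i) (y ^ i) := (map_zpow prHom (x, y) i).symm
        rw [h2, pr_inv, pr_mul, pr_mem_kerBase, map_mul, map_mul, map_inv, map_inv, map_zpow,
          map_zpow, hi, inv_mul_cancel, eq_inv_of_mul_eq_one_right hxy,
          eq_inv_of_mul_eq_one_right hpq, inv_inv, inv_zpow, hi, mul_inv_cancel]
        exact ⟨rfl, rfl⟩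
      rw [h1, QuotientGroup.mk_zpow]
      exact zpow_mem hk i
    have hnb := normal_twistBase (π := π)
    have h1 : (QuotientGroup.mk (⟨sw, sw_mem_twist⟩ : twist π) : twist π ⧸ U) ∈ K := by
      rw [← hK.2]
      refine mem_normalizer_of_forall_conj_mem fun g hg => ?_
      induction g using QuotientGroup.induction_on with | H g
      refine hin _ (hnb.conj_mem g ?_ ⟨sw, sw_mem_twist⟩)
      obtain ⟨g, hgt⟩ := g
      obtain ⟨p, q, rfl | rfl⟩ := eq_pr_or g
      · exact mem_twistBase.2 ⟨p, q, hgt, rfl⟩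
      · exact absurd hg (hsw p q hgt)
    have h2 : pr (1 : A) 1 * sw ∈ twist π := by
      rw [pr_one, one_mul]
      exact sw_mem_twist
    refine hsw 1 1 h2 ?_
    convert h1 using 3
    rw [pr_one, one_mul]

end Twist

theorem IsSimpleDecomposition.le_normalizer {Q : Type*} [Group Q] {N : Subgroup Q} {k : ℕ}
    {T : Fin k → Subgroup Q} (h : IsSimpleDecomposition N T) (j : Fin k) :
    N ≤ normalizer (T j : Set Q) := by
  rw [← h.iSup_eq]
  refine iSup_le fun l => ?_
  rcases eq_or_ne l j with rfl | hl
  · exact Subgroup.le_normalizer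
  · rw [le_normalizer_iff]
    intro x hx y hy
    rwa [(h.commute l j hl x hx y hy).eq, mul_inv_cancel_right]

/-! ### Failure of condition (E) for `twist π` -/

section Twist

variable {A C : Type*} [Group A] [CommGroup C] {π : A →* C}

theorem not_isSimpleGroup_kerBase (hnt : ∃ s, π s = 1 ∧ s ≠ 1) :
    ¬ IsSimpleGroup ((kerBase π).subgroupOf (twist π)) := by
  rw [Subgroup.isSimpleGroup_iff]
  rintro ⟨-, h⟩
  have hle : (kerFst π).subgroupOf (twist π) ≤ (kerBase π).subgroupOf (twist π) :=
    fun g hg => kerFst_le_kerBase (show (g : Wr A) ∈ kerFst π from hg)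
  have hn : (((kerFst π).subgroupOf (twist π)).subgroupOf
      ((kerBase π).subgroupOf (twist π))).Normal := by
    rw [normal_subgroupOf_iff_le_normalizer hle, normalizer_kerFst hnt]
    exact fun g hg => kerBase_le_twistBase (show (g : Wr A) ∈ kerBase π from hg)
  rcases h _ hle hn with h | h
  · exact kerFst_not_le_kerSnd hnt (h ▸ bot_le)
  · exact kerFst_subgroupOf_ne_top hnt h.ge

variable (π) in
theorem exists_mulEquiv_kerFst : Nonempty (π.ker ≃* (kerFst π).subgroupOf (twist π)) := by
  let f : π.ker →* twist π := (prHom.comp ((MonoidHom.inl A A).comp π.ker.subtype)).codRestrict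
    (twist π) (fun x => kerBase_le_twist (kerFst_le_kerBase (pr_mem_kerFst.2 ⟨x.2, rfl⟩)))
  have hf : Function.Injective f := fun x y h =>
    Subtype.ext (pr_inj.1 (congrArg Subtype.val h)).1
  have hr : f.range = (kerFst π).subgroupOf (twist π) := by
    ext g
    rw [mem_subgroupOf, mem_kerFst]
    constructor
    · rintro ⟨x, rfl⟩
      exact ⟨x, x.2, rfl⟩
    · rintro ⟨x, hx, he⟩
      exact ⟨⟨x, hx⟩, Subtype.ext he.symm⟩
  exact ⟨hr ▸ MonoidHom.ofInjective hf⟩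

variable (π) in
theorem exists_mulEquiv_kerSnd : Nonempty (π.ker ≃* (kerSnd π).subgroupOf (twist π)) := by
  let f : π.ker →* twist π := (prHom.comp ((MonoidHom.inr A A).comp π.ker.subtype)).codRestrict
    (twist π) (fun x => kerBase_le_twist (kerSnd_le_kerBase (pr_mem_kerSnd.2 ⟨rfl, x.2⟩)))
  have hf : Function.Injective f := fun x y h =>
    Subtype.ext (pr_inj.1 (congrArg Subtype.val h)).2
  have hr : f.range = (kerSnd π).subgroupOf (twist π) := by
    ext g
    rw [mem_subgroupOf, mem_kerSnd]
    constructor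
    · rintro ⟨x, rfl⟩
      exact ⟨x, x.2, rfl⟩
    · rintro ⟨x, hx, he⟩
      exact ⟨⟨x, hx⟩, Subtype.ext he.symm⟩
  exact ⟨hr ▸ MonoidHom.ofInjective hf⟩

/-- The last chief factor is ker π × ker π, and each `T` in it is one of the two direct factors. In
the preimage of a Carter subgroup of the quotient, the normalizer of `T` is only ker π × ker π,
which induces inner automorphisms; so the induced group is a copy of `ker π`. -/
theorem not_holds_twist [Finite A] (hC3 : ∀ a : C, a ^ 3 = 1)
    (hCz : ∀ a b : C, a ≠ 1 → b ∈ zpowers a)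
    (hZ : ∀ x : A, (∀ s, π s = 1 → Commute s x) → x = 1) [IsSimpleGroup π.ker]
    (hS : ¬ HasCarter π.ker) (D : ConditionEData (twist π)) : ¬ D.Holds := by
  intro hD
  have hnt : ∃ s, π s = 1 ∧ s ≠ 1 := by
    obtain ⟨⟨s, hs⟩, hs1⟩ := exists_ne (1 : π.ker)
    exact ⟨s, hs, fun h => hs1 (Subtype.ext h)⟩
  have hHn := normal_kerBase (π := π)
  set H' := (kerBase π).subgroupOf (twist π) with hH'
  set F₁ := (kerFst π).subgroupOf (twist π) with hF₁
  set F₂ := (kerSnd π).subgroupOf (twist π) with hF₂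
  have hF₁H : F₁ ≤ H' := fun g hg => kerFst_le_kerBase (show (g : Wr A) ∈ kerFst π from hg)
  have hF₂H : F₂ ≤ H' := fun g hg => kerSnd_le_kerBase (show (g : Wr A) ∈ kerSnd π from hg)
  have hH1 : H' ≠ ⊥ := fun h => kerFst_subgroupOf_ne_top hnt (h.trans_le bot_le)
  have hsw : ∀ h : sw ∈ twist π, (⟨sw, h⟩ : twist π) ∉ (twistBase π).subgroupOf (twist π) := by
    intro h h'
    obtain ⟨x, y, -, he⟩ := mem_twistBase.1 (show sw ∈ twistBase π from h')
    exact pr_ne_pr_mul_sw x y 1 1 (by rw [← he, pr_one, one_mul])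
  -- the last factor of the chief series
  obtain ⟨i, hi⟩ : ∃ i : Fin D.series.length, i.succ = Fin.last _ := by
    have h0 : D.series.length ≠ 0 := by
      intro h0
      have h1 : (0 : Fin (D.series.length + 1)) = Fin.last _ := Fin.ext (by simp [h0])
      have h2 := D.series.term_zero
      rw [h1, D.series.term_last] at h2
      exact hH1 (le_bot_iff.1 (h2 ▸ le_top))
    exact ⟨⟨D.series.length - 1, by omega⟩, Fin.ext (by simp; omega)⟩
  have hbot : D.series.term i.succ = ⊥ := by rw [hi, D.series.term_last]
  have hUn := D.series.normal i.castSucc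
  -- A non-trivial normal subgroup contains `H'`: the other candidates `F₁` and `F₂` are not
  -- normalized by the swap. Minimality of the chief factor then gives equality.
  have hU : D.series.term i.castSucc = H' := by
    have hne : D.series.term i.castSucc ≠ ⊥ := by
      have := D.series.lt i
      rw [hbot] at this
      exact this.ne'
    have hle : H' ≤ D.series.term i.castSucc := by
      rcases kerBase_subgroupOf_le_or_eq hZ (B := D.series.term i.castSucc)
        le_normalizer_of_normal with h | h | h | h
      · exact h
      · exact absurd h hne
      · have h1 : normalizer (D.series.term i.castSucc : Set (twist π)) = ⊤ := normalizer_eq_top _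
        rw [h, normalizer_kerFst hnt] at h1
        exact absurd (h1 ▸ mem_top _) (hsw sw_mem_twist)
      · have h1 : normalizer (D.series.term i.castSucc : Set (twist π)) = ⊤ := normalizer_eq_top _
        rw [h, normalizer_kerSnd hnt] at h1
        exact absurd (h1 ▸ mem_top _) (hsw sw_mem_twist)
    rcases D.series.minimal i H' hHn (hbot ▸ bot_le) hle with h | h
    · exact absurd (h.trans hbot) hH1
    · exact h.symm
  have hdec := D.decomposition i
  set q := QuotientGroup.mk' (D.series.term i.succ) with hq
  have hqi : Function.Injective q := by
    rw [← MonoidHom.ker_eq_bot_iff, hq, QuotientGroup.ker_mk', hbot]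
  have hqs : Function.Surjective q := QuotientGroup.mk'_surjective _
  have hnum : 0 < D.numFactors i := by
    rcases Nat.eq_zero_or_pos (D.numFactors i) with h | h
    · have : IsEmpty (Fin (D.numFactors i)) := by rw [h]; infer_instance
      have h1 := hdec.iSup_eq
      rw [iSup_of_empty, hU] at h1
      exact absurd ((map_eq_bot_iff_of_injective _ hqi).1 h1.symm) hH1
    · exact h
  set j : Fin (D.numFactors i) := ⟨0, hnum⟩ with hj
  have hcar : HasCarter (twist π ⧸ D.series.term i.castSucc) := isCarter_zpowers_sw hC3 hU
  have hKi := D.isCarter i hcar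
  have haut := (hD i j).resolve_left (not_not.2 hcar)
  set T := D.factor i j with hT
  let T' : Subgroup (twist π) := T.comap q
  have hTT' : T'.map q = T := map_comap_eq_self_of_surjective hqs T
  let e : T' ≃* T := (T'.equivMapOfInjective q hqi).trans (MulEquiv.subgroupCongr hTT')
  have hTs : IsSimpleGroup T := hdec.simple j
  have hTs' : IsSimpleGroup T' := e.isSimpleGroup
  have hTH : T' ≤ H' := by
    have h1 : T ≤ (D.series.term i.castSucc).map q := by
      rw [← hdec.iSup_eq]
      exact le_iSup _ j
    rw [hU] at h1
    have h2 := comap_mono (f := q) h1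
    rwa [comap_map_eq_self_of_injective hqi] at h2
  have hnorm : ∀ g : twist π, q g ∈ normalizer (T : Set _) ↔ g ∈ normalizer (T' : Set (twist π)) := by
    intro g
    rw [mem_normalizer_iff, mem_normalizer_iff]
    constructor
    · intro h k
      have := h (q k)
      rwa [← map_inv, ← map_mul, ← map_mul] at this
    · intro h k
      obtain ⟨k, rfl⟩ := hqs k
      rw [← map_inv, ← map_mul, ← map_mul]
      exact h k
  have hTn : H' ≤ normalizer (T' : Set (twist π)) := by
    intro g hg
    rw [← hnorm]
    refine hdec.le_normalizer j ?_
    rw [hU]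
    exact mem_map_of_mem q hg
  have hpre : ∀ g : twist π, q g ∈ D.preimage i ↔ QuotientGroup.mk g ∈ D.carter i :=
    fun g => Iff.rfl
  have hHpre : ∀ g ∈ H', q g ∈ D.preimage i := by
    intro g hg
    rw [hpre, (QuotientGroup.eq_one_iff g).2 (hU ▸ hg)]
    exact one_mem _
  have hTpre : T ≤ D.preimage i := by
    intro t ht
    obtain ⟨t, rfl⟩ := hqs t
    exact hHpre t (hTH ht)
  have hcent : ∀ (F : Subgroup (twist π)), Nonempty (π.ker ≃* F) → T' = F →
      normalizer (F : Set (twist π)) = (twistBase π).subgroupOf (twist π) →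
      (∀ g ∈ H', ∃ f ∈ F, ∀ x ∈ F, g * x * g⁻¹ = f * x * f⁻¹) → False := by
    rintro F ⟨eF⟩ hTF hFn hinner
    have hker : ∀ t : T, (∀ x : T, t * x * t⁻¹ = x) → t = 1 := by
      let e' : π.ker ≃* T := eF.trans ((MulEquiv.subgroupCongr hTF.symm).trans e)
      intro t ht
      obtain ⟨t, rfl⟩ := e'.surjective t
      have h1 : (t : A) = 1 := by
        refine hZ t fun s hs => ?_
        have h2 := ht (e' ⟨s, hs⟩)
        rw [← map_mul, ← map_inv, ← map_mul, e'.injective.eq_iff, mul_inv_eq_iff_eq_mul] at h2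
        exact (congrArg Subtype.val h2).symm
      rw [show t = 1 from Subtype.ext h1, map_one]
    obtain ⟨E⟩ : Nonempty (T ≃* autSection (D.preimage i) T ⊥) := by
      refine nonempty_mulEquiv_autSection hTpre (fun k hk hkn => ?_)
        (fun t ht h => congrArg Subtype.val (hker ⟨t, ht⟩ fun x => Subtype.ext (h x x.2)))
      obtain ⟨g, rfl⟩ := hqs k
      rw [hnorm, hTF, hFn] at hkn
      -- An element normalizing `T` lies in `twistBase π`, and the Carter subgroup modulo `H'` meets
      -- the image of that group trivially.
      have hgH : g ∈ H' := mem_of_mk_mem_carter hC3 hCz hU hKi ((hpre g).1 hk) hkn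
      obtain ⟨f, hf, hfx⟩ := hinner g hgH
      have hfT : f ∈ T' := hTF ▸ hf
      refine ⟨q f, hfT, fun x hx => ?_⟩
      obtain ⟨x, rfl⟩ := hqs x
      have hxF : x ∈ F := hTF ▸ (show x ∈ T' from hx)
      have := congrArg q (hfx x hxF)
      simpa only [map_mul, map_inv] using this
    exact hS (haut.of_mulEquiv
      (eF.trans ((MulEquiv.subgroupCongr hTF.symm).trans (e.trans E))).symm)
  rcases kerBase_subgroupOf_le_or_eq hZ hTn with h | h | h | h
  · have := le_antisymm hTH h
    rw [this] at hTs'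
    exact not_isSimpleGroup_kerBase hnt hTs'
  · rw [Subgroup.isSimpleGroup_iff] at hTs'
    exact hTs'.1 h
  · refine hcent F₁ (exists_mulEquiv_kerFst π) h (normalizer_kerFst hnt) ?_
    rintro ⟨g, hgt⟩ hg
    obtain ⟨x, y, hx, hy, rfl⟩ := mem_kerBase.1 (show g ∈ kerBase π from hg)
    have h1 : pr x 1 ∈ kerFst π := pr_mem_kerFst.2 ⟨hx, rfl⟩
    refine ⟨⟨pr x 1, kerBase_le_twist (kerFst_le_kerBase h1)⟩, h1, ?_⟩
    rintro ⟨z, hzt⟩ hz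
    obtain ⟨z, -, rfl⟩ := mem_kerFst.1 (show z ∈ kerFst π from hz)
    apply Subtype.ext
    change pr x y * pr z 1 * (pr x y)⁻¹ = pr x 1 * pr z 1 * (pr x 1)⁻¹
    rw [pr_conj_pr, pr_conj_pr]
    simp
  · refine hcent F₂ (exists_mulEquiv_kerSnd π) h (normalizer_kerSnd hnt) ?_
    rintro ⟨g, hgt⟩ hg
    obtain ⟨x, y, hx, hy, rfl⟩ := mem_kerBase.1 (show g ∈ kerBase π from hg)
    have h1 : pr 1 y ∈ kerSnd π := pr_mem_kerSnd.2 ⟨rfl, hy⟩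
    refine ⟨⟨pr 1 y, kerBase_le_twist (kerSnd_le_kerBase h1)⟩, h1, ?_⟩
    rintro ⟨z, hzt⟩ hz
    obtain ⟨z, -, rfl⟩ := mem_kerSnd.1 (show z ∈ kerSnd π from hz)
    apply Subtype.ext
    change pr x y * pr 1 z * (pr x y)⁻¹ = pr 1 y * pr 1 z * (pr 1 y)⁻¹
    rw [pr_conj_pr, pr_conj_pr]
    simp

end Twist

/-! ### Traces, involutions and centralizers in SL₂ and PSL₂ -/

section SL2

variable {F : Type*} [Field F]

/-- The trace. -/
def tr (A : SL(2, F)) : F := A 0 0 + A 1 1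

theorem det_eq (A : SL(2, F)) : A 0 0 * A 1 1 - A 0 1 * A 1 0 = 1 := by
  rw [← Matrix.det_fin_two]
  exact A.2

theorem mul_apply_zero_zero (A B : SL(2, F)) :
    (A * B) 0 0 = A 0 0 * B 0 0 + A 0 1 * B 1 0 := by
  simp [Matrix.mul_apply, Fin.sum_univ_two]

theorem mul_apply_zero_one (A B : SL(2, F)) :
    (A * B) 0 1 = A 0 0 * B 0 1 + A 0 1 * B 1 1 := by
  simp [Matrix.mul_apply, Fin.sum_univ_two]

theorem mul_apply_one_zero (A B : SL(2, F)) :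
    (A * B) 1 0 = A 1 0 * B 0 0 + A 1 1 * B 1 0 := by
  simp [Matrix.mul_apply, Fin.sum_univ_two]

theorem mul_apply_one_one (A B : SL(2, F)) :
    (A * B) 1 1 = A 1 0 * B 0 1 + A 1 1 * B 1 1 := by
  simp [Matrix.mul_apply, Fin.sum_univ_two]

theorem neg_apply (A : SL(2, F)) (i j : Fin 2) : (-A) i j = -A i j := by
  simp

theorem SL2_ext {A B : SL(2, F)} (h00 : A 0 0 = B 0 0) (h01 : A 0 1 = B 0 1)
    (h10 : A 1 0 = B 1 0) (h11 : A 1 1 = B 1 1) : A = B := by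
  ext i j
  fin_cases i <;> fin_cases j <;> assumption

theorem mk_eq_mk_iff {A B : SL(2, F)} :
    (QuotientGroup.mk A : PSL(2, F)) = QuotientGroup.mk B ↔ A = B ∨ A = -B := by
  rw [QuotientGroup.eq, Matrix.SpecialLinearGroup.mem_center_iff]
  constructor
  · rintro ⟨r, hr, h⟩
    rw [Fintype.card_fin, pow_two, mul_self_eq_one_iff] at hr
    rcases hr with rfl | rfl
    · left
      have h1 : A⁻¹ * B = 1 := by
        apply Subtype.ext
        rw [← h, map_one]
        rfl
      exact inv_mul_eq_one.1 h1
    · right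
      have h1 : A⁻¹ * B = -1 := by
        apply Subtype.ext
        rw [← h, map_neg, map_one]
        rfl
      rw [inv_mul_eq_iff_eq_mul] at h1
      rw [h1]
      simp
  · rintro (rfl | rfl)
    · exact ⟨1, one_pow _, by rw [inv_mul_cancel, map_one]; rfl⟩
    · refine ⟨-1, by simp, ?_⟩
      have : (-B)⁻¹ * B = -1 := by
        rw [inv_mul_eq_iff_eq_mul]
        simp
      rw [this, map_neg, map_one]
      rfl

theorem mk_eq_one_iff {A : SL(2, F)} : (QuotientGroup.mk A : PSL(2, F)) = 1 ↔ A = 1 ∨ A = -1 :=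
  mk_eq_mk_iff (B := 1)

theorem commute_mk_iff {A B : SL(2, F)} :
    Commute (QuotientGroup.mk A : PSL(2, F)) (QuotientGroup.mk B) ↔
      A * B = B * A ∨ A * B = -(B * A) :=
  mk_eq_mk_iff

theorem tr_mul_comm (A B : SL(2, F)) : tr (A * B) = tr (B * A) := by
  simp only [tr, mul_apply_zero_zero, mul_apply_one_one]
  ring

theorem tr_neg (A : SL(2, F)) : tr (-A) = -tr A := by
  simp only [tr, neg_apply]
  ring

theorem tr_conj (A B : SL(2, F)) : tr (A * B * A⁻¹) = tr B := by
  rw [tr_mul_comm, inv_mul_cancel_left]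

theorem tr_mul_self (A : SL(2, F)) : tr (A * A) = tr A ^ 2 - 2 := by
  have := det_eq A
  simp only [tr, mul_apply_zero_zero, mul_apply_one_one]
  linear_combination -2 * this

/-- Cayley–Hamilton: A² = tr(A) A - 1. Thus trace 0 characterizes the involutions of PSL₂. -/
theorem mul_self_eq_neg_one_iff {A : SL(2, F)} : A * A = -1 ↔ tr A = 0 := by
  have hd := det_eq A
  constructor
  · intro h
    by_contra ht
    have h01 : (A * A) 0 1 = (-1 : SL(2, F)) 0 1 := by rw [h]
    have h10 : (A * A) 1 0 = (-1 : SL(2, F)) 1 0 := by rw [h]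
    have h00 : (A * A) 0 0 = (-1 : SL(2, F)) 0 0 := by rw [h]
    simp [mul_apply_zero_one, mul_apply_one_zero, mul_apply_zero_zero] at h01 h10 h00
    have e1 : tr A * A 0 1 = 0 := by rw [tr]; linear_combination h01
    have e2 : tr A * A 0 0 = 0 := by rw [tr]; linear_combination h00 + hd
    rcases mul_eq_zero.1 e1 with h | h
    · exact ht h
    rcases mul_eq_zero.1 e2 with h' | h'
    · exact ht h'
    rw [h, h'] at hd
    simp at hd
  · intro h
    have h' : A 1 1 = -A 0 0 := by rw [tr] at h; linear_combination h
    rw [h'] at hd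
    apply SL2_ext <;> simp [mul_apply_zero_one, mul_apply_one_zero, mul_apply_zero_zero,
      mul_apply_one_one, h']
    · linear_combination -hd
    · ring
    · ring
    · linear_combination -hd

theorem eq_one_or_neg_one_of_mul_self (h2 : (2 : F) ≠ 0) {A : SL(2, F)} (h : A * A = 1) :
    A = 1 ∨ A = -1 := by
  have hd := det_eq A
  have ht : tr A ≠ 0 := fun ht => by
    rw [← mul_self_eq_neg_one_iff, h] at ht
    have := congrArg (fun B : SL(2, F) => B 0 0) ht
    simp at this
    exact h2 (by linear_combination this)
  have h01 : (A * A) 0 1 = (1 : SL(2, F)) 0 1 := by rw [h]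
  have h10 : (A * A) 1 0 = (1 : SL(2, F)) 1 0 := by rw [h]
  have h00 : (A * A) 0 0 = (1 : SL(2, F)) 0 0 := by rw [h]
  simp [mul_apply_zero_one, mul_apply_one_zero, mul_apply_zero_zero] at h01 h10 h00
  have e1 : A 0 1 = 0 := (mul_eq_zero.1
    (show tr A * A 0 1 = 0 by rw [tr]; linear_combination h01)).resolve_left ht
  have e2 : A 1 0 = 0 := (mul_eq_zero.1
    (show tr A * A 1 0 = 0 by rw [tr]; linear_combination h10)).resolve_left ht
  rw [e1, zero_mul, add_zero] at h00
  rw [e1, zero_mul, sub_zero] at hd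
  have e3 : A 1 1 = A 0 0 := by
    have h3 : A 0 0 ≠ 0 := fun h => by simp [h] at hd
    exact mul_left_cancel₀ h3 (hd.trans h00.symm)
  rcases mul_self_eq_one_iff.1 h00 with h4 | h4
  · left
    apply SL2_ext <;> simp [e1, e2, e3, h4]
  · right
    apply SL2_ext <;> simp [e1, e2, e3, h4]

theorem mk_sq_eq_one_iff (h2 : (2 : F) ≠ 0) {A : SL(2, F)} :
    (QuotientGroup.mk A : PSL(2, F)) ^ 2 = 1 ↔ (A = 1 ∨ A = -1) ∨ tr A = 0 := by
  rw [pow_two, ← mul_self_eq_neg_one_iff]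
  change (QuotientGroup.mk (A * A) : PSL(2, F)) = 1 ↔ _
  rw [mk_eq_one_iff]
  constructor
  · exact Or.imp (eq_one_or_neg_one_of_mul_self h2) id
  · rintro ((rfl | rfl) | h)
    · simp
    · simp
    · exact Or.inr h

/-- `A` is conjugate to `-A`. So elements of PSL₂ with non-zero trace commute only if their lifts
do. -/
theorem tr_eq_zero_of_anticommute (h2 : (2 : F) ≠ 0) {A B : SL(2, F)} (h : A * B = -(B * A)) :
    tr A = 0 := by
  have h1 : A = -(B * A * B⁻¹) := by
    rw [← neg_mul, ← h, mul_inv_cancel_right]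
  have h2' := congrArg tr h1
  rw [tr_neg, tr_conj] at h2'
  have h3 : 2 * tr A = 0 := by linear_combination h2'
  exact (mul_eq_zero.1 h3).resolve_left h2

/-- The commutator AB - BA is, up to scalars, the cross product of the vectors (a - d, b, c)
representing the matrices modulo scalars. -/
theorem commute_iff_parallel {A B : SL(2, F)} : A * B = B * A ↔
    A 0 1 * B 1 0 = B 0 1 * A 1 0 ∧ (A 0 0 - A 1 1) * B 0 1 = (B 0 0 - B 1 1) * A 0 1 ∧
      (A 0 0 - A 1 1) * B 1 0 = (B 0 0 - B 1 1) * A 1 0 := by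
  constructor
  · intro h
    have h01 : (A * B) 0 1 = (B * A) 0 1 := by rw [h]
    have h10 : (A * B) 1 0 = (B * A) 1 0 := by rw [h]
    have h00 : (A * B) 0 0 = (B * A) 0 0 := by rw [h]
    rw [mul_apply_zero_one, mul_apply_zero_one] at h01
    rw [mul_apply_one_zero, mul_apply_one_zero] at h10
    rw [mul_apply_zero_zero, mul_apply_zero_zero] at h00
    refine ⟨by linear_combination h00, by linear_combination h01, by linear_combination -h10⟩
  · rintro ⟨h1, h2, h3⟩
    apply SL2_ext
    · rw [mul_apply_zero_zero, mul_apply_zero_zero]; linear_combination h1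
    · rw [mul_apply_zero_one, mul_apply_zero_one]; linear_combination h2
    · rw [mul_apply_one_zero, mul_apply_one_zero]; linear_combination -h3
    · rw [mul_apply_one_one, mul_apply_one_one]; linear_combination -h1

/-- Two vectors parallel to the same non-zero vector are parallel; the vector of `A` vanishes only
for ±1. The cases choose a non-zero coordinate to cancel. -/
theorem commute_of_commute {A B D : SL(2, F)} (hA : ¬ (A = 1 ∨ A = -1)) (hAB : A * B = B * A)
    (hAD : A * D = D * A) : B * D = D * B := by
  rw [commute_iff_parallel] at hAB hAD ⊢
  obtain ⟨p1, p2, p3⟩ := hAB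
  obtain ⟨q1, q2, q3⟩ := hAD
  by_cases h01 : A 0 1 = 0
  · by_cases h10 : A 1 0 = 0
    · by_cases h : A 0 0 - A 1 1 = 0
      · exfalso
        apply hA
        have hd := det_eq A
        have h' : A 1 1 = A 0 0 := by linear_combination -h
        rw [h01, h', zero_mul, sub_zero] at hd
        rcases mul_self_eq_one_iff.1 hd with h4 | h4
        · left
          apply SL2_ext <;> simp [h01, h10, h', h4]
        · right
          apply SL2_ext <;> simp [h01, h10, h', h4]
      · refine ⟨mul_left_cancel₀ h ?_, mul_left_cancel₀ h ?_, mul_left_cancel₀ h ?_⟩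
        · linear_combination D 1 0 * p2 - B 1 0 * q2 +
            ((B 0 0 - B 1 1) * D 1 0 - (D 0 0 - D 1 1) * B 1 0) * h01
        · linear_combination (B 0 0 - B 1 1) * q2 - (D 0 0 - D 1 1) * p2
        · linear_combination (B 0 0 - B 1 1) * q3 - (D 0 0 - D 1 1) * p3
    · refine ⟨mul_left_cancel₀ h10 ?_, mul_left_cancel₀ h10 ?_, mul_left_cancel₀ h10 ?_⟩
      · linear_combination B 1 0 * q1 - D 1 0 * p1
      · linear_combination (D 0 0 - D 1 1) * p1 - (B 0 0 - B 1 1) * q1 +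
          ((B 0 0 - B 1 1) * D 1 0 - (D 0 0 - D 1 1) * B 1 0) * h01
      · linear_combination B 1 0 * q3 - D 1 0 * p3
  · have r : B 0 1 * D 1 0 = D 0 1 * B 1 0 :=
      mul_left_cancel₀ h01 (by linear_combination B 0 1 * q1 - D 0 1 * p1)
    refine ⟨r, mul_left_cancel₀ h01 ?_, mul_left_cancel₀ h01 ?_⟩
    · linear_combination B 0 1 * q2 - D 0 1 * p2
    · linear_combination B 1 0 * q2 - D 1 0 * p2 + (A 0 0 - A 1 1) * r

/-- Centralizers in `PSL₂` of elements that are not involutions are abelian. -/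
theorem PSL_commute_of_commute (h2 : (2 : F) ≠ 0) (x : PSL(2, F)) (hx : x ^ 2 ≠ 1)
    (y z : PSL(2, F)) (hy : Commute x y) (hz : Commute x z) : Commute y z := by
  induction x using QuotientGroup.induction_on with | H A
  induction y using QuotientGroup.induction_on with | H B
  induction z using QuotientGroup.induction_on with | H D
  rw [Ne, mk_sq_eq_one_iff h2, not_or] at hx
  rw [commute_mk_iff] at hy hz ⊢
  left
  exact commute_of_commute hx.1
    (hy.resolve_right fun h => hx.2 (tr_eq_zero_of_anticommute h2 h))
    (hz.resolve_right fun h => hx.2 (tr_eq_zero_of_anticommute h2 h))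

/-- If `A * A` represented an involution, then 0 = tr(A²) = tr(A)² - 2. -/
theorem PSL_sq_eq_one_of_pow_four (h2 : (2 : F) ≠ 0) (hsq : ∀ a : F, a ^ 2 ≠ 2) (x : PSL(2, F))
    (hx : x ^ 4 = 1) : x ^ 2 = 1 := by
  induction x using QuotientGroup.induction_on with | H A
  have h1 : (QuotientGroup.mk (A * A) : PSL(2, F)) ^ 2 = 1 := by
    have : (QuotientGroup.mk (A * A) : PSL(2, F)) = (QuotientGroup.mk A : PSL(2, F)) ^ 2 := by
      rw [pow_two]
      rfl
    rw [this, ← pow_mul]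
    exact hx
  rw [mk_sq_eq_one_iff h2] at h1
  rcases h1 with h1 | h1
  · rw [pow_two]
    exact mk_eq_one_iff.2 h1
  · rw [tr_mul_self] at h1
    exact absurd (by linear_combination h1) (hsq (tr A))

/-- For trace -1 the characteristic polynomial x² + x + 1 divides x³ - 1; for trace 1, pass to `-A`.
-/
theorem pow_three_eq_one_of_sq_tr {A : SL(2, F)} (h : tr A ^ 2 = 1) :
    (QuotientGroup.mk A : PSL(2, F)) ^ 3 = 1 := by
  have hd := det_eq A
  have key : ∀ B : SL(2, F), tr B = -1 → B ^ 3 = 1 := by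
    intro B hB
    have hd := det_eq B
    have h' : B 1 1 = -1 - B 0 0 := by rw [tr] at hB; linear_combination hB
    have h3 : B ^ 3 = B * B * B := by rw [pow_succ, pow_two]
    rw [h'] at hd
    rw [h3]
    apply SL2_ext <;> simp only [mul_apply_zero_zero, mul_apply_one_one, mul_apply_zero_one,
      mul_apply_one_zero, h', Matrix.SpecialLinearGroup.coe_one, Matrix.one_apply_eq, ne_eq,
      zero_ne_one, one_ne_zero, not_false_eq_true, Matrix.one_apply_ne]
    · linear_combination (1 - B 0 0) * hd + 0 * hd
    · linear_combination (- B 0 1) * hd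
    · linear_combination (- B 1 0) * hd
    · linear_combination (B 0 0 + 2) * hd
  rcases mul_self_eq_one_iff.1 ((pow_two _).symm.trans h) with h | h
  · have h1 := key (-A) (by rw [tr_neg, h])
    have h2 : (QuotientGroup.mk A : PSL(2, F)) = QuotientGroup.mk (-A) :=
      mk_eq_mk_iff.2 (Or.inr (neg_neg A).symm)
    rw [h2, ← QuotientGroup.mk_pow, h1]
    rfl
  · rw [← QuotientGroup.mk_pow, key A h]
    rfl

end SL2

/-! ### Elements of 3-power order in characteristic 3 -/

section CharThree

variable {F : Type*} [Field F] [CharP F 3]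

theorem two_eq_neg_one : (2 : F) = -1 := by
  have : (3 : F) = 0 := CharP.cast_eq_zero F 3
  linear_combination this

theorem two_ne_zero_of_char_three : (2 : F) ≠ 0 := by
  rw [two_eq_neg_one]
  exact neg_ne_zero.2 one_ne_zero

/-- In general tr(A³) = tr(A)³ - 3 tr(A). -/
theorem tr_pow_three (A : SL(2, F)) : tr (A ^ 3) = tr A ^ 3 := by
  have h3 : (3 : F) = 0 := CharP.cast_eq_zero F 3
  have hd := det_eq A
  have h : A ^ 3 = A * A * A := by rw [pow_succ, pow_two]
  rw [h]
  simp only [tr, mul_apply_zero_zero, mul_apply_one_one, mul_apply_zero_one, mul_apply_one_zero]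
  linear_combination (-A 0 0 - A 1 1) * (A 0 0 * A 1 1 - A 0 1 * A 1 0) * h3

theorem sq_tr_eq_one_of_pow {A : SL(2, F)} {n : ℕ}
    (h : (QuotientGroup.mk A : PSL(2, F)) ^ 3 ^ n = 1) : tr A ^ 2 = 1 := by
  have h3 : (3 : F) = 0 := CharP.cast_eq_zero F 3
  induction n generalizing A with
  | zero =>
    rw [pow_zero, pow_one, mk_eq_one_iff] at h
    have h1 : tr (1 : SL(2, F)) = -1 := by
      simp only [tr, Matrix.SpecialLinearGroup.coe_one, Matrix.one_apply_eq]
      linear_combination h3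
    rcases h with rfl | rfl
    · rw [h1, neg_one_sq]
    · rw [tr_neg, h1, neg_neg, one_pow]
  | succ n ih =>
    rw [pow_succ', pow_mul] at h
    have h1 := ih (A := A ^ 3) h
    rw [tr_pow_three] at h1
    have h2 : (tr A ^ 2 - 1) ^ 3 = 0 := by
      linear_combination h1 + (-tr A ^ 4 + tr A ^ 2) * h3
    exact sub_eq_zero.1 (pow_eq_zero_iff (by norm_num) |>.1 h2)

/-- No element of order a power of `3` commutes with an involution. -/
theorem eq_one_of_commute_involution {x y : PSL(2, F)} (hx : ∃ n, x ^ 3 ^ n = 1) (hy : y ^ 2 = 1)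
    (hy1 : y ≠ 1) (h : Commute x y) : x = 1 := by
  have h2 : (2 : F) ≠ 0 := two_ne_zero_of_char_three
  have h3 : (3 : F) = 0 := CharP.cast_eq_zero F 3
  induction x using QuotientGroup.induction_on with | H A
  induction y using QuotientGroup.induction_on with | H B
  obtain ⟨n, hn⟩ := hx
  have ht := sq_tr_eq_one_of_pow hn
  rw [mk_sq_eq_one_iff h2] at hy
  rw [Ne, mk_eq_one_iff] at hy1
  have hB := hy.resolve_left hy1
  rw [commute_mk_iff] at h
  have h := h.resolve_right fun h => by
    rw [tr_eq_zero_of_anticommute h2 h] at ht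
    simp at ht
  by_contra hA
  rw [mk_eq_one_iff] at hA
  have hBA := commute_of_commute hA rfl h
  rw [commute_iff_parallel] at h
  obtain ⟨p1, p2, p3⟩ := h
  have hdA := det_eq A
  have hdB := det_eq B
  have hB' : B 1 1 = -B 0 0 := by rw [tr] at hB; linear_combination hB
  rw [hB'] at p2 p3 hdB
  -- This is the discriminant tr² - 4 of `A`, with tr² = 1. For `B`, of trace 0, the discriminant is
  -- -4 ≠ 0. Since the vectors of `A` and `B` modulo scalars are parallel, that of `A` must vanish.
  have hdisc : (A 0 0 - A 1 1) ^ 2 + 4 * A 0 1 * A 1 0 = 0 := by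
    rw [tr] at ht
    linear_combination ht - 4 * hdA - h3
  have e1 : A 0 1 ^ 2 = 0 := by
    linear_combination -4 * A 0 1 ^ 2 * hdB +
      ((A 0 0 - A 1 1) * B 0 1 + 2 * B 0 0 * A 0 1) * p2 - B 0 1 ^ 2 * hdisc -
      4 * A 0 1 * B 0 1 * p1 - A 0 1 ^ 2 * h3
  have e2 : A 1 0 ^ 2 = 0 := by
    linear_combination -4 * A 1 0 ^ 2 * hdB +
      ((A 0 0 - A 1 1) * B 1 0 + 2 * B 0 0 * A 1 0) * p3 - B 1 0 ^ 2 * hdisc +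
      4 * A 1 0 * B 1 0 * p1 - A 1 0 ^ 2 * h3
  rw [pow_eq_zero_iff (by norm_num)] at e1 e2
  have e3 : A 0 0 - A 1 1 = 0 := by
    rw [e1] at hdisc
    have h5 : (A 0 0 - A 1 1) ^ 2 = 0 := by linear_combination hdisc
    rwa [pow_eq_zero_iff (by norm_num)] at h5
  have h' : A 1 1 = A 0 0 := by linear_combination -e3
  rw [e1, h', zero_mul, sub_zero] at hdA
  refine hA ((mul_self_eq_one_iff.1 hdA).imp (fun h4 => ?_) fun h4 => ?_) <;>
  · apply SL2_ext <;> simp [e1, e2, h', h4]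

end CharThree

/-! ### Field automorphisms of order 3 acting on PSL₂ -/

section Cubic

variable {F : Type*} [Field F]

/-- A field automorphism of order `3` whose fixed field has three elements. -/
structure IsCubic (σ : F ≃+* F) : Prop where
  apply_apply_apply : ∀ x, σ (σ (σ x)) = x
  pow_three_of_fixed : ∀ x, σ x = x → x ^ 3 = x
  exists_ne : ∃ x, σ x ≠ x

variable {σ : F ≃+* F}

theorem slAut_apply (σ : F ≃+* F) (A : SL(2, F)) (i j : Fin 2) : slAut σ A i j = σ (A i j) := by
  simp [slAut]

theorem tr_slAut (A : SL(2, F)) : tr (slAut σ A) = σ (tr A) := by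
  rw [tr, slAut_apply, slAut_apply, tr, map_add]

theorem fieldAut_mk (σ : F ≃+* F) (A : SL(2, F)) :
    fieldAut σ (QuotientGroup.mk A) = QuotientGroup.mk (slAut σ A) := rfl

theorem fieldAut_one : fieldAut (1 : F ≃+* F) = 1 := by
  ext y
  induction y using QuotientGroup.induction_on with | H A
  rw [fieldAut_mk]
  congr 1

theorem fieldAut_mul (σ τ : F ≃+* F) : fieldAut (σ * τ) = fieldAut σ * fieldAut τ := by
  ext y
  induction y using QuotientGroup.induction_on with | H A
  rw [MulAut.mul_apply, fieldAut_mk, fieldAut_mk, fieldAut_mk]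
  congr 1

/-- The action of the automorphisms of `F` on `PSL₂(F)`. -/
def fieldAutHom : (F ≃+* F) →* MulAut PSL(2, F) where
  toFun := fieldAut
  map_one' := fieldAut_one
  map_mul' := fieldAut_mul

theorem exists_eq_fieldAut {τ : F ≃+* F} (c : zpowers (fieldAut τ)) :
    ∃ σ : F ≃+* F, c.1 = fieldAut σ := by
  obtain ⟨k, hk⟩ := mem_zpowers_iff.1 c.2
  exact ⟨τ ^ k, hk.symm.trans (map_zpow fieldAutHom τ k).symm⟩

theorem IsCubic.fieldAut_pow_three (hσ : IsCubic σ) : fieldAut σ ^ 3 = 1 := by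
  have h : σ ^ 3 = 1 := RingEquiv.ext fun x => by
    rw [pow_succ, pow_two]
    exact hσ.apply_apply_apply x
  exact (map_pow fieldAutHom σ 3).symm.trans ((congrArg _ h).trans (map_one _))

theorem IsCubic.eq_zero_or (hσ : IsCubic σ) {x : F} (h : σ x = x) : x = 0 ∨ x = 1 ∨ x = -1 := by
  have h1 := hσ.pow_three_of_fixed x h
  have h2 : x * (x ^ 2 - 1) = 0 := by linear_combination h1
  refine (mul_eq_zero.1 h2).imp_right fun h3 => ?_
  exact mul_self_eq_one_iff.1 (by linear_combination h3)

variable [CharP F 3]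

theorem IsCubic.eq_zero_of_apply_eq_neg (hσ : IsCubic σ) {x : F} (h : σ x = -x) : x = 0 := by
  have h1 := hσ.apply_apply_apply x
  rw [h, map_neg, h, neg_neg, h] at h1
  have h2 : (2 : F) * x = 0 := by linear_combination -h1
  exact (mul_eq_zero.1 h2).resolve_left two_ne_zero_of_char_three

/-- The equation says that `B` commutes with an element inducing `σ` twisted by `A`. Up to sign,
applying `σ` to `B` gives a conjugate of `B`, so `σ` fixes or negates its trace; fixed values are 0
and ±1, negated ones are 0. -/
theorem IsCubic.tr_eq_zero_or (hσ : IsCubic σ) {A B : SL(2, F)}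
    (h : (QuotientGroup.mk A : PSL(2, F)) * fieldAut σ (QuotientGroup.mk B) =
      QuotientGroup.mk B * QuotientGroup.mk A) : tr B = 0 ∨ tr B ^ 2 = 1 := by
  rw [fieldAut_mk] at h
  have h' : A * slAut σ B = B * A ∨ A * slAut σ B = -(B * A) := mk_eq_mk_iff.1 h
  rcases h' with h | h
  · have h1 : slAut σ B = A⁻¹ * B * A⁻¹⁻¹ := by
      rw [inv_inv, mul_assoc, ← h, inv_mul_cancel_left]
    have h2 := congrArg tr h1
    rw [tr_conj, tr_slAut] at h2
    rcases hσ.eq_zero_or h2 with h3 | h3 | h3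
    · exact Or.inl h3
    · exact Or.inr (by rw [h3, one_pow])
    · exact Or.inr (by rw [h3, neg_one_sq])
  · have h1 : slAut σ B = -(A⁻¹ * B * A⁻¹⁻¹) := by
      rw [inv_inv, mul_assoc, ← mul_neg, ← h, inv_mul_cancel_left]
    have h2 := congrArg tr h1
    rw [tr_neg, tr_conj, tr_slAut] at h2
    exact Or.inl (hσ.eq_zero_of_apply_eq_neg h2)

theorem IsCubic.pow_two_or_pow_three (hσ : IsCubic σ) {a y : PSL(2, F)}
    (h : a * fieldAut σ y = y * a) : y ^ 2 = 1 ∨ y ^ 3 = 1 := by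
  induction a using QuotientGroup.induction_on with | H A
  induction y using QuotientGroup.induction_on with | H B
  refine (hσ.tr_eq_zero_or h).imp (fun h1 => ?_) pow_three_eq_one_of_sq_tr
  exact (mk_sq_eq_one_iff two_ne_zero_of_char_three).2 (Or.inr h1)

end Cubic

/-! ### Vanishing of cohomology: elements outside PSL₂ conjugate to field automorphisms -/

section Lang

variable {F : Type*} [Field F] {σ : F ≃+* F}

/-- Dedekind's independence of the characters 1, σ, σ². -/
theorem IsCubic.eq_zero_of_forall (hσ : IsCubic σ) {a b c : F}
    (h : ∀ x, a * x + b * σ x + c * σ (σ x) = 0) : a = 0 := by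
  obtain ⟨t, ht⟩ := hσ.exists_ne
  let f : Fin 3 → (F →* F) := ![MonoidHom.id F, (σ : F →* F), (σ : F →* F).comp (σ : F →* F)]
  have hf : Function.Injective f := by
    have h01 : f 0 ≠ f 1 := fun h => ht (DFunLike.congr_fun h t).symm
    have h02 : f 0 ≠ f 2 := fun h => ht (by
      have h1 : t = σ (σ t) := DFunLike.congr_fun h t
      have h2 := hσ.apply_apply_apply t
      rwa [← h1] at h2)
    have h12 : f 1 ≠ f 2 := fun h => ht (σ.injective (DFunLike.congr_fun h t)).symm
    intro i j hij
    fin_cases i <;> fin_cases j <;> first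
      | rfl
      | exact (h01 hij).elim
      | exact (h01 hij.symm).elim
      | exact (h02 hij).elim
      | exact (h02 hij.symm).elim
      | exact (h12 hij).elim
      | exact (h12 hij.symm).elim
  have hli := (linearIndependent_monoidHom F F).comp f hf
  rw [Fintype.linearIndependent_iff] at hli
  refine hli ![a, b, c] ?_ 0
  ext x
  simpa [Fin.sum_univ_three, f] using h x

/-- The semilinear map `v ↦ A σ(v)`. -/
def semi (σ : F ≃+* F) (A : SL(2, F)) (v : Fin 2 → F) : Fin 2 → F :=
  ![A 0 0 * σ (v 0) + A 0 1 * σ (v 1), A 1 0 * σ (v 0) + A 1 1 * σ (v 1)]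

theorem semi_zero (A : SL(2, F)) (v : Fin 2 → F) :
  semi σ A v 0 = A 0 0 * σ (v 0) + A 0 1 * σ (v 1) := rfl

theorem semi_one (A : SL(2, F)) (v : Fin 2 → F) :
  semi σ A v 1 = A 1 0 * σ (v 0) + A 1 1 * σ (v 1) := rfl

theorem semi_add (A : SL(2, F)) (v w : Fin 2 → F) : semi σ A (v + w) = semi σ A v + semi σ A w := by
  ext i
  fin_cases i
  · simp [semi_zero]
    ring
  · simp [semi_one]
    ring

theorem semi_smul (A : SL(2, F)) (a : F) (v : Fin 2 → F) :
    semi σ A (a • v) = σ a • semi σ A v := by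
  ext i
  fin_cases i
  · simp [semi_zero]
    ring
  · simp [semi_one]
    ring

theorem IsCubic.semi_semi_semi (hσ : IsCubic σ) {A : SL(2, F)}
    (hA : A * slAut σ A * slAut σ (slAut σ A) = 1) (v : Fin 2 → F) :
    semi σ A (semi σ A (semi σ A v)) = v := by
  have key : ∀ i j, (A * slAut σ A * slAut σ (slAut σ A)) i j = (1 : SL(2, F)) i j :=
    fun i j => by rw [hA]
  have h00 := key 0 0
  have h01 := key 0 1
  have h10 := key 1 0
  have h11 := key 1 1
  simp only [mul_apply_zero_zero, mul_apply_zero_one, mul_apply_one_zero, mul_apply_one_one,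
    slAut_apply, Matrix.SpecialLinearGroup.coe_one, Matrix.one_apply_eq, ne_eq,
      zero_ne_one, one_ne_zero, not_false_eq_true, Matrix.one_apply_ne] at h00 h01 h10 h11
  ext i
  fin_cases i
  · simp only [Fin.zero_eta, semi_zero, semi_one, map_add, map_mul, hσ.apply_apply_apply]
    linear_combination v 0 * h00 + v 1 * h01
  · simp only [Fin.mk_one, semi_zero, semi_one, map_add, map_mul, hσ.apply_apply_apply]
    linear_combination v 0 * h10 + v 1 * h11

/-- With s the semilinear map, which has s³ = 1, every sum x v + σ(x) s(v) + σ²(x) s²(v) is fixed by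
s. A linear form vanishing on all fixed vectors vanishes on these for every x, hence at v by
independence of characters. -/
theorem IsCubic.exists_semi_eq (hσ : IsCubic σ) {A : SL(2, F)}
    (hA : A * slAut σ A * slAut σ (slAut σ A) = 1) {p q : F} (hpq : p ≠ 0 ∨ q ≠ 0) :
    ∃ v, semi σ A v = v ∧ p * v 0 + q * v 1 ≠ 0 := by
  by_contra! H
  have key : ∀ v : Fin 2 → F, p * v 0 + q * v 1 = 0 := by
    intro v
    refine hσ.eq_zero_of_forall (b := p * semi σ A v 0 + q * semi σ A v 1)
      (c := p * semi σ A (semi σ A v) 0 + q * semi σ A (semi σ A v) 1) fun x => ?_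
    have h := H (x • v + σ x • semi σ A v + σ (σ x) • semi σ A (semi σ A v)) (by
      rw [semi_add, semi_add, semi_smul, semi_smul, semi_smul, hσ.semi_semi_semi hA,
        hσ.apply_apply_apply]
      abel)
    simp only [Pi.add_apply, Pi.smul_apply, smul_eq_mul] at h
    linear_combination h
  rcases hpq with h | h
  · exact h (by simpa using key ![1, 0])
  · exact h (by simpa using key ![0, 1])

/-- The first cohomology of `⟨σ⟩` in `SL₂(F)` vanishes on such cocycles. -/
theorem IsCubic.exists_mul_slAut_eq (hσ : IsCubic σ) {A : SL(2, F)}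
    (hA : A * slAut σ A * slAut σ (slAut σ A) = 1) : ∃ B : SL(2, F), A * slAut σ B = B := by
  obtain ⟨v, hv, hv0⟩ := hσ.exists_semi_eq hA (p := 1) (q := 0) (Or.inl one_ne_zero)
  have hv1 : v 0 ≠ 0 := by simpa using hv0
  obtain ⟨w, hw, hw0⟩ := hσ.exists_semi_eq hA (p := -v 1) (q := v 0) (Or.inr hv1)
  have hv0' := congrFun hv 0
  have hv1' := congrFun hv 1
  have hw0' := congrFun hw 0
  have hw1' := congrFun hw 1
  rw [semi_zero] at hv0' hw0'
  rw [semi_one] at hv1' hw1'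
  set d := -v 1 * w 0 + v 0 * w 1 with hd
  have hdA := det_eq A
  -- The two fixed vectors give d = det(A) σ(d), and det(A) = 1. So dividing the second column by
  -- `d` keeps it fixed and makes the determinant 1.
  have hσd : σ d = d := by
    have h : d = -(A 1 0 * σ (v 0) + A 1 1 * σ (v 1)) * (A 0 0 * σ (w 0) + A 0 1 * σ (w 1)) +
        (A 0 0 * σ (v 0) + A 0 1 * σ (v 1)) * (A 1 0 * σ (w 0) + A 1 1 * σ (w 1)) := by
      rw [hv0', hv1', hw0', hw1']
    refine Eq.trans ?_ h.symm
    rw [hd]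
    simp only [map_add, map_mul, map_neg]
    linear_combination (-1 : F) * (-σ (v 1) * σ (w 0) + σ (v 0) * σ (w 1)) * hdA
  have hd2 : σ d⁻¹ = d⁻¹ := by rw [map_inv₀, hσd]
  obtain ⟨B, h00, h01, h10, h11⟩ : ∃ B : SL(2, F), B 0 0 = v 0 ∧ B 0 1 = d⁻¹ * w 0 ∧
      B 1 0 = v 1 ∧ B 1 1 = d⁻¹ * w 1 := by
    refine ⟨⟨!![v 0, d⁻¹ * w 0; v 1, d⁻¹ * w 1], ?_⟩, rfl, rfl, rfl, rfl⟩
    rw [Matrix.det_fin_two_of]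
    have : d * d⁻¹ = 1 := mul_inv_cancel₀ hw0
    linear_combination this - d⁻¹ * hd
  refine ⟨B, ?_⟩
  apply SL2_ext
  · rw [mul_apply_zero_zero, slAut_apply, slAut_apply, h00, h10]
    exact hv0'
  · rw [mul_apply_zero_one, slAut_apply, slAut_apply, h01, h11, map_mul, map_mul, hd2]
    linear_combination d⁻¹ * hw0'
  · rw [mul_apply_one_zero, slAut_apply, slAut_apply, h00, h10]
    exact hv1'
  · rw [mul_apply_one_one, slAut_apply, slAut_apply, h01, h11, map_mul, map_mul, hd2]
    linear_combination d⁻¹ * hw1'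

/-- A lift of the cocycle has norm ±1; as the norm has three factors, replacing `A` by `-A` corrects
the sign. -/
theorem IsCubic.exists_eq_mul_fieldAut_inv (hσ : IsCubic σ) {a : PSL(2, F)}
    (ha : a * fieldAut σ a * fieldAut σ (fieldAut σ a) = 1) :
    ∃ b : PSL(2, F), a * fieldAut σ b = b := by
  induction a using QuotientGroup.induction_on with | H A
  rw [fieldAut_mk, fieldAut_mk] at ha
  have ha' : A * slAut σ A * slAut σ (slAut σ A) = 1 ∨
      A * slAut σ A * slAut σ (slAut σ A) = -1 := mk_eq_one_iff.1 ha
  rcases ha' with h | h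
  · obtain ⟨B, hB⟩ := hσ.exists_mul_slAut_eq h
    exact ⟨QuotientGroup.mk B, congrArg QuotientGroup.mk hB⟩
  · have hneg : ∀ B : SL(2, F), slAut σ (-B) = -slAut σ B := by
      intro B
      apply SL2_ext <;> simp only [slAut_apply, neg_apply, map_neg]
    obtain ⟨B, hB⟩ := hσ.exists_mul_slAut_eq (A := -A) (by
      rw [hneg, hneg, neg_mul_neg, mul_neg, h, neg_neg])
    have hmk : (QuotientGroup.mk A : PSL(2, F)) = QuotientGroup.mk (-A) :=
      mk_eq_mk_iff.2 (Or.inr (neg_neg A).symm)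
    exact ⟨QuotientGroup.mk B, by rw [hmk]; exact congrArg QuotientGroup.mk hB⟩

end Lang

/-! ### Explicit elements, and triviality of the centre of PSL₂ -/

section Elements

variable {F : Type*} [Field F]

/-- An upper unitriangular matrix. -/
def upper (b : F) : SL(2, F) := ⟨!![1, b; 0, 1], by simp⟩

/-- The matrix of the quarter turn. -/
def weyl : SL(2, F) := ⟨!![0, -1; 1, 0], by simp⟩

theorem upper_zero_zero (b : F) : upper b 0 0 = 1 := rfl
theorem upper_zero_one (b : F) : upper b 0 1 = b := rfl
theorem upper_one_zero (b : F) : upper b 1 0 = 0 := rfl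
theorem upper_one_one (b : F) : upper b 1 1 = 1 := rfl
theorem weyl_zero_zero : (weyl : SL(2, F)) 0 0 = 0 := rfl
theorem weyl_zero_one : (weyl : SL(2, F)) 0 1 = -1 := rfl
theorem weyl_one_zero : (weyl : SL(2, F)) 1 0 = 1 := rfl
theorem weyl_one_one : (weyl : SL(2, F)) 1 1 = 0 := rfl

theorem slAut_upper (σ : F ≃+* F) (b : F) : slAut σ (upper b) = upper (σ b) := by
  apply SL2_ext <;> rw [slAut_apply] <;>
    simp [upper_zero_zero, upper_zero_one, upper_one_zero, upper_one_one]

theorem slAut_weyl (σ : F ≃+* F) : slAut σ weyl = weyl := by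
  apply SL2_ext <;> rw [slAut_apply] <;>
    simp [weyl_zero_zero, weyl_zero_one, weyl_one_zero, weyl_one_one]

theorem upper_mul_upper (a b : F) : upper a * upper b = upper (a + b) := by
  apply SL2_ext <;> simp [mul_apply_zero_zero, mul_apply_zero_one, mul_apply_one_zero,
    mul_apply_one_one, upper_zero_zero, upper_zero_one, upper_one_zero, upper_one_one, add_comm]

theorem upper_zero : upper (0 : F) = 1 := by
  apply SL2_ext <;> simp [upper_zero_zero, upper_zero_one, upper_one_zero, upper_one_one]

theorem upper_inv (b : F) : (upper b)⁻¹ = upper (-b) := by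
  rw [inv_eq_iff_mul_eq_one, upper_mul_upper, add_neg_cancel, upper_zero]

theorem upper_pow (b : F) (n : ℕ) : upper b ^ n = upper (n * b) := by
  induction n with
  | zero => simp [upper_zero]
  | succ n ih => rw [pow_succ, ih, upper_mul_upper, Nat.cast_succ, add_mul, one_mul]

theorem weyl_sq : (QuotientGroup.mk weyl : PSL(2, F)) ^ 2 = 1 := by
  rw [pow_two]
  refine mk_eq_one_iff.2 (Or.inr (mul_self_eq_neg_one_iff.2 ?_))
  rw [tr, weyl_zero_zero, weyl_one_one, add_zero]

theorem not_commute_upper_weyl :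
    ¬ Commute (QuotientGroup.mk (upper 1) : PSL(2, F)) (QuotientGroup.mk weyl) := by
  rw [commute_mk_iff]
  have h1 : (upper 1 * weyl : SL(2, F)) 0 0 = 1 := by
    rw [mul_apply_zero_zero, upper_zero_zero, upper_zero_one, weyl_zero_zero, weyl_one_zero]
    ring
  have h2 : (weyl * upper 1 : SL(2, F)) 0 0 = 0 := by
    rw [mul_apply_zero_zero, upper_zero_zero, upper_one_zero, weyl_zero_zero, weyl_zero_one]
    ring
  rintro (h | h)
  · rw [h, h2] at h1
    exact zero_ne_one h1
  · rw [h, neg_apply, h2, neg_zero] at h1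
    exact zero_ne_one h1

theorem upper_pow_three [CharP F 3] (b : F) : upper b ^ 3 = 1 := by
  have h3 : ((3 : ℕ) : F) = 0 := CharP.cast_eq_zero F 3
  rw [upper_pow, h3, zero_mul, upper_zero]

/-- The test matrices `upper 1` and `weyl * upper 1` have non-zero trace, so a lift of `x` commutes
with them in SL₂ itself; together they leave only scalars. -/
theorem PSL_eq_one_of_forall_commute [CharP F 3] {x : PSL(2, F)} (h : ∀ y, Commute y x) :
    x = 1 := by
  induction x using QuotientGroup.induction_on with | H A
  have h2 : (2 : F) ≠ 0 := two_ne_zero_of_char_three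
  have key : ∀ B : SL(2, F), tr B ≠ 0 → B * A = A * B := fun B hB =>
    (commute_mk_iff.1 (h (QuotientGroup.mk B))).resolve_right
      fun h => hB (tr_eq_zero_of_anticommute h2 h)
  have h1 := key (upper 1) (by
    rw [tr, upper_zero_zero, upper_one_one, one_add_one_eq_two]
    exact h2)
  have h4 := key (weyl * upper 1) (by
    rw [tr, mul_apply_zero_zero, mul_apply_one_one, upper_zero_zero, upper_one_zero,
      upper_zero_one, upper_one_one, weyl_zero_zero, weyl_zero_one, weyl_one_zero, weyl_one_one]
    simp)
  rw [commute_iff_parallel] at h1 h4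
  simp only [mul_apply_zero_zero, mul_apply_zero_one, mul_apply_one_zero,
    mul_apply_one_one, upper_zero_zero, upper_one_zero,
      upper_zero_one, upper_one_one, weyl_zero_zero, weyl_zero_one, weyl_one_zero,
      weyl_one_one] at h1 h4
  have e1 : A 1 0 = 0 := by linear_combination h1.1
  have e2 : A 0 1 = 0 := by linear_combination -h4.1 - e1
  have e3 : A 1 1 = A 0 0 := by linear_combination h1.2.1
  have hd := det_eq A
  rw [e1, e3, mul_zero, sub_zero] at hd
  rw [mk_eq_one_iff]
  refine (mul_self_eq_one_iff.1 hd).imp (fun h4 => ?_) fun h4 => ?_ <;>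
  · apply SL2_ext <;> simp [e1, e2, e3, h4]

end Elements

/-! ### The four-group of fixed involutions -/

section Fixed

variable {F : Type*} [Field F] [CharP F 3] {σ : F ≃+* F}

theorem IsCubic.exists_zmod (hσ : IsCubic σ) {x : F} (h : σ x = x) :
    ∃ z : ZMod 3, ZMod.castHom (dvd_refl 3) F z = x := by
  rcases hσ.eq_zero_or h with rfl | rfl | rfl
  · exact ⟨0, map_zero _⟩
  · exact ⟨1, map_one _⟩
  · exact ⟨-1, by rw [map_neg, map_one]⟩

theorem IsCubic.slAut_eq_of_fieldAut_eq (hσ : IsCubic σ) {A : SL(2, F)}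
    (h : fieldAut σ (QuotientGroup.mk A) = QuotientGroup.mk A) : slAut σ A = A := by
  rw [fieldAut_mk] at h
  refine (mk_eq_mk_iff.1 h).resolve_right fun h => ?_
  have h1 : ∀ i j, A i j = 0 := fun i j => hσ.eq_zero_of_apply_eq_neg (by
    rw [← slAut_apply, h, neg_apply])
  have hd := det_eq A
  simp [h1] at hd

/-- The trace-zero matrices in SL₂(3) are the elements of order 4 of its quaternion subgroup: two of
them agree up to sign or have a product of trace 0. -/
theorem quaternion_zmod_three : ∀ a b c : ZMod 3, -a * a - b * c = 1 → ∀ a' b' c' : ZMod 3,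
    -a' * a' - b' * c' = 1 → 2 * a * a' + b * c' + c * b' = 0 ∨
      (a = a' ∧ b = b' ∧ c = c') ∨ (a = -a' ∧ b = -b' ∧ c = -c') := by
  decide

theorem IsCubic.sq_mul_eq_one (hσ : IsCubic σ) {x y : PSL(2, F)} (hx : x ^ 2 = 1) (hy : y ^ 2 = 1)
    (hσx : fieldAut σ x = x) (hσy : fieldAut σ y = y) : (x * y) ^ 2 = 1 := by
  have h2 : (2 : F) ≠ 0 := two_ne_zero_of_char_three
  induction x using QuotientGroup.induction_on with | H A
  induction y using QuotientGroup.induction_on with | H B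
  have hA := hσ.slAut_eq_of_fieldAut_eq hσx
  have hB := hσ.slAut_eq_of_fieldAut_eq hσy
  by_cases hx1 : (QuotientGroup.mk A : PSL(2, F)) = 1
  · rw [hx1, one_mul, hy]
  by_cases hy1 : (QuotientGroup.mk B : PSL(2, F)) = 1
  · rw [hy1, mul_one, hx]
  rw [mk_eq_one_iff] at hx1 hy1
  have htA := ((mk_sq_eq_one_iff h2).1 hx).resolve_left hx1
  have htB := ((mk_sq_eq_one_iff h2).1 hy).resolve_left hy1
  have key : ∀ {D : SL(2, F)}, slAut σ D = D → ∀ i j,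
      ∃ z : ZMod 3, ZMod.castHom (dvd_refl 3) F z = D i j := fun hD i j =>
    hσ.exists_zmod (by rw [← slAut_apply, hD])
  obtain ⟨a, ha⟩ := key hA 0 0
  obtain ⟨b, hb⟩ := key hA 0 1
  obtain ⟨c, hc⟩ := key hA 1 0
  obtain ⟨a', ha'⟩ := key hB 0 0
  obtain ⟨b', hb'⟩ := key hB 0 1
  obtain ⟨c', hc'⟩ := key hB 1 0
  have hA1 : A 1 1 = -A 0 0 := by rw [tr] at htA; linear_combination htA
  have hB1 : B 1 1 = -B 0 0 := by rw [tr] at htB; linear_combination htB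
  have hinj : Function.Injective (ZMod.castHom (dvd_refl 3) F) := RingHom.injective _
  have hdA : -a * a - b * c = 1 := hinj (by
    rw [map_sub, map_mul, map_mul, map_neg, ha, hb, hc, map_one]
    linear_combination det_eq A - A 0 0 * hA1)
  have hdB : -a' * a' - b' * c' = 1 := hinj (by
    rw [map_sub, map_mul, map_mul, map_neg, ha', hb', hc', map_one]
    linear_combination det_eq B - B 0 0 * hB1)
  rcases quaternion_zmod_three a b c hdA a' b' c' hdB with h | ⟨rfl, rfl, rfl⟩ | ⟨rfl, rfl, rfl⟩
  · refine (mk_sq_eq_one_iff (A := A * B) h2).2 (Or.inr ?_)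
    have h3 := congrArg (ZMod.castHom (dvd_refl 3) F) h
    simp only [map_add, map_mul, map_ofNat, map_zero, ha, hb, hc, ha', hb', hc'] at h3
    rw [tr, mul_apply_zero_zero, mul_apply_one_one, hA1, hB1]
    linear_combination h3
  · have h3 : A = B := SL2_ext (ha.symm.trans ha') (hb.symm.trans hb') (hc.symm.trans hc')
      (by rw [hA1, hB1, ← ha, ← ha'])
    rw [h3, ← pow_two, hy, one_pow]
  · rw [map_neg] at ha hb hc
    have h3 : (QuotientGroup.mk A : PSL(2, F)) = QuotientGroup.mk B := mk_eq_mk_iff.2 (Or.inr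
      (SL2_ext (by rw [neg_apply, ← ha, ha']) (by rw [neg_apply, ← hb, hb'])
        (by rw [neg_apply, ← hc, hc']) (by rw [neg_apply, hA1, hB1, ← ha, ha'])))
    rw [h3, ← pow_two, hy, one_pow]

/-- The elements of order at most `2` of `PSL₂(F)` that are fixed by `σ`. -/
def fixedInvolutions (hσ : IsCubic σ) : Subgroup PSL(2, F) where
  carrier := {x | x ^ 2 = 1 ∧ fieldAut σ x = x}
  one_mem' := ⟨one_pow 2, map_one _⟩
  mul_mem' := fun {x y} hx hy =>
    ⟨hσ.sq_mul_eq_one hx.1 hy.1 hx.2 hy.2, by rw [map_mul, hx.2, hy.2]⟩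
  inv_mem' := fun {x} hx => ⟨by rw [inv_pow, hx.1, inv_one], by rw [map_inv, hx.2]⟩

end Fixed

/-! ### Centralizers in L -/

section SemidirectProducts

variable {F : Type*} [Field F] {τ : F ≃+* F}

instance : CommGroup (zpowers (fieldAut τ)) :=
  { (inferInstance : Group (zpowers (fieldAut τ))) with
    mul_comm := fun a b => (zpowers_isMulCommutative (fieldAut τ)).is_comm.comm a b }

/-- The projection of `L` onto `⟨φ⟩`. -/
def proj (τ : F ≃+* F) : L τ →* zpowers (fieldAut τ) := SemidirectProduct.rightHom

theorem eq_inl_of_proj_eq_one {x : L τ} (h : proj τ x = 1) :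
    ∃ y, x = SemidirectProduct.inl y :=
  ⟨x.left, SemidirectProduct.ext rfl h⟩

theorem proj_inl (y : PSL(2, F)) : proj τ (SemidirectProduct.inl y) = 1 := rfl

theorem commute_inl_iff {σ : F ≃+* F} {t : L τ} (ht : t.right.1 = fieldAut σ) {y : PSL(2, F)} :
    Commute (SemidirectProduct.inl y) t ↔ t.left * fieldAut σ y = y * t.left := by
  rw [Commute, SemiconjBy, SemidirectProduct.ext_iff, SemidirectProduct.mul_left,
    SemidirectProduct.mul_left, SemidirectProduct.mul_right, SemidirectProduct.mul_right,
    SemidirectProduct.right_inl, SemidirectProduct.left_inl, one_mul, mul_one, map_one, ← ht]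
  exact ⟨fun h => h.1.symm, fun h => ⟨h.symm, rfl⟩⟩

theorem commute_inl_inl_iff {x y : PSL(2, F)} :
    Commute (SemidirectProduct.inl x : L τ) (SemidirectProduct.inl y) ↔ Commute x y := by
  rw [Commute, SemiconjBy, ← map_mul, ← map_mul, SemidirectProduct.inl_inj]
  rfl

theorem inl_pow_eq_one {y : PSL(2, F)} {n : ℕ} :
    (SemidirectProduct.inl y : L τ) ^ n = 1 ↔ y ^ n = 1 := by
  rw [← map_pow, ← map_one SemidirectProduct.inl, SemidirectProduct.inl_inj]

theorem exists_isCubic (hF : ∀ σ : F ≃+* F, σ ≠ 1 → IsCubic σ) {t : L τ} (ht : proj τ t ≠ 1) :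
    ∃ σ : F ≃+* F, IsCubic σ ∧ t.right.1 = fieldAut σ := by
  obtain ⟨σ, hσ⟩ := exists_eq_fieldAut t.right
  refine ⟨σ, hF σ ?_, hσ⟩
  rintro rfl
  exact ht (Subtype.ext (hσ.trans fieldAut_one))

variable [CharP F 3]

/-- Since `t` commutes with an involution, t³ = 1, and then `t` is conjugate by some `b` to a pure
field automorphism, whose centralizer in PSL₂ is its fixed-point group. The conjugates by `b` of the
fixed involutions form `V`; that of `upper 1` serves as `w`, and that of `weyl` as the element of
`V` not commuting with it. -/
theorem centralizerCondition_proj (hF : ∀ σ : F ≃+* F, σ ≠ 1 → IsCubic σ) :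
    CentralizerCondition (proj τ) := by
  intro t ⟨n, htn⟩ ht q hq hq1 ⟨m, hm, hqm⟩ hqt
  obtain ⟨σ, hσ, htσ⟩ := exists_isCubic hF ht
  obtain ⟨y, rfl⟩ := eq_inl_of_proj_eq_one hq
  have h3 : ∀ {r : PSL(2, F)}, Commute (SemidirectProduct.inl r) t →
      (∃ m : ℕ, m.Coprime 3 ∧ r ^ m = 1) → r ^ 2 = 1 := by
    rintro r hr ⟨m, hm, hrm⟩
    refine (hσ.pow_two_or_pow_three ((commute_inl_iff htσ).1 hr)).elim id fun h => ?_
    rw [eq_one_of_pow_eq_one_of_coprime hrm h hm, one_pow]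
  have hy2 : y ^ 2 = 1 := h3 hqt ⟨m, hm, inl_pow_eq_one.1 hqm⟩
  have hy1 : y ≠ 1 := by
    rintro rfl
    exact hq1 (map_one _)
  have hfirst : ∀ s, proj τ s = 1 → (∃ n, s ^ 3 ^ n = 1) → Commute s (SemidirectProduct.inl y) →
      s = 1 := by
    rintro s hs ⟨k, hk⟩ hsy
    obtain ⟨x, rfl⟩ := eq_inl_of_proj_eq_one hs
    rw [eq_one_of_commute_involution ⟨k, inl_pow_eq_one.1 hk⟩ hy2 hy1
      (commute_inl_inl_iff.1 hsy), map_one]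
  refine ⟨hfirst, ?_⟩
  have hc3 : t.right ^ 3 = 1 := Subtype.ext (by
    rw [SubmonoidClass.coe_pow, htσ, hσ.fieldAut_pow_three, OneMemClass.coe_one])
  have ht3 : t ^ 3 = 1 := by
    refine hfirst _ ((map_pow (proj τ) t 3).trans hc3) ⟨n, ?_⟩ (hqt.pow_right 3).symm
    rw [← pow_mul, mul_comm, pow_mul, htn, one_pow]
  have hleft : t.left * fieldAut σ t.left * fieldAut σ (fieldAut σ t.left) = 1 := by
    have h := congrArg SemidirectProduct.left ht3
    rw [pow_succ, pow_two, SemidirectProduct.mul_left, SemidirectProduct.mul_left,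
      SemidirectProduct.mul_right, map_mul] at h
    have h4 : ∀ z, (zpowers (fieldAut τ)).subtype t.right z = fieldAut σ z := fun z =>
      DFunLike.congr_fun htσ z
    simp only [MulAut.mul_apply, h4] at h
    exact h
  obtain ⟨b, hb⟩ := hσ.exists_eq_mul_fieldAut_inv hleft
  have hcomm : ∀ x, Commute (SemidirectProduct.inl (b * x * b⁻¹)) t ↔ fieldAut σ x = x := by
    intro x
    have ha : t.left = b * (fieldAut σ b)⁻¹ := eq_mul_inv_of_mul_eq hb
    rw [commute_inl_iff htσ, map_mul, map_mul, map_inv, ha]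
    constructor
    · intro h
      have h5 : b * (fieldAut σ x * (fieldAut σ b)⁻¹) = b * (x * (fieldAut σ b)⁻¹) := by
        simpa [mul_assoc] using h
      exact mul_right_cancel (mul_left_cancel h5)
    · intro h
      rw [h]
      group
  refine ⟨(fixedInvolutions hσ).map (SemidirectProduct.inl.comp (MulAut.conj b).toMonoidHom),
    ?_, ?_, SemidirectProduct.inl (b * QuotientGroup.mk (upper 1) * b⁻¹), rfl, ?_, ?_,
    SemidirectProduct.inl (b * QuotientGroup.mk weyl * b⁻¹), ⟨QuotientGroup.mk weyl, ⟨weyl_sq, ?_⟩,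
      rfl⟩, ?_⟩
  · rintro _ ⟨x, hx, rfl⟩
    refine ⟨rfl, (hcomm x).2 hx.2, inl_pow_eq_one.2 ?_⟩
    change (b * x * b⁻¹) ^ 2 = 1
    rw [conj_pow, hx.1, mul_one, mul_inv_cancel]
  · rintro r hr hrt ⟨k, hk, hrk⟩
    obtain ⟨x, rfl⟩ := eq_inl_of_proj_eq_one hr
    have hx : b * (b⁻¹ * x * b) * b⁻¹ = x := by group
    refine ⟨b⁻¹ * x * b, ⟨?_, (hcomm _).1 (by rwa [hx])⟩, congrArg SemidirectProduct.inl hx⟩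
    have h5 := conj_pow (a := b⁻¹) (b := x) (i := 2)
    rw [inv_inv] at h5
    rw [h5, h3 hrt ⟨k, hk, inl_pow_eq_one.1 hrk⟩, mul_one, inv_mul_cancel]
  · rw [hcomm, fieldAut_mk, slAut_upper, map_one]
  · rw [inl_pow_eq_one, conj_pow]
    have h5 : (QuotientGroup.mk (upper 1) : PSL(2, F)) ^ 3 = 1 :=
      congrArg QuotientGroup.mk (upper_pow_three (1 : F))
    rw [h5, mul_one, mul_inv_cancel]
  · rw [fieldAut_mk, slAut_weyl]
  · rw [commute_inl_inl_iff]
    intro h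
    refine not_commute_upper_weyl (F := F) ?_
    exact (Commute.conj_iff b).1 h

theorem eq_one_of_forall_commute (hF : ∀ σ : F ≃+* F, σ ≠ 1 → IsCubic σ) {x : L τ}
    (hx : ∀ s, proj τ s = 1 → Commute s x) : x = 1 := by
  by_cases h : proj τ x = 1
  · obtain ⟨y, rfl⟩ := eq_inl_of_proj_eq_one h
    rw [PSL_eq_one_of_forall_commute fun z => commute_inl_inl_iff.1 (hx _ (proj_inl z)), map_one]
  · exfalso
    obtain ⟨σ, hσ, hxσ⟩ := exists_isCubic hF h
    obtain ⟨t, ht⟩ := hσ.exists_ne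
    -- An element inducing `σ` commutes only with elements of trace 0 or ±1, so a trace moved by `σ`
    -- gives a contradiction.
    obtain ⟨B, hB⟩ : ∃ B : SL(2, F), tr B = t :=
      ⟨⟨!![t, -1; 1, 0], by simp⟩, add_zero t⟩
    have h1 := (commute_inl_iff hxσ).1 (hx _ (proj_inl (QuotientGroup.mk B)))
    obtain ⟨A, hA⟩ := QuotientGroup.mk_surjective x.left
    rw [← hA] at h1
    rcases hσ.tr_eq_zero_or h1 with h2 | h2 <;> rw [hB] at h2
    · exact ht (by rw [h2, map_zero])
    · rcases mul_self_eq_one_iff.1 ((pow_two t).symm.trans h2) with rfl | rfl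
      · exact ht (map_one σ)
      · exact ht (by rw [map_neg, map_one])

end SemidirectProducts

/-! ### The self-normalizing 3-subgroup of L -/

section Unipotent

variable {F : Type*} [Field F] {τ : F ≃+* F}

theorem exists_apply_mk_upper (c : zpowers (fieldAut τ)) (b : F) :
    ∃ b', c.1 (QuotientGroup.mk (upper b)) = QuotientGroup.mk (upper b') := by
  obtain ⟨σ, hσ⟩ := exists_eq_fieldAut c
  exact ⟨σ b, by rw [hσ, fieldAut_mk, slAut_upper]⟩

variable (τ) in
/-- `U ⋊ ⟨φ⟩`, with `U` the group of unitriangular matrices. -/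
def unipotent : Subgroup (L τ) where
  carrier := {l | ∃ b, l.left = QuotientGroup.mk (upper b)}
  one_mem' := ⟨0, by rw [upper_zero]; rfl⟩
  mul_mem' := by
    rintro l m ⟨b, hb⟩ ⟨d, hd⟩
    obtain ⟨d', hd'⟩ := exists_apply_mk_upper l.right d
    refine ⟨b + d', ?_⟩
    rw [SemidirectProduct.mul_left, hb, hd, ← upper_mul_upper]
    exact congrArg (QuotientGroup.mk (upper b) * ·) hd'
  inv_mem' := by
    rintro l ⟨b, hb⟩
    obtain ⟨b', hb'⟩ := exists_apply_mk_upper l.right⁻¹ (-b)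
    refine ⟨b', ?_⟩
    rw [SemidirectProduct.inv_left, hb, ← hb', ← upper_inv]
    rfl

theorem inl_mem_unipotent {y : PSL(2, F)} :
    (SemidirectProduct.inl y : L τ) ∈ unipotent τ ↔ ∃ b, y = QuotientGroup.mk (upper b) := Iff.rfl

theorem exists_mem_unipotent (c : zpowers (fieldAut τ)) : ∃ q ∈ unipotent τ, proj τ q = c :=
  ⟨SemidirectProduct.inr c, ⟨0, by rw [upper_zero]; rfl⟩, rfl⟩

theorem pow_three_eq_one (hτ : IsCubic τ) (c : zpowers (fieldAut τ)) : c ^ 3 = 1 := by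
  obtain ⟨k, hk⟩ := mem_zpowers_iff.1 c.2
  refine Subtype.ext ?_
  rw [SubmonoidClass.coe_pow, ← hk, ← zpow_natCast, zpow_comm, zpow_natCast,
    hτ.fieldAut_pow_three, one_zpow]
  rfl

variable [CharP F 3]

theorem isPGroup_unipotent (hτ : IsCubic τ) : IsPGroup 3 (unipotent τ) := by
  rintro ⟨l, hl⟩
  refine ⟨2, Subtype.ext ?_⟩
  have h1 : proj τ (l ^ 3) = 1 := by rw [map_pow, pow_three_eq_one hτ]
  obtain ⟨y, hy⟩ := eq_inl_of_proj_eq_one h1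
  have h2 : l ^ 3 ∈ unipotent τ := pow_mem hl 3
  rw [hy, inl_mem_unipotent] at h2
  obtain ⟨b, rfl⟩ := h2
  have h3 : (QuotientGroup.mk (upper b) : PSL(2, F)) ^ 3 = 1 :=
    congrArg QuotientGroup.mk (upper_pow_three b)
  change l ^ 3 ^ 2 = 1
  rw [pow_two, pow_mul, hy, inl_pow_eq_one, h3]

theorem mem_unipotent_of_mem_normalizer (hτ : IsCubic τ) {x : L τ} (hx : proj τ x = 1)
    (hn : x ∈ normalizer (unipotent τ : Set (L τ))) : x ∈ unipotent τ := by
  have h2 : (2 : F) ≠ 0 := two_ne_zero_of_char_three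
  obtain ⟨a, rfl⟩ := eq_inl_of_proj_eq_one hx
  obtain ⟨A, rfl⟩ := QuotientGroup.mk_surjective a
  have hd := det_eq A
  -- Conjugating `upper 1` must give a unitriangular matrix again, up to sign, so `A` is upper
  -- triangular.
  have h10 : A 1 0 = 0 := by
    have h1 := (mem_normalizer_iff.1 hn (SemidirectProduct.inl (QuotientGroup.mk (upper 1)))).1
      ⟨1, rfl⟩
    rw [← map_inv, ← map_mul, ← map_mul, inl_mem_unipotent] at h1
    obtain ⟨b, hb⟩ := h1
    rw [mul_inv_eq_iff_eq_mul] at hb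
    have hb' : A * upper 1 = upper b * A ∨ A * upper 1 = -(upper b * A) := mk_eq_mk_iff.1 hb
    rcases hb' with h | h
    · have h11 : (A * upper 1 : SL(2, F)) 1 1 = (upper b * A : SL(2, F)) 1 1 := by rw [h]
      rw [mul_apply_one_one, mul_apply_one_one, upper_zero_one, upper_one_one,
        upper_one_zero, upper_one_one] at h11
      linear_combination h11
    · have h00 : (A * upper 1 : SL(2, F)) 1 0 = (-(upper b * A) : SL(2, F)) 1 0 := by rw [h]
      rw [neg_apply, mul_apply_one_zero, mul_apply_one_zero, upper_zero_zero, upper_one_one,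
        upper_one_zero, upper_one_zero] at h00
      have h3 : 2 * A 1 0 = 0 := by linear_combination h00
      exact (mul_eq_zero.1 h3).resolve_left h2
  rw [h10, mul_zero, sub_zero] at hd
  -- Conjugating φ must stay in the subgroup, so `A` and its image under `τ` differ, up to sign, by
  -- a unitriangular factor. Hence `τ` fixes or negates the diagonal entry; being non-zero, the
  -- entry is ±1.
  have h11 : A 1 1 = 1 ∨ A 1 1 = -1 := by
    have hA0 : A 1 1 ≠ 0 := fun h => by
      rw [h, mul_zero] at hd
      exact zero_ne_one hd
    have h1 := (mem_normalizer_iff.1 hn (phi τ)).1 ⟨0, by rw [upper_zero]; rfl⟩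
    obtain ⟨b, hb⟩ := h1
    have h3 : (SemidirectProduct.inl (QuotientGroup.mk A) * phi τ *
        (SemidirectProduct.inl (QuotientGroup.mk A))⁻¹ : L τ).left =
        QuotientGroup.mk A * (fieldAut τ (QuotientGroup.mk A))⁻¹ := by
      rw [← map_inv, SemidirectProduct.mul_left, SemidirectProduct.mul_left,
        SemidirectProduct.mul_right, SemidirectProduct.left_inl, SemidirectProduct.left_inl,
        SemidirectProduct.right_inl, one_mul, ← map_inv (fieldAut τ)]
      have h4 : (phi τ).left = 1 := rfl
      rw [h4, map_one, mul_one]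
      rfl
    rw [h3, mul_inv_eq_iff_eq_mul, fieldAut_mk] at hb
    have hb' : A = upper b * slAut τ A ∨ A = -(upper b * slAut τ A) := mk_eq_mk_iff.1 hb
    have h5 : (upper b * slAut τ A) 1 1 = τ (A 1 1) := by
      rw [mul_apply_one_one, slAut_apply, slAut_apply, upper_one_zero, upper_one_one]
      ring
    rcases hb' with h | h
    · have h6 : A 1 1 = (upper b * slAut τ A) 1 1 := by rw [← h]
      rw [h5] at h6
      exact (hτ.eq_zero_or h6.symm).resolve_left hA0
    · have h6 : A 1 1 = (-(upper b * slAut τ A)) 1 1 := by rw [← h]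
      rw [neg_apply, h5] at h6
      exact absurd (hτ.eq_zero_of_apply_eq_neg (by rw [← neg_eq_iff_eq_neg, ← h6])) hA0
  rw [inl_mem_unipotent]
  rcases h11 with h | h <;> rw [h] at hd
  · refine ⟨A 0 1, congrArg QuotientGroup.mk (SL2_ext ?_ rfl h10 h)⟩
    rw [upper_zero_zero]
    linear_combination hd
  · refine ⟨-A 0 1, mk_eq_mk_iff.2 (Or.inr (SL2_ext ?_ ?_ ?_ ?_))⟩
    · rw [neg_apply, upper_zero_zero]
      linear_combination -hd
    · rw [neg_apply, upper_zero_one, neg_neg]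
    · rw [neg_apply, upper_one_zero, neg_zero, h10]
    · rw [neg_apply, upper_one_one, h]

end Unipotent

/-! ### Identification of G with `twist (proj τ)`, and its kernel PSL₂ -/

section Projection

variable {F : Type*} [Field F] {τ : F ≃+* F}

/-- The kernel of the projection of `L` is `PSL₂(F)`. -/
noncomputable def kerProjEquiv (τ : F ≃+* F) : PSL(2, F) ≃* (proj τ).ker :=
  (MonoidHom.ofInjective SemidirectProduct.inl_injective).trans
    (MulEquiv.subgroupCongr SemidirectProduct.range_inl_eq_ker_rightHom)

theorem mem_zpowers_of_ne_one {c d : zpowers (fieldAut τ)}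
    (h3 : ∀ e : zpowers (fieldAut τ), e ^ 3 = 1) (hc : c ≠ 1) : d ∈ zpowers c := by
  have h1 : orderOf (fieldAut τ) ∣ 3 := orderOf_dvd_of_pow_eq_one
    (congrArg Subtype.val (h3 ⟨fieldAut τ, mem_zpowers _⟩))
  have : Fact (Nat.Prime 3) := ⟨Nat.prime_three⟩
  have h2 : Nat.card (zpowers (fieldAut τ)) = 3 := by
    rw [Nat.card_zpowers]
    refine ((Nat.dvd_prime Nat.prime_three).1 h1).resolve_left fun h => hc ?_
    rw [orderOf_eq_one_iff] at h
    obtain ⟨k, hk⟩ := mem_zpowers_iff.1 c.2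
    exact Subtype.ext (hk.symm.trans (by rw [h, one_zpow, OneMemClass.coe_one]))
  exact mem_zpowers_of_prime_card h2 hc

theorem eq_twist (τ : F ≃+* F) : G τ = twist (proj τ) := by
  apply le_antisymm
  · refine sup_le (sup_le ?_ ?_) ?_
    · rintro _ ⟨f, hf, rfl⟩
      obtain ⟨a, ha⟩ := hf 0 trivial
      obtain ⟨b, hb⟩ := hf 1 trivial
      change proj τ (f 0) * proj τ (f 1) = 1
      rw [← ha, ← hb, proj_inl, proj_inl, one_mul]
    · rw [zpowers_le]
      change pr (phi τ) (phi τ)⁻¹ ∈ twist (proj τ)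
      rw [pr_mem_twist, map_inv, mul_inv_cancel]
    · rintro _ ⟨σ, rfl⟩
      change proj τ 1 * proj τ 1 = 1
      rw [map_one, one_mul]
  · have hsw : (sw : Wr (L τ)) ∈ G τ := mem_sup_right ⟨_, rfl⟩
    -- Such a pair is an element of `H` times a power of (φ, φ⁻¹): the condition forces opposite
    -- exponents of φ in the two coordinates.
    have hpr : ∀ x y : L τ, proj τ x * proj τ y = 1 → pr x y ∈ G τ := by
      intro x y hxy
      refine mem_sup_left ?_
      obtain ⟨k, hk⟩ := mem_zpowers_iff.1 x.right.2
      have hx : x = SemidirectProduct.inl x.left * phi τ ^ k := by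
        rw [phi, ← map_zpow]
        refine (SemidirectProduct.inl_left_mul_inr_right x).symm.trans ?_
        congr 2
        exact Subtype.ext hk.symm
      have hy : y = SemidirectProduct.inl y.left * (phi τ)⁻¹ ^ k := by
        rw [inv_zpow, phi, ← map_zpow, ← map_inv]
        refine (SemidirectProduct.inl_left_mul_inr_right y).symm.trans ?_
        congr 2
        have h1 : y.right = x.right⁻¹ := eq_inv_of_mul_eq_one_right hxy
        rw [h1]
        congr 1
        exact Subtype.ext hk.symm
      have h1 : pr x y = pr (SemidirectProduct.inl x.left) (SemidirectProduct.inl y.left) *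
          pr (phi τ) (phi τ)⁻¹ ^ k := by
        have h2 : pr (phi τ) (phi τ)⁻¹ ^ k = pr (phi τ ^ k) ((phi τ)⁻¹ ^ k) :=
          (map_zpow prHom (phi τ, (phi τ)⁻¹) k).symm
        rw [h2, pr_mul, ← hx, ← hy]
      rw [h1]
      refine mul_mem (mem_sup_left ⟨_, ?_, rfl⟩) (mem_sup_right (zpow_mem (mem_zpowers _) k))
      intro i _
      fin_cases i
      · exact ⟨x.left, rfl⟩
      · exact ⟨y.left, rfl⟩
    intro g hg
    obtain ⟨x, y, rfl | rfl⟩ := eq_pr_or g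
    · exact hpr x y (pr_mem_twist.1 hg)
    · exact mul_mem (hpr x y (pr_mul_sw_mem_twist.1 hg)) hsw

theorem inf_eq_twistBase (τ : F ≃+* F) : G τ ⊓ M τ = twistBase (proj τ) := by
  rw [eq_twist, M, SemidirectProduct.range_inl_eq_ker_rightHom]
  rfl

instance [Finite F] (τ : F ≃+* F) : Finite (L τ) := by
  have : Finite SL(2, F) := Subtype.finite
  have : Finite PSL(2, F) := Quotient.finite _
  have : Finite (zpowers (fieldAut τ)) := by
    have : Finite (MulAut PSL(2, F)) := Finite.of_injective (fun f => (f : PSL(2, F) → PSL(2, F)))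
      DFunLike.coe_injective
    exact Subtype.finite
  exact Finite.of_equiv _ SemidirectProduct.equivProd.symm

theorem isSimpleGroup_ker_proj [Finite F] (hF : 4 ≤ Nat.card F) : IsSimpleGroup (proj τ).ker := by
  have := Matrix.ProjectiveSpecialLinearGroup.rank_two_simple hF
  exact (kerProjEquiv τ).symm.isSimpleGroup

theorem not_hasCarter_ker_proj [Finite F] [CharP F 3] (hF : 4 ≤ Nat.card F)
    (hsq : ∀ a : F, a ^ 2 ≠ 2) : ¬ HasCarter (proj τ).ker := by
  have := Matrix.ProjectiveSpecialLinearGroup.rank_two_simple hF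
  have : Finite SL(2, F) := Subtype.finite
  have : Finite PSL(2, F) := Quotient.finite _
  intro h
  exact not_hasCarter_of_centralizers (Γ := PSL(2, F)) ⟨_, _, not_commute_upper_weyl⟩
    (PSL_commute_of_commute two_ne_zero_of_char_three)
    (PSL_sq_eq_one_of_pow_four two_ne_zero_of_char_three hsq) (h.of_mulEquiv (kerProjEquiv τ).symm)

end Projection

/-! ### The field with 27 elements -/

section GaloisField

theorem pow_card_galoisField (x : GaloisField 3 3) : x ^ 27 = x := by
  have := Fintype.ofFinite (GaloisField 3 3)
  have h := FiniteField.pow_card x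
  rwa [← Nat.card_eq_fintype_card, GaloisField.card 3 3 (by norm_num)] at h

theorem sq_ne_two_galoisField (a : GaloisField 3 3) : a ^ 2 ≠ 2 := by
  intro h
  rw [two_eq_neg_one] at h
  have h1 := pow_card_galoisField a
  -- With a² = -1 the odd exponent 13 gives a²⁷ = -a, while a²⁷ = a.
  have h2 : a ^ 27 = (a ^ 2) ^ 13 * a := by ring
  rw [h2, h] at h1
  have h3 : (2 : GaloisField 3 3) * a = 0 := by linear_combination -h1
  have h4 := (mul_eq_zero.1 h3).resolve_left two_ne_zero_of_char_three
  rw [h4] at h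
  simp at h

/-- An automorphism is a power x ↦ x^(3^n) of Frobenius with n < 3, and n ≠ 0 here. For n = 2 a
fixed x satisfies x³ = (x⁹)³ = x²⁷ = x. -/
theorem isCubic_galoisField (σ : GaloisField 3 3 ≃+* GaloisField 3 3) (hσ : σ ≠ 1) :
    IsCubic σ := by
  have h0 : ∀ r : ZMod 3, σ (algebraMap (ZMod 3) (GaloisField 3 3) r) =
      algebraMap (ZMod 3) (GaloisField 3 3) r := fun r =>
    RingHom.congr_fun (Subsingleton.elim
      ((σ : GaloisField 3 3 →+* GaloisField 3 3).comp (algebraMap (ZMod 3) (GaloisField 3 3)))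
      (algebraMap (ZMod 3) (GaloisField 3 3))) r
  obtain ⟨⟨n, hn⟩, h⟩ := (FiniteField.bijective_frobeniusAlgEquivOfAlgebraic_pow (ZMod 3)
    (GaloisField 3 3)).2 (AlgEquiv.ofRingEquiv h0)
  rw [GaloisField.finrank 3 (by norm_num)] at hn
  have hn' : ∀ x, σ x = x ^ 3 ^ n := by
    intro x
    have h1 := DFunLike.congr_fun h x
    have h2 := congrFun (FiniteField.coe_frobeniusAlgEquivOfAlgebraic_iterate (ZMod 3)
      (GaloisField 3 3) n) x
    rw [ZMod.card] at h2
    rw [← h2, ← AlgEquiv.coe_pow]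
    exact h1.symm
  have h27 : ∀ x : GaloisField 3 3, x ^ 27 = x := pow_card_galoisField
  have hex : ∃ x, σ x ≠ x := by
    by_contra! h
    exact hσ (RingEquiv.ext h)
  have h729 : ∀ x : GaloisField 3 3, x ^ 729 = x := fun x => by
    have h3 : x ^ 729 = (x ^ 27) ^ 27 := by ring
    rw [h3, h27, h27]
  interval_cases n
  · exact absurd (RingEquiv.ext fun x => by rw [hn' x, pow_zero, pow_one]; rfl) hσ
  · refine ⟨fun x => ?_, fun x hx => ?_, hex⟩
    · rw [hn', hn', hn', ← pow_mul, ← pow_mul]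
      exact h27 x
    · rw [hn', pow_one] at hx
      exact hx
  · refine ⟨fun x => ?_, fun x hx => ?_, hex⟩
    · rw [hn', hn', hn', ← pow_mul, ← pow_mul]
      exact h729 x
    · rw [hn'] at hx
      have h3 : (x ^ 3 ^ 2) ^ 3 = x ^ 27 := by ring
      rw [hx, h27] at h3
      exact h3

theorem exists_ne_refl_galoisField :
    ∃ σ : GaloisField 3 3 ≃+* GaloisField 3 3, σ ≠ RingEquiv.refl (GaloisField 3 3) := by
  refine ⟨(FiniteField.frobeniusAlgEquivOfAlgebraic (ZMod 3) (GaloisField 3 3)).toRingEquiv,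
    fun h => ?_⟩
  have h1 : FiniteField.frobeniusAlgEquivOfAlgebraic (ZMod 3) (GaloisField 3 3) = 1 :=
    AlgEquiv.ext fun x => RingEquiv.congr_fun h x
  have h2 := FiniteField.orderOf_frobeniusAlgEquivOfAlgebraic (ZMod 3) (GaloisField 3 3)
  rw [h1, orderOf_one, GaloisField.finrank 3 (by norm_num)] at h2
  norm_num at h2

end GaloisField

theorem isMulCommutative_quotient_twistBase {A C : Type*} [Group A] [CommGroup C] (π : A →* C)
    [((twistBase π).subgroupOf (twist π)).Normal]
    (a b : twist π ⧸ (twistBase π).subgroupOf (twist π)) : a * b = b * a := by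
  induction a using QuotientGroup.induction_on with | H x
  induction b using QuotientGroup.induction_on with | H y
  refine QuotientGroup.eq.2 ?_
  have h := commutator_mem_twistBase (π := π) y.2 x.2
  rw [mem_subgroupOf]
  change ((x : Wr A) * y)⁻¹ * (y * x) ∈ twistBase π
  rwa [mul_inv_rev, ← mul_assoc]

theorem isNilpotent_of_forall_comm {A : Type*} [Group A] (h : ∀ a b : A, a * b = b * a) :
    Group.IsNilpotent A := by
  let : CommGroup A := { (inferInstance : Group A) with mul_comm := h }
  infer_instance

theorem twist_proj_galoisField (τ : GaloisField 3 3 ≃+* GaloisField 3 3) (hτ : IsCubic τ) :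
    CompositionFactorCondition (twist (proj τ)) ∧
      HasCarter ((twistBase (proj τ)).subgroupOf (twist (proj τ))) ∧
      ¬ HasCarter (twist (proj τ)) ∧
      ∀ D : ConditionEData (twist (proj τ)), ¬ D.Holds := by
  have hF : 4 ≤ Nat.card (GaloisField 3 3) := by
    rw [GaloisField.card 3 3 (by norm_num)]
    norm_num
  have := isSimpleGroup_ker_proj (τ := τ) hF
  have hS := not_hasCarter_ker_proj (τ := τ) hF sq_ne_two_galoisField
  have h3 := pow_three_eq_one hτ
  have hz : ∀ a b : zpowers (fieldAut τ), a ≠ 1 → b ∈ zpowers a := fun a b ha =>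
    mem_zpowers_of_ne_one h3 ha
  have hZ : ∀ x : L τ, (∀ s, proj τ s = 1 → Commute s x) → x = 1 := fun x hx =>
    eq_one_of_forall_commute isCubic_galoisField hx
  obtain ⟨P, hP3, hP⟩ := isCarterIn_twistBase (isPGroup_unipotent hτ) exists_mem_unipotent
    fun x hx hn => mem_unipotent_of_mem_normalizer hτ hx hn
  exact ⟨compositionFactorCondition_twist hZ hP3 hP,
    hasCarter_of_relative hP.le hP.nilpotent hP.self,
    not_hasCarter_twist h3 hz hS (centralizerCondition_proj isCubic_galoisField),
    not_holds_twist h3 hz hZ hS⟩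

end CarterExample

theorem mainTheorem2 :
    (∀ τ : GaloisField 3 3 ≃+* GaloisField 3 3, τ ≠ RingEquiv.refl (GaloisField 3 3) →
      CarterExample.CompositionFactorCondition (CarterExample.G τ) ∧
      (∃ _ : ((CarterExample.G τ ⊓ CarterExample.M τ).subgroupOf (CarterExample.G τ)).Normal,
        CarterExample.HasCarter
          ((CarterExample.G τ ⊓ CarterExample.M τ).subgroupOf (CarterExample.G τ)) ∧
        Group.IsNilpotent (CarterExample.G τ ⧸
          (CarterExample.G τ ⊓ CarterExample.M τ).subgroupOf (CarterExample.G τ))) ∧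
      ¬ CarterExample.HasCarter (CarterExample.G τ) ∧
      ∀ D : CarterExample.ConditionEData (CarterExample.G τ), ¬ D.Holds) ∧
    (∃ (Γ : Type) (_ : Group Γ), Finite Γ ∧ CarterExample.CompositionFactorCondition Γ ∧
      ¬ CarterExample.HasCarter Γ ∧ ∀ D : CarterExample.ConditionEData Γ, ¬ D.Holds) ∧
    (∃ (Γ : Type) (_ : Group Γ) (N : Subgroup Γ) (_ : N.Normal), Finite Γ ∧
      CarterExample.HasCarter N ∧ CarterExample.HasCarter (Γ ⧸ N) ∧
      ¬ CarterExample.HasCarter Γ) := by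
  obtain ⟨σ, hσ⟩ := CarterExample.exists_ne_refl_galoisField
  obtain ⟨h1, h2, h3, h4⟩ := CarterExample.twist_proj_galoisField σ
    (CarterExample.isCubic_galoisField σ hσ)
  have hn : ∀ τ : GaloisField 3 3 ≃+* GaloisField 3 3,
      ((CarterExample.twistBase (CarterExample.proj τ)).subgroupOf
        (CarterExample.twist (CarterExample.proj τ))).Normal :=
    fun τ => CarterExample.normal_twistBase
  refine ⟨fun τ hτ => ?_, ⟨_, _, inferInstance, h1, h3, h4⟩, ⟨_, _, _, hn σ, inferInstance, h2,
    CarterExample.hasCarter_of_commute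
      (CarterExample.isMulCommutative_quotient_twistBase (CarterExample.proj σ)), h3⟩⟩
  rw [CarterExample.inf_eq_twistBase, CarterExample.eq_twist]
  obtain ⟨h1, h2, h3, h4⟩ := CarterExample.twist_proj_galoisField τ
    (CarterExample.isCubic_galoisField τ hτ)
  exact ⟨h1, ⟨hn τ, h2, CarterExample.isNilpotent_of_forall_comm
    (CarterExample.isMulCommutative_quotient_twistBase (CarterExample.proj τ))⟩, h3, h4⟩
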